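/- **Notation.** Let $\mathfrak X_n=\{(x_1,\dots,x_n)\in\mathbb R^n: x_1<\dots<x_n\}$. For $\varsigma=(s_1,\dots,s_p)$, let $\mathrm{LP}_\varsigma$ be the set of planar link patterns of $p$ points with index valences $\varsigma$: finite collections (repetitions allowed) of links $\{a,b\}$ with $a\ne b$ in $\{1,\dots,p\}$ such that each $i$ is an endpoint of exactly $s_i$ links and no two links $\{a,b\},\{c,d\}$ satisfy $a<c<b<d$. Let $\mathrm{LP}_N:=\mathrm{LP}_{(1,\dots,1)}$ ($2N$ points) be the set of planar pair partitions. A planar pair partition is written $\alpha=\{\{a_1,b_1\},\dots,\{a_N,b_N\}\}$ with $a_1<\dots<a_N$ and $a_i<b_i$; put $\vartheta_\alpha(i,j)=1$ if $i,j\in\{a_1,\dots,a_N\}$ or $i,j\in\{b_1,\dots,b_N\}$, and $\vartheta_\alpha(i,j)=-1$ otherwise. The conformal block functions are $$\mathcal U_\alpha(x_1,\dots,x_{2N})=\prod_{1\le i<j\le 2N}(x_j-x_i)^{\frac12\vartheta_\alpha(i,j)}.$$ Let $\mathcal M_{\alpha,\beta}=1$ if $\beta=\{\{a_1,b_{\sigma(1)}\},\dots,\{a_N,b_{\sigma(N)}\}\}$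 for some permutation $\sigma$, and $\mathcal M_{\alpha,\beta}=0$ otherwise. The pure partition functions for $\kappa=4$ are $$\mathcal Z_\alpha=\sum_{\beta\in\mathrm{LP}_N}\mathcal M^{-1}_{\alpha,\beta}\,\mathcal U_\beta ,\qquad \alpha\in\mathrm{LP}_N .$$ A function $F$ on $\mathfrak X_n$ is called Möbius covariant with weight $w$ if $F(x_1,\dots,x_n)=\prod_{i}\varphi'(x_i)^{w}\,F(\varphi(x_1),\dots,\varphi(x_n))$ for all $(x_1,\dots,x_n)\in\mathfrak X_n$ and all Möbius maps $\varphi$ of the upper half-plane, finite at the points $x_i$, with $\varphi(x_1)<\dots<\varphi(x_n)$. **Proposition 1.2.** The functions $\mathcal Z_\alpha$ are pure partition functions of multiple $\mathrm{SLE}_4$. That is, with $h=\frac14$, one has $\mathcal Z_\emptyset=1$, and for all $N$ and all $\alpha\in\mathrm{LP}_N$: * $\mathcal Z_\alpha:\mathfrak X_{2N}\to\mathbb R_{>0}$ is smooth, and for all $j$ $$\Big[2\,\partial_{x_j}^2+\sum_{i\ne j}\Big(\frac{2}{x_i-x_j}\partial_{x_i}-\frac{2h}{(x_i-x_j)^2}\Big)\Big]\mathcal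 Z_\alpha=0;$$ * $\mathcal Z_\alpha$ is Möbius covariant with weight $h$; * for $1\le j\le 2N-1$ and $\xi\in(x_{j-1},x_{j+2})$, as $x_j<x_{j+1}$ tend to $\xi$ and the other variables are fixed, $(x_{j+1}-x_j)^{2h}\mathcal Z_\alpha(x_1,\dots,x_{2N})$ tends to $0$ if $\{j,j+1\}\notin\alpha$, and to $\mathcal Z_{\alpha/\{j,j+1\}}(x_1,\dots,x_{j-1},x_{j+2},\dots,x_{2N})$ if $\{j,j+1\}\in\alpha$, where $\alpha/\{j,j+1\}$ is obtained by removing the link $\{j,j+1\}$ and relabelling; * there are $C,q>0$ such that $|\mathcal Z_\alpha|\le C\prod_{i<j}(x_j-x_i)^{\mu_{ij}}$ on $\mathfrak X_{2N}$, where $\mu_{ij}=q$ if $|x_j-x_i|>1$ and $\mu_{ij}=-q$ otherwise. Moreover, let $N\ge1$ and $\hat\alpha\in\mathrm{LP}_{(2,\dots,2)}$, where the index has length $2N$. Let $\alpha=\tau(\hat\alpha)$ be the planar pair partition of $4N$ points obtained by splitting each point $j$ of $\hat\alpha$ into two points $2j-1,2j$ and attaching one of the two links ending at $j$ to each of them.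 Then for all $(y_1,\dots,y_{2N})\in\mathfrak X_{2N}$ the limit $$\mathcal Z_{\hat\alpha}(y_1,\dots,y_{2N})=\lim_{\substack{x_{2j-1},x_{2j}\to y_j\\ 1\le j\le 2N}}\frac{\mathcal Z_{\alpha}(x_1,\dots,x_{4N})}{\prod_{j=1}^{2N}(x_{2j}-x_{2j-1})^{1/2}}$$ along $x_1<\dots<x_{4N}$ exists and is positive; the function $\mathcal Z_{\hat\alpha}:\mathfrak X_{2N}\to\mathbb R_{>0}$ is smooth, and with $\kappa=4$ and $H=1$: * for all $j\in\{1,\dots,2N\}$, $$\Big[\frac{\partial^3}{\partial y_j^3}-\frac{16}{\kappa}\mathcal L^{(j)}_{-2}\frac{\partial}{\partial y_j}+\frac{8(8-\kappa)}{\kappa^2}\mathcal L^{(j)}_{-3}\Big]\mathcal Z_{\hat\alpha}(y_1,\dots,y_{2N})=0,$$ where $$\mathcal L^{(j)}_{-2}=\sum_{i\ne j}\Big(\frac{H}{(y_i-y_j)^2}-\frac1{y_i-y_j}\frac{\partial}{\partial y_i}\Big),\qquad \mathcal L^{(j)}_{-3}=\sum_{i\ne j}\Big(\frac{2H}{(y_i-y_j)^3}-\frac1{(y_i-y_j)^2}\frac{\partial}{\partial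 y_i}\Big);$$ * $\mathcal Z_{\hat\alpha}$ is Möbius covariant with weight $H$. -/

import Mathlib

open Filter Topology
open scoped ContDiff

/-! ### Planar link patterns -/

/-- Planar link patterns of `p` points with index valences `s`.  The points are `0 < 1 < ⋯ < p - 1`,
in this order along the boundary.  A link is written `(a, b)` with `a < b`; links may be repeated.
The point `i` is an endpoint of exactly `s i` links, and no two links cross, that is, there are no
links `(a, b)` and `(c, d)` with `a < c < b < d`. -/
@[ext]
structure LinkPattern {p : ℕ} (s : Fin p → ℕ) where
  links : Multiset (Fin p × Fin p)
  lt : ∀ l ∈ links, l.1 < l.2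
  valence : ∀ i, links.countP (fun l => l.1 = i ∨ l.2 = i) = s i
  planar : ∀ l ∈ links, ∀ m ∈ links, ¬ (l.1 < m.1 ∧ m.1 < l.2 ∧ l.2 < m.2)

/-- Planar pair partitions of `2 N` points: all valences are equal to one. -/
abbrev PairPartition (N : ℕ) : Type := LinkPattern (fun _ : Fin (2 * N) => 1)

theorem LinkPattern.links_le {p : ℕ} {s : Fin p → ℕ} (α : LinkPattern s) :
    α.links ≤ ∑ l : Fin p × Fin p, s l.1 • ({l} : Multiset (Fin p × Fin p)) := by
  classical
  rw [Multiset.le_iff_count]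
  intro l
  have h1 : α.links.count l ≤ s l.1 := by
    rw [← α.valence l.1]
    unfold Multiset.count
    rw [Multiset.countP_eq_card_filter, Multiset.countP_eq_card_filter]
    apply Multiset.card_le_card
    apply Multiset.monotone_filter_right
    intro m hm
    left
    rw [← hm]
  refine h1.trans ?_
  rw [Multiset.count_sum']
  refine le_trans ?_ (Finset.single_le_sum
    (f := fun x : Fin p × Fin p => Multiset.count l (s x.1 • ({x} : Multiset (Fin p × Fin p))))
    (fun _ _ => Nat.zero_le _) (Finset.mem_univ l))
  simp

instance LinkPattern.finite {p : ℕ} (s : Fin p → ℕ) : Finite (LinkPattern s) := by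
  classical
  have hfin : (Set.Iic
    (∑ l : Fin p × Fin p, s l.1 • ({l} : Multiset (Fin p × Fin p)))).Finite := Set.finite_Iic _
  have : Finite (Set.Iic
    (∑ l : Fin p × Fin p, s l.1 • ({l} : Multiset (Fin p × Fin p)))) := hfin
  exact Finite.of_injective
    (fun α : LinkPattern s => (⟨α.links, α.links_le⟩ : Set.Iic
      (∑ l : Fin p × Fin p, s l.1 • ({l} : Multiset (Fin p × Fin p)))))
    (fun α β h => LinkPattern.ext (congrArg Subtype.val h))

noncomputable instance LinkPattern.fintype {p : ℕ} (s : Fin p → ℕ) : Fintype (LinkPattern s) :=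
  Fintype.ofFinite _

noncomputable instance LinkPattern.decEq {p : ℕ} (s : Fin p → ℕ) : DecidableEq (LinkPattern s) :=
  Classical.decEq _

/-! ### Splitting the points of a link pattern with valences `(2, …, 2)` -/

/-- The points `2 j` and `2 j + 1` are the two points into which `j` is split. -/
def halve {n : ℕ} (k : Fin (2 * n)) : Fin n := ⟨k / 2, by omega⟩

/-- `α` is obtained from `a` by splitting each point `j` into the two points `2 j`, `2 j + 1` and
attaching to each of them one of the two links ending at `j`. -/
def IsSplitting {n : ℕ} (a : LinkPattern (fun _ : Fin n => 2)) (α : PairPartition n) : Prop :=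
  α.links.map (Prod.map halve halve) = a.links

theorem exists_isSplitting {n : ℕ} (a : LinkPattern (fun _ : Fin n => 2)) :
    ∃ α : PairPartition n, IsSplitting a α := by
  classical
  obtain ⟨m, e, he⟩ : ∃ (m : ℕ) (e : Fin m → Fin n × Fin n),
      a.links = (Finset.univ : Finset (Fin m)).val.map e := by
    refine Quotient.inductionOn a.links fun L => ⟨L.length, L.get, ?_⟩
    simp [Fin.univ_def, List.map_get_finRange]
  have hmem : ∀ i, e i ∈ a.links := fun i => by
    rw [he]; exact Multiset.mem_map_of_mem _ (Finset.mem_univ_val i)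
  have hlt : ∀ i, (e i).1 < (e i).2 := fun i => a.lt _ (hmem i)
  -- half-edges, the points they end at, and their order at a common endpoint
  let vert : Fin m × Bool → Fin n := fun h => if h.2 then (e h.1).2 else (e h.1).1
  let key : Fin m × Bool → ℕ ×ₗ ℕ ×ₗ ℕ := fun h =>
    if h.2 then toLex (0, toLex (n - (e h.1).1, (h.1 : ℕ)))
    else toLex (1, toLex (n - (e h.1).2, m - (h.1 : ℕ)))
  have key_inj : Function.Injective key := by
    rintro ⟨i, b⟩ ⟨j, c⟩ h
    cases b <;> cases c <;> simp [key, Prod.ext_iff] at h ⊢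
    · apply Fin.ext; omega
    · apply Fin.ext; omega
  have card_fib : ∀ v, (Finset.univ.filter fun h => vert h = v).card = 2 := by
    intro v
    have hv := a.valence v
    rw [he, Multiset.countP_map] at hv
    have h1 : (Finset.univ.filter fun h => vert h = v)
        = (Finset.univ.filter fun i => (e i).1 = v ∨ (e i).2 = v).image
          (fun i => (i, decide ((e i).2 = v))) := by
      ext ⟨i, b⟩
      have := hlt i
      cases b <;> simp [vert] <;> grind
    rw [h1, Finset.card_image_of_injective _ (fun i j h => (Prod.ext_iff.1 h).1)]
    rw [← hv]; rfl
  let rank : Fin m × Bool → ℕ := fun h =>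
    (Finset.univ.filter fun h' => vert h' = vert h ∧ key h' < key h).card
  have rank_lt : ∀ h, rank h < 2 := by
    intro h
    rw [← card_fib (vert h)]
    apply Finset.card_lt_card
    refine ⟨fun x hx => ?_, fun hs => ?_⟩
    · simp only [Finset.mem_filter, Finset.mem_univ, true_and] at hx ⊢; exact hx.1
    · have := hs (show h ∈ Finset.univ.filter (fun h' => vert h' = vert h) by simp)
      simp at this
  have rank_mono : ∀ h h', vert h = vert h' → key h < key h' → rank h < rank h' := by
    intro h h' hv hk
    apply Finset.card_lt_card
    refine ⟨fun x hx => ?_, fun hs => ?_⟩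
    · simp only [Finset.mem_filter, Finset.mem_univ, true_and] at hx ⊢
      exact ⟨hx.1.trans hv, hx.2.trans hk⟩
    · have := hs (show h ∈ Finset.univ.filter
        (fun x => vert x = vert h' ∧ key x < key h') by simp [hv, hk])
      simp at this
  let pos : Fin m × Bool → Fin (2 * n) := fun h =>
    ⟨2 * (vert h : ℕ) + rank h, by have := rank_lt h; have := (vert h).2; omega⟩
  have halve_pos : ∀ h, halve (pos h) = vert h := by
    intro h
    have := rank_lt h
    apply Fin.ext
    simp only [halve, pos]
    omega
  have pos_inj : Function.Injective pos := by
    intro h h' hh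
    have hv : vert h = vert h' := by rw [← halve_pos, ← halve_pos, hh]
    have hr : rank h = rank h' := by
      have := congrArg Fin.val hh
      simp only [pos, hv] at this
      omega
    rcases lt_trichotomy (key h) (key h') with hk | hk | hk
    · have := rank_mono h h' hv hk; omega
    · exact key_inj hk
    · have := rank_mono h' h hv.symm hk; omega
  have hcard : Fintype.card (Fin m × Bool) = Fintype.card (Fin (2 * n)) := by
    rw [← Finset.card_univ, Finset.card_eq_sum_card_fiberwise (f := vert) (t := Finset.univ)
      (fun _ _ => Finset.mem_coe.2 (Finset.mem_univ _))]
    simp only [card_fib]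
    simp [mul_comm]
  have pos_bij : Function.Bijective pos :=
    (Fintype.bijective_iff_injective_and_card pos).2 ⟨pos_inj, hcard⟩
  -- comparing positions
  have key_of_pos : ∀ h h', vert h = vert h' → pos h < pos h' → key h < key h' := by
    intro h h' hv hp
    rcases lt_trichotomy (key h) (key h') with hk | hk | hk
    · exact hk
    · rw [key_inj hk] at hp; exact absurd hp (lt_irrefl _)
    · have := rank_mono h' h hv.symm hk
      have hp' : (pos h : ℕ) < pos h' := hp
      simp only [pos, hv] at hp'
      omega
  have vert_of_pos : ∀ h h', pos h < pos h' → vert h ≤ vert h' := by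
    intro h h' hp
    rw [← halve_pos, ← halve_pos]
    have hp' : (pos h : ℕ) < pos h' := hp
    apply Fin.le_def.2
    simp only [halve]
    omega
  refine ⟨⟨(Finset.univ : Finset (Fin m)).val.map fun i => (pos (i, false), pos (i, true)),
    ?_, ?_, ?_⟩, ?_⟩
  · intro l hl
    obtain ⟨i, -, rfl⟩ := Multiset.mem_map.1 hl
    by_contra hcon
    rcases lt_or_eq_of_le (not_lt.1 hcon) with h | h
    · have h2 := vert_of_pos _ _ h
      simp only [vert] at h2
      exact absurd (hlt i) (not_lt.2 h2)
    · have := pos_inj h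
      simp at this
  · intro k
    obtain ⟨⟨i, b⟩, rfl⟩ := pos_bij.2 k
    rw [Multiset.countP_map]
    have : (Finset.univ.filter fun j : Fin m =>
        pos (j, false) = pos (i, b) ∨ pos (j, true) = pos (i, b)) = {i} := by
      ext j
      simp only [Finset.mem_filter, Finset.mem_univ, true_and, Finset.mem_singleton,
        pos_inj.eq_iff, Prod.mk.injEq]
      cases b <;> simp
    have h2 := congrArg Finset.card this
    rw [Finset.card_singleton] at h2
    exact h2
  · rintro l hl l' hl' ⟨h1, h2, h3⟩
    obtain ⟨i, -, rfl⟩ := Multiset.mem_map.1 hl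
    obtain ⟨j, -, rfl⟩ := Multiset.mem_map.1 hl'
    simp only at h1 h2 h3
    have v1 := vert_of_pos _ _ h1
    have v2 := vert_of_pos _ _ h2
    have v3 := vert_of_pos _ _ h3
    have k1 := fun hv => key_of_pos (i, false) (j, false) hv h1
    have k2 := fun hv => key_of_pos (j, false) (i, true) hv h2
    have k3 := fun hv => key_of_pos (i, true) (j, true) hv h3
    clear h1 h2 h3 hl hl' key_of_pos vert_of_pos rank_mono key_inj card_fib halve_pos
      pos_inj pos_bij he hcard pos
    have hij := a.planar _ (hmem i) _ (hmem j)
    simp only [vert, key, Bool.false_eq_true, if_true, if_false, Prod.Lex.toLex_lt_toLex] at v1 v2 v3 k1 k2 k3 hij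
    have := hlt i
    have := hlt j
    have b1 := (e i).1.2
    have b2 := (e i).2.2
    have b3 := (e j).1.2
    have b4 := (e j).2.2
    have b5 := i.2
    have b6 := j.2
    simp only [Fin.lt_def, Fin.le_def, Fin.ext_iff] at *
    clear rank_lt rank key vert
    omega
  · rw [IsSplitting, he, Multiset.map_map]
    apply Multiset.map_congr rfl
    intro i _
    simp [Prod.map, halve_pos, vert]

/-- The planar pair partition of `2 n` points associated to a planar link pattern of `n` points with
valences `(2, …, 2)` by splitting its points.  (Planarity leaves only one way of splitting them.) -/
noncomputable def LinkPattern.split {n : ℕ} (a : LinkPattern (fun _ : Fin n => 2)) :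
    PairPartition n := (exists_isSplitting a).choose

theorem LinkPattern.split_spec {n : ℕ} (a : LinkPattern (fun _ : Fin n => 2)) :
    IsSplitting a a.split := (exists_isSplitting a).choose_spec

/-! ### Configuration space, partial derivatives, Möbius covariance -/

/-- The configuration space of `n` real points `x_0 < ⋯ < x_{n-1}`. -/
def config (n : ℕ) : Set (Fin n → ℝ) := {x | StrictMono x}

/-- The partial derivative with respect to the `j`-th variable. -/
noncomputable def partialDeriv {n : ℕ} (j : Fin n) (f : (Fin n → ℝ) → ℝ) (x : Fin n → ℝ) : ℝ :=
  deriv (fun t => f (Function.update x j t)) (x j)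

noncomputable def mobius (a b c d t : ℝ) : ℝ := (a * t + b) / (c * t + d)

/-- `f` is Möbius covariant with weight `w` at each point: for all Möbius maps `φ` of the upper
half-plane that are finite at the points of `x` and preserve their order,
`f x = ∏ i, φ'(x_i) ^ w * f (φ ∘ x)`. -/
def IsMobiusCovariant {n : ℕ} (w : ℝ) (f : (Fin n → ℝ) → ℝ) : Prop :=
  ∀ a b c d : ℝ, 0 < a * d - b * c → ∀ x ∈ config n, (∀ i, c * x i + d ≠ 0) →
    mobius a b c d ∘ x ∈ config n →
    f x = (∏ i, deriv (mobius a b c d) (x i) ^ w) * f (mobius a b c d ∘ x)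

/-! ### Conformal blocks and pure partition functions for `κ = 4` -/

/-- The index `i` is one of the left endpoints `a_1, …, a_N` of the links of `α`. -/
def IsLeft {N : ℕ} (α : PairPartition N) (i : Fin (2 * N)) : Prop := ∃ l ∈ α.links, l.1 = i

/-- The index `i` is one of the right endpoints `b_1, …, b_N` of the links of `α`. -/
def IsRight {N : ℕ} (α : PairPartition N) (i : Fin (2 * N)) : Prop := ∃ l ∈ α.links, l.2 = i

open Classical in
noncomputable def theta {N : ℕ} (α : PairPartition N) (i j : Fin (2 * N)) : ℝ :=
  if (IsLeft α i ∧ IsLeft α j) ∨ (IsRight α i ∧ IsRight α j) then 1 else -1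

/-- The conformal block function `∏_{i < j} (x_j - x_i) ^ (θ_α(i, j) / 2)`. -/
noncomputable def conformalBlock {N : ℕ} (α : PairPartition N) (x : Fin (2 * N) → ℝ) : ℝ :=
  ∏ i, ∏ j ∈ Finset.Ioi i, (x j - x i) ^ (1 / 2 * theta α i j)

/-- If `α = {{a_1, b_1}, …, {a_N, b_N}}` with `a_1 < ⋯ < a_N` and `a_i < b_i`, then
`β = {{a_1, b_{σ(1)}}, …, {a_N, b_{σ(N)}}}` for some permutation `σ`. -/
def ParenRel {N : ℕ} (α β : PairPartition N) : Prop :=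
  ∃ a b : Fin N → Fin (2 * N), StrictMono a ∧
    α.links = Finset.univ.val.map (fun i => (a i, b i)) ∧
    ∃ σ : Equiv.Perm (Fin N),
      β.links.map (fun l => s(l.1, l.2)) = Finset.univ.val.map (fun i => s(a i, b (σ i)))

open Classical in
/-- The incidence matrix of `ParenRel`. -/
noncomputable def incidence (N : ℕ) : Matrix (PairPartition N) (PairPartition N) ℝ :=
  Matrix.of fun α β => if ParenRel α β then 1 else 0

/-- The pure partition function of `α` for `κ = 4`, as a linear combination of conformal blocks. -/
noncomputable def pureZ {N : ℕ} (α : PairPartition N) (x : Fin (2 * N) → ℝ) : ℝ :=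
  ∑ β, (incidence N)⁻¹ α β * conformalBlock β x

/-! ### The defining properties of pure partition functions -/

/-- The second order operator
`κ/2 ∂_j² + ∑_{i ≠ j} (2 / (x_i - x_j) ∂_i - 2 h / (x_i - x_j)²)`. -/
noncomputable def secondOrderBPZ {n : ℕ} (κ h : ℝ) (j : Fin n) (f : (Fin n → ℝ) → ℝ)
    (x : Fin n → ℝ) : ℝ :=
  κ / 2 * partialDeriv j (partialDeriv j f) x
    + ∑ i ∈ Finset.univ.erase j,
        (2 / (x i - x j) * partialDeriv i f x - 2 * h / (x i - x j) ^ 2 * f x)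

/-- The increasing enumeration of the indices other than `j` and `j + 1`. -/
def skipPair {N : ℕ} (j : ℕ) (i : Fin (2 * N)) : Fin (2 * (N + 1)) :=
  if (i : ℕ) < j then ⟨i, by omega⟩ else ⟨i + 2, by omega⟩

/-- `α'` is obtained from `α` by removing the link `{j, k}`, where `k = j + 1`, and relabelling. -/
def IsRemoval {N : ℕ} (α : PairPartition (N + 1)) (j k : Fin (2 * (N + 1)))
    (α' : PairPartition N) : Prop :=
  α.links = (j, k) ::ₘ α'.links.map (Prod.map (skipPair (j : ℕ)) (skipPair (j : ℕ)))

open Classical in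
/-- The collection `Z` consists of pure partition functions of multiple `SLE_κ`: positive smooth
functions with `Z_∅ = 1` that solve the second order equations, are Möbius covariant with weight
`h = (6 - κ) / (2 κ)`, have the prescribed asymptotics as two neighbouring points collide, and
satisfy a power law bound. -/
structure IsPurePartitionCollection (κ : ℝ)
    (Z : ∀ N : ℕ, PairPartition N → (Fin (2 * N) → ℝ) → ℝ) : Prop where
  normalized : ∀ (α : PairPartition 0) (x : Fin (2 * 0) → ℝ), Z 0 α x = 1
  pos : ∀ (N : ℕ) (α : PairPartition N), ∀ x ∈ config (2 * N), 0 < Z N α x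
  smooth : ∀ (N : ℕ) (α : PairPartition N), ContDiffOn ℝ ∞ (Z N α) (config (2 * N))
  pde : ∀ (N : ℕ) (α : PairPartition N) (j : Fin (2 * N)), ∀ x ∈ config (2 * N),
    secondOrderBPZ κ ((6 - κ) / (2 * κ)) j (Z N α) x = 0
  cov : ∀ (N : ℕ) (α : PairPartition N), IsMobiusCovariant ((6 - κ) / (2 * κ)) (Z N α)
  /-- Here `ξ` lies between the neighbouring points, `k = j + 1`, and `u < v` are the values of the
  variables `x_j`, `x_k`, which tend to `ξ` while the other variables are fixed. -/
  asy : ∀ (N : ℕ) (α : PairPartition (N + 1)) (j k : Fin (2 * (N + 1))), (k : ℕ) = j + 1 →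
    ∀ (x : Fin (2 * (N + 1)) → ℝ) (ξ : ℝ), (x ∘ skipPair (j : ℕ) : Fin (2 * N) → ℝ) ∈ config (2 * N) →
      (∀ i < j, x i < ξ) → (∀ i > k, ξ < x i) →
      ((j, k) ∉ α.links →
        Tendsto (fun p : ℝ × ℝ => Z (N + 1) α (Function.update (Function.update x j p.1) k p.2)
            / (p.2 - p.1) ^ (-2 * ((6 - κ) / (2 * κ))))
          (𝓝[{p | p.1 < p.2}] (ξ, ξ)) (𝓝 0)) ∧
      ((j, k) ∈ α.links → ∃ α' : PairPartition N, IsRemoval α j k α' ∧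
        Tendsto (fun p : ℝ × ℝ => Z (N + 1) α (Function.update (Function.update x j p.1) k p.2)
            / (p.2 - p.1) ^ (-2 * ((6 - κ) / (2 * κ))))
          (𝓝[{p | p.1 < p.2}] (ξ, ξ)) (𝓝 (Z N α' (x ∘ skipPair (j : ℕ)))))
  bound : ∀ (N : ℕ) (α : PairPartition N), ∃ C > 0, ∃ q > 0, ∀ x ∈ config (2 * N),
    |Z N α x| ≤ C * ∏ i, ∏ j ∈ Finset.Ioi i, (x j - x i) ^ (if 1 < |x j - x i| then q else -q : ℝ)

/-! ### Fused functions and the third order equation -/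

/-- The quotient `Z_α(x_1, …, x_{2n}) / ∏_j (x_{2j} - x_{2j-1})^{1/2}`, where `α` is the pair
partition obtained from `a` by splitting. -/
noncomputable def fusionRatio {n : ℕ} (a : LinkPattern (fun _ : Fin n => 2))
    (x : Fin (2 * n) → ℝ) : ℝ :=
  pureZ a.split x /
    ∏ j : Fin n, (x ⟨2 * j + 1, by omega⟩ - x ⟨2 * j, by omega⟩) ^ (1 / 2 : ℝ)

/-- The filter of configurations `x_1 < ⋯ < x_{2n}` such that `x_{2j-1}, x_{2j} → y_j` for
all `j`. -/
def fusionFilter {n : ℕ} (y : Fin n → ℝ) : Filter (Fin (2 * n) → ℝ) :=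
  𝓝[config (2 * n)] (y ∘ halve)

/-- The fused function: the limit of `fusionRatio a` along `fusionFilter y`. -/
noncomputable def fusedZ {n : ℕ} (a : LinkPattern (fun _ : Fin n => 2)) (y : Fin n → ℝ) : ℝ :=
  limUnder (fusionFilter y) (fusionRatio a)

/-- `ℒ_{-2}^{(j)} = ∑_{i ≠ j} (H / (y_i - y_j)² - 1 / (y_i - y_j) ∂_i)`. -/
noncomputable def opL2 {n : ℕ} (H : ℝ) (j : Fin n) (f : (Fin n → ℝ) → ℝ) (y : Fin n → ℝ) : ℝ :=
  ∑ i ∈ Finset.univ.erase j,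
    (H / (y i - y j) ^ 2 * f y - 1 / (y i - y j) * partialDeriv i f y)

/-- `ℒ_{-3}^{(j)} = ∑_{i ≠ j} (2 H / (y_i - y_j)³ - 1 / (y_i - y_j)² ∂_i)`. -/
noncomputable def opL3 {n : ℕ} (H : ℝ) (j : Fin n) (f : (Fin n → ℝ) → ℝ) (y : Fin n → ℝ) : ℝ :=
  ∑ i ∈ Finset.univ.erase j,
    (2 * H / (y i - y j) ^ 3 * f y - 1 / (y i - y j) ^ 2 * partialDeriv i f y)

/-- `∂_j³ - 16/κ ℒ_{-2}^{(j)} ∂_j + 8 (8 - κ)/κ² ℒ_{-3}^{(j)}`. -/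
noncomputable def thirdOrderBPZ {n : ℕ} (κ H : ℝ) (j : Fin n) (f : (Fin n → ℝ) → ℝ)
    (y : Fin n → ℝ) : ℝ :=
  partialDeriv j (partialDeriv j (partialDeriv j f)) y
    - 16 / κ * opL2 H j (partialDeriv j f) y
    + 8 * (8 - κ) / κ ^ 2 * opL3 H j f y

/-! ### Noncrossing involutions and pair partitions -/

/-- Fixed-point free noncrossing involutions. -/
structure IsNoncrossing {n : ℕ} (f : Fin n → Fin n) : Prop where
  invol : ∀ a, f (f a) = a
  ne : ∀ a, f a ≠ a
  nc : ∀ a b, a < b → b < f a → ¬ f a < f b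

theorem IsNoncrossing.inj {n : ℕ} {f : Fin n → Fin n} (hf : IsNoncrossing f)
    {a b : Fin n} : f a = f b ↔ a = b :=
  ⟨fun h => by rw [← hf.invol a, h, hf.invol], fun h => h ▸ rfl⟩

theorem IsNoncrossing.eq_comm {n : ℕ} {f : Fin n → Fin n} (hf : IsNoncrossing f)
    {a b : Fin n} : f a = b ↔ f b = a :=
  ⟨fun h => by rw [← h, hf.invol], fun h => by rw [← h, hf.invol]⟩

namespace LinkPattern

variable {N : ℕ}

theorem exists_link (α : PairPartition N) (i : Fin (2 * N)) :
    ∃ l ∈ α.links, l.1 = i ∨ l.2 = i := by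
  have h := α.valence i
  have : 0 < α.links.countP (fun l => l.1 = i ∨ l.2 = i) := by rw [h]; exact one_pos
  exact Multiset.countP_pos.1 this

theorem link_unique (α : PairPartition N) {i : Fin (2 * N)} {l m : Fin (2 * N) × Fin (2 * N)}
    (hl : l ∈ α.links) (hm : m ∈ α.links) (hli : l.1 = i ∨ l.2 = i) (hmi : m.1 = i ∨ m.2 = i) :
    l = m := by
  have h := α.valence i
  rw [Multiset.countP_eq_card_filter, Multiset.card_eq_one] at h
  obtain ⟨c, hc⟩ := h
  have h1 : l ∈ α.links.filter (fun l => l.1 = i ∨ l.2 = i) := Multiset.mem_filter.2 ⟨hl, hli⟩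
  have h2 : m ∈ α.links.filter (fun l => l.1 = i ∨ l.2 = i) := Multiset.mem_filter.2 ⟨hm, hmi⟩
  rw [hc, Multiset.mem_singleton] at h1 h2
  rw [h1, h2]

theorem links_nodup (α : PairPartition N) : α.links.Nodup := by
  rw [Multiset.nodup_iff_count_le_one]
  intro l
  refine le_trans ?_ (α.valence l.1).le
  unfold Multiset.count
  rw [Multiset.countP_eq_card_filter, Multiset.countP_eq_card_filter]
  apply Multiset.card_le_card
  apply Multiset.monotone_filter_right
  intro m hm
  left
  rw [← hm]

/-- The other endpoint of the link ending at `i`. -/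
noncomputable def mate (α : PairPartition N) (i : Fin (2 * N)) : Fin (2 * N) :=
  if (α.exists_link i).choose.1 = i then (α.exists_link i).choose.2
  else (α.exists_link i).choose.1

theorem mate_of_mem (α : PairPartition N) {l : Fin (2 * N) × Fin (2 * N)} (hl : l ∈ α.links) :
    α.mate l.1 = l.2 ∧ α.mate l.2 = l.1 := by
  have hlt := α.lt l hl
  constructor
  · have h := (α.exists_link l.1).choose_spec
    have := α.link_unique h.1 hl h.2 (Or.inl rfl)
    unfold mate
    rw [this, if_pos rfl]
  · have h := (α.exists_link l.2).choose_spec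
    have := α.link_unique h.1 hl h.2 (Or.inr rfl)
    unfold mate
    rw [this, if_neg hlt.ne]

theorem mem_links_iff (α : PairPartition N) (a b : Fin (2 * N)) :
    (a, b) ∈ α.links ↔ a < b ∧ α.mate a = b := by
  refine ⟨fun h => ⟨α.lt _ h, (α.mate_of_mem h).1⟩, fun ⟨hab, h⟩ => ?_⟩
  obtain ⟨l, hl, h1 | h1⟩ := α.exists_link a
  · have h2 := (α.mate_of_mem hl).1
    rw [h1, h] at h2
    rw [h2, ← h1]; exact hl
  · have h2 := (α.mate_of_mem hl).2
    have h3 := α.lt l hl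
    rw [h1, h] at h2
    rw [h1, ← h2] at h3
    exact absurd hab h3.asymm

theorem mate_isNoncrossing (α : PairPartition N) : IsNoncrossing α.mate := by
  have key : ∀ a, α.mate (α.mate a) = a ∧ α.mate a ≠ a := by
    intro a
    obtain ⟨l, hl, rfl | rfl⟩ := α.exists_link a
    · rw [(α.mate_of_mem hl).1, (α.mate_of_mem hl).2]
      exact ⟨rfl, (α.lt _ hl).ne'⟩
    · rw [(α.mate_of_mem hl).2, (α.mate_of_mem hl).1]
      exact ⟨rfl, (α.lt _ hl).ne⟩
  refine ⟨fun a => (key a).1, fun a => (key a).2, fun a b hab hb hlt => ?_⟩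
  exact α.planar (a, α.mate a) ((α.mem_links_iff _ _).2 ⟨hab.trans hb, rfl⟩)
    (b, α.mate b) ((α.mem_links_iff _ _).2 ⟨hb.trans hlt, rfl⟩) ⟨hab, hb, hlt⟩

theorem mate_injective : Function.Injective (mate : PairPartition N → _) := by
  intro α β h
  apply LinkPattern.ext
  refine (Multiset.Nodup.ext α.links_nodup β.links_nodup).2 fun ⟨a, b⟩ => ?_
  rw [mem_links_iff, mem_links_iff, h]

/-- The pair partition with a given mate function. -/
def ofMate (f : Fin (2 * N) → Fin (2 * N)) (hf : IsNoncrossing f) : PairPartition N where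
  links := (Finset.univ.filter fun l : Fin (2 * N) × Fin (2 * N) => l.1 < l.2 ∧ f l.1 = l.2).val
  lt l hl := by
    rw [Finset.mem_val, Finset.mem_filter] at hl
    exact hl.2.1
  valence i := by
    rw [Multiset.countP_eq_card_filter, ← Finset.filter_val, Finset.card_val, Finset.card_eq_one]
    refine ⟨(min i (f i), max i (f i)), ?_⟩
    ext ⟨a, b⟩
    simp only [Finset.mem_filter, Finset.mem_univ, true_and, Finset.mem_singleton, Prod.mk.injEq]
    constructor
    · rintro ⟨⟨h1, h2⟩, rfl | rfl⟩
      · subst h2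
        exact ⟨(min_eq_left h1.le).symm, (max_eq_right h1.le).symm⟩
      · have h3 : f b = a := hf.eq_comm.1 h2
        rw [h3]
        exact ⟨(min_eq_right h1.le).symm, (max_eq_left h1.le).symm⟩
    · rintro ⟨rfl, rfl⟩
      rcases lt_or_gt_of_ne (hf.ne i) with h | h
      · rw [min_eq_right h.le, max_eq_left h.le, hf.invol]
        exact ⟨⟨h, rfl⟩, Or.inr rfl⟩
      · rw [min_eq_left h.le, max_eq_right h.le]
        exact ⟨⟨h, rfl⟩, Or.inl rfl⟩
  planar := by
    rintro ⟨a, b⟩ hl ⟨c, d⟩ hm ⟨h1, h2, h3⟩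
    rw [Finset.mem_val, Finset.mem_filter] at hl hm
    obtain ⟨-, hl1, hl2⟩ := hl
    obtain ⟨-, hm1, hm2⟩ := hm
    simp only at hl2 hm2 h1 h2 h3
    rw [← hl2] at h2 h3
    rw [← hm2] at h3
    exact hf.nc _ _ h1 h2 h3

@[simp] theorem mate_ofMate (f : Fin (2 * N) → Fin (2 * N)) (hf : IsNoncrossing f) :
    (ofMate f hf).mate = f := by
  have key : ∀ a, a < f a → (ofMate f hf).mate a = f a := fun a ha =>
    (((ofMate f hf).mem_links_iff _ _).1 (by
      rw [ofMate, Finset.mem_val, Finset.mem_filter]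
      exact ⟨Finset.mem_univ _, ha, rfl⟩)).2
  funext a
  rcases lt_or_gt_of_ne (hf.ne a) with h | h
  · have h1 := key (f a) (by rw [hf.invol]; exact h)
    rw [hf.invol] at h1
    rw [← (ofMate f hf).mate_isNoncrossing.eq_comm.1 h1]
  · exact key a h

@[simp] theorem mate_mate (α : PairPartition N) (a : Fin (2 * N)) : α.mate (α.mate a) = a :=
  α.mate_isNoncrossing.invol a

theorem mate_ne (α : PairPartition N) (a : Fin (2 * N)) : α.mate a ≠ a :=
  α.mate_isNoncrossing.ne a

theorem mate_eq_comm (α : PairPartition N) {a b : Fin (2 * N)} : α.mate a = b ↔ α.mate b = a :=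
  α.mate_isNoncrossing.eq_comm

theorem mate_inj (α : PairPartition N) {a b : Fin (2 * N)} : α.mate a = α.mate b ↔ a = b :=
  α.mate_isNoncrossing.inj

theorem isLeft_iff (α : PairPartition N) (a : Fin (2 * N)) : IsLeft α a ↔ a < α.mate a := by
  constructor
  · rintro ⟨l, hl, rfl⟩
    rw [(α.mate_of_mem hl).1]; exact α.lt _ hl
  · intro h
    exact ⟨(a, α.mate a), (α.mem_links_iff _ _).2 ⟨h, rfl⟩, rfl⟩

theorem isRight_iff (α : PairPartition N) (a : Fin (2 * N)) : IsRight α a ↔ α.mate a < a := by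
  constructor
  · rintro ⟨l, hl, rfl⟩
    rw [(α.mate_of_mem hl).2]; exact α.lt _ hl
  · intro h
    exact ⟨(α.mate a, a), (α.mem_links_iff _ _).2 ⟨h, α.mate_mate a⟩, rfl⟩

end LinkPattern

/-! ### The Temperley–Lieb action on noncrossing involutions -/

/-- Join `i` to `j`, and the former partners of `i` and `j` to each other. -/
def capFun {n : ℕ} (f : Fin n → Fin n) (i j : Fin n) : Fin n → Fin n := fun k =>
  if k = i then j else if k = j then i else if k = f i then f j else if k = f j then f i else f k

theorem IsNoncrossing.capFun {n : ℕ} {f : Fin n → Fin n} (hf : IsNoncrossing f) {i j : Fin n}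
    (hij : (j : ℕ) = i + 1) : IsNoncrossing (capFun f i j) := by
  have hne : i ≠ j := fun h => by rw [h] at hij; omega
  have h1 := hf.invol
  have h2 := hf.ne
  have hi := h1 i
  have hj := h1 j
  have hi2 := h2 i
  have hj2 := h2 j
  have hinj : ∀ a b, f a = f b → a = b := fun a b h => hf.inj.1 h
  constructor
  · intro a
    have := h1 a
    have := h2 a
    have := hinj i j
    unfold _root_.capFun
    grind
  · intro a
    have := h1 a
    have := h2 a
    have := hinj i j
    unfold _root_.capFun
    grind
  · intro a b hab hb hlt
    have e1 := h1 a
    have e2 := h1 b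
    have nca := hf.nc
    have u0 := nca i a
    have v0 := nca a i
    have u1 := nca i b
    have v1 := nca b i
    have u2 := nca j a
    have v2 := nca a j
    have u3 := nca j b
    have v3 := nca b j
    have u4 := nca (f i) a
    have v4 := nca a (f i)
    have u5 := nca (f i) b
    have v5 := nca b (f i)
    have u6 := nca (f j) a
    have v6 := nca a (f j)
    have u7 := nca (f j) b
    have v7 := nca b (f j)
    have w8 := nca i j
    have w9 := nca i (f i)
    have w10 := nca i (f j)
    have w11 := nca j i
    have w12 := nca j (f i)
    have w13 := nca j (f j)
    have w14 := nca (f i) i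
    have w15 := nca (f i) j
    have w16 := nca (f i) (f j)
    have w17 := nca (f j) i
    have w18 := nca (f j) j
    have w19 := nca (f j) (f i)
    have ab := nca a b
    unfold _root_.capFun at hb hlt
    clear nca h1 h2 hinj
    split_ifs at hb hlt <;> grind

/-! ### Colourings compatible with a matching, and the incidence matrix -/

/-- Each pair `{a, f a}` has exactly one element in `I`. -/
def Compat {n : ℕ} (f : Fin n → Fin n) (I : Finset (Fin n)) : Prop := ∀ a, f a ∈ I ↔ a ∉ I

theorem Compat.compl {n : ℕ} {f : Fin n → Fin n} {I : Finset (Fin n)} (h : Compat f I) :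
    Compat f Iᶜ := fun a => by simp [h a]

theorem Compat.card {N : ℕ} {f : Fin (2 * N) → Fin (2 * N)} {I : Finset (Fin (2 * N))}
    (hf : IsNoncrossing f) (h : Compat f I) : I.card = N := by
  have h1 : Iᶜ = I.image f := by
    ext a
    simp only [Finset.mem_compl, Finset.mem_image]
    constructor
    · intro ha
      exact ⟨f a, (h a).2 ha, hf.invol a⟩
    · rintro ⟨b, hb, rfl⟩
      rw [h b]; exact not_not.2 hb
  have h2 := Finset.card_compl_add_card I
  rw [h1, Finset.card_image_of_injective _ (fun a b => hf.inj.1), Fintype.card_fin] at h2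
  omega

namespace LinkPattern
variable {N : ℕ}

/-- The set of left endpoints. -/
noncomputable def lefts (α : PairPartition N) : Finset (Fin (2 * N)) :=
  Finset.univ.filter fun a => a < α.mate a

theorem mem_lefts (α : PairPartition N) {a : Fin (2 * N)} : a ∈ α.lefts ↔ a < α.mate a := by
  simp [lefts]

theorem notMem_lefts (α : PairPartition N) {a : Fin (2 * N)} : a ∉ α.lefts ↔ α.mate a < a := by
  rw [mem_lefts, not_lt, le_iff_lt_or_eq, or_iff_left (α.mate_ne a)]

theorem compat_lefts (α : PairPartition N) : Compat α.mate α.lefts := fun a => by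
  rw [notMem_lefts, mem_lefts, mate_mate]

theorem lefts_injective : Function.Injective (lefts : PairPartition N → _) := by
  intro α β h
  apply mate_injective
  have hl : ∀ a, a < α.mate a ↔ a < β.mate a := fun a => by
    rw [← mem_lefts, ← mem_lefts, h]
  have hr : ∀ a, α.mate a < a ↔ β.mate a < a := fun a => by
    rw [← notMem_lefts, ← notMem_lefts, h]
  -- right endpoints have the same partners
  have half : ∀ (γ δ : PairPartition N), (∀ a, a < γ.mate a ↔ a < δ.mate a) →
      (∀ a, γ.mate a < a ↔ δ.mate a < a) → ∀ b : Fin (2 * N), γ.mate b < b →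
      (∀ b' < b, γ.mate b' < b' → γ.mate b' = δ.mate b') → ¬ γ.mate b < δ.mate b := by
    intro γ δ hl hr b hb ih hlt
    have hb' := (hr b).1 hb
    have hc : δ.mate b < γ.mate (δ.mate b) := (hl _).2 (by rw [mate_mate]; exact hb')
    have h2 : γ.mate (δ.mate b) ≤ b := by
      have := γ.mate_isNoncrossing.nc (γ.mate b) (δ.mate b) hlt
      rw [mate_mate] at this
      exact not_lt.1 (this hb')
    have h3 : γ.mate (δ.mate b) ≠ b := fun h => by
      rw [γ.mate_eq_comm] at h; rw [h] at hlt; exact hlt.ne rfl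
    have h4 := ih _ (lt_of_le_of_ne h2 h3) (by rw [mate_mate]; exact hc)
    rw [mate_mate] at h4
    have h5 := δ.mate_inj.1 h4
    exact h3 h5.symm
  have hright : ∀ k : ℕ, ∀ b : Fin (2 * N), (b : ℕ) = k → α.mate b < b → α.mate b = β.mate b := by
    intro k
    induction k using Nat.strong_induction_on with
    | _ k ih =>
      intro b hbk hb
      rcases lt_trichotomy (α.mate b) (β.mate b) with h1 | h1 | h1
      · refine absurd h1 (half α β hl hr b hb fun b' hb' h' => ih b' ?_ b' rfl h')
        rw [← hbk]; exact hb'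
      · exact h1
      · refine absurd h1 (half β α (fun a => (hl a).symm) (fun a => (hr a).symm) b ((hr b).1 hb)
          fun b' hb' h' => (ih b' ?_ b' rfl ((hr b').2 h')).symm)
        rw [← hbk]; exact hb'
  funext a
  rcases lt_or_gt_of_ne (α.mate_ne a) with h1 | h1
  · exact hright _ a rfl h1
  · have := hright _ (α.mate a) rfl (by rw [mate_mate]; exact h1)
    rw [mate_mate] at this
    rw [β.mate_eq_comm.1 this.symm]

theorem links_eq_map (α : PairPartition N) (a : Fin N → Fin (2 * N)) (ha : Function.Injective a)
    (hr : ∀ x, x ∈ α.lefts ↔ ∃ i, a i = x) :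
    α.links = Finset.univ.val.map (fun i => (a i, α.mate (a i))) := by
  refine (Multiset.Nodup.ext α.links_nodup ?_).2 ?_
  · exact Multiset.Nodup.map (fun i j h => ha (Prod.ext_iff.1 h).1) Finset.univ.nodup
  · rintro ⟨x, y⟩
    rw [mem_links_iff, Multiset.mem_map]
    constructor
    · rintro ⟨h, rfl⟩
      obtain ⟨i, rfl⟩ := (hr x).1 (α.mem_lefts.2 h)
      exact ⟨i, Finset.mem_univ_val i, rfl⟩
    · rintro ⟨i, -, h⟩
      obtain ⟨rfl, rfl⟩ := Prod.ext_iff.1 h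
      exact ⟨α.mem_lefts.1 ((hr _).2 ⟨i, rfl⟩), rfl⟩

theorem parenRel_iff (α β : PairPartition N) : ParenRel α β ↔ Compat β.mate α.lefts := by
  constructor
  · rintro ⟨a, b, ha, hα, σ, hβ⟩ c
    have hmem : ∀ i, (a i, b i) ∈ α.links := fun i => by
      rw [hα]; exact Multiset.mem_map_of_mem _ (Finset.mem_univ_val i)
    have hal : ∀ i, a i ∈ α.lefts := fun i => by
      have := (α.mem_links_iff _ _).1 (hmem i)
      rw [mem_lefts, this.2]; exact this.1
    have hbl : ∀ i, b i ∉ α.lefts := fun i => by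
      have := (α.mem_links_iff _ _).1 (hmem i)
      rw [notMem_lefts, α.mate_eq_comm.1 this.2]; exact this.1
    have hc : s(c, β.mate c) ∈ β.links.map (fun l => s(l.1, l.2)) := by
      rw [Multiset.mem_map]
      rcases lt_or_gt_of_ne (β.mate_ne c) with h | h
      · exact ⟨(β.mate c, c), (β.mem_links_iff _ _).2 ⟨h, β.mate_mate c⟩, Sym2.eq_swap⟩
      · exact ⟨(c, β.mate c), (β.mem_links_iff _ _).2 ⟨h, rfl⟩, rfl⟩
    rw [hβ, Multiset.mem_map] at hc
    obtain ⟨i, -, hi⟩ := hc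
    rcases Sym2.eq_iff.1 hi with ⟨h1, h2⟩ | ⟨h1, h2⟩
    · rw [← h2, ← h1]
      exact iff_of_false (hbl _) (not_not.2 (hal _))
    · rw [← h1, ← h2]
      exact iff_of_true (hal _) (hbl _)
  · intro h
    have hcard : α.lefts.card = N := α.compat_lefts.card α.mate_isNoncrossing
    let a := α.lefts.orderEmbOfFin hcard
    have hr : ∀ x, x ∈ α.lefts ↔ ∃ i, a i = x := fun x => by
      rw [← Finset.mem_coe, ← Finset.range_orderEmbOfFin α.lefts hcard]; rfl
    have hal : ∀ i, a i ∈ α.lefts := fun i => (hr _).2 ⟨i, rfl⟩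
    have hex : ∀ i, ∃ k, a k = α.mate (β.mate (a i)) := fun i =>
      (hr _).1 ((α.compat_lefts _).2 fun h' => ((h _).1 h') (hal i))
    choose σ hσ using hex
    have hinj : Function.Injective σ := by
      intro i j hij
      have := hσ i
      rw [hij, hσ j, mate_inj, mate_inj] at this
      exact (a.injective this).symm
    refine ⟨a, fun i => α.mate (a i), a.strictMono, α.links_eq_map a a.injective hr,
      Equiv.ofBijective σ (Finite.injective_iff_bijective.1 hinj), ?_⟩
    simp only [Equiv.ofBijective_apply, hσ, mate_mate]
    refine (Multiset.Nodup.ext ?_ ?_).2 ?_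
    · refine Multiset.Nodup.map_on ?_ β.links_nodup
      rintro ⟨x, y⟩ hl ⟨z, w⟩ hm hs
      have h1 := β.lt _ hl
      have h2 := β.lt _ hm
      rcases Sym2.eq_iff.1 hs with ⟨rfl, rfl⟩ | ⟨rfl, rfl⟩
      · rfl
      · exact absurd h1 h2.asymm
    · refine Multiset.Nodup.map ?_ Finset.univ.nodup
      intro i j hs
      rcases Sym2.eq_iff.1 hs with ⟨h1, -⟩ | ⟨h1, -⟩
      · exact a.injective h1
      · exact absurd ((h (a j)).1 (h1 ▸ hal i)) (not_not.2 (hal j))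
    · intro s
      rw [Multiset.mem_map, Multiset.mem_map]
      constructor
      · rintro ⟨⟨x, y⟩, hl, rfl⟩
        obtain ⟨-, hxy⟩ := (β.mem_links_iff _ _).1 hl
        subst hxy
        by_cases hx : x ∈ α.lefts
        · obtain ⟨i, rfl⟩ := (hr x).1 hx
          exact ⟨i, Finset.mem_univ_val _, rfl⟩
        · obtain ⟨i, hi⟩ := (hr _).1 ((h x).2 hx)
          exact ⟨i, Finset.mem_univ_val _, by rw [hi, mate_mate]; exact Sym2.eq_swap⟩
      · rintro ⟨i, -, rfl⟩
        rcases lt_or_gt_of_ne (β.mate_ne (a i)) with h1 | h1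
        · exact ⟨(β.mate (a i), a i), (β.mem_links_iff _ _).2 ⟨h1, β.mate_mate _⟩, Sym2.eq_swap⟩
        · exact ⟨(a i, β.mate (a i)), (β.mem_links_iff _ _).2 ⟨h1, rfl⟩, rfl⟩

end LinkPattern

open LinkPattern

open Classical in
/-- The indicator of the colourings that are compatible with `β`. -/
noncomputable def compatInd {N : ℕ} (β : PairPartition N) (I : Finset (Fin (2 * N))) : ℝ :=
  if Compat β.mate I then 1 else 0

theorem incidence_apply {N : ℕ} (α β : PairPartition N) :
    incidence N α β = compatInd β α.lefts := by
  unfold incidence compatInd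
  rw [Matrix.of_apply]
  congr 1
  exact propext (parenRel_iff α β)

/-- The sum of the left endpoints. -/
noncomputable def leftSum {N : ℕ} (α : PairPartition N) : ℕ := ∑ a ∈ α.lefts, (a : ℕ)

theorem leftSum_lt {N : ℕ} {α β : PairPartition N} (h : Compat β.mate α.lefts) (hne : β ≠ α) :
    leftSum β < leftSum α := by
  have h1 : leftSum β = ∑ a ∈ α.lefts, (min a (β.mate a) : ℕ) := by
    unfold leftSum
    symm
    refine Finset.sum_bij (fun a _ => min a (β.mate a)) ?_ ?_ ?_ ?_
    · intro a _
      rw [mem_lefts]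
      rcases lt_or_gt_of_ne (β.mate_ne a) with h | h
      · rw [min_eq_right h.le, mate_mate]; exact h
      · rw [min_eq_left h.le]; exact h
    · intro a ha b hb hab
      have key : ∀ x y, x ∈ α.lefts → y ∈ α.lefts → x = β.mate y → False := fun x y hx hy hxy =>
        (h y).1 (hxy ▸ hx) hy
      rcases min_choice a (β.mate a) with e1 | e1 <;> rcases min_choice b (β.mate b) with e2 | e2 <;>
        rw [e1, e2] at hab
      · exact hab
      · exact (key _ _ ha hb hab).elim
      · exact (key _ _ hb ha hab.symm).elim
      · exact β.mate_inj.1 hab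
    · intro b hb
      have hb' := β.mem_lefts.1 hb
      by_cases hbα : b ∈ α.lefts
      · exact ⟨b, hbα, min_eq_left hb'.le⟩
      · exact ⟨β.mate b, (h b).2 hbα, by rw [mate_mate]; exact min_eq_right hb'.le⟩
    · intro a _
      rcases le_total a (β.mate a) with h | h
      · rw [min_eq_left h, min_eq_left (Fin.le_def.1 h)]
      · rw [min_eq_right h, min_eq_right (Fin.le_def.1 h)]
  rw [h1]
  unfold leftSum
  apply Finset.sum_lt_sum
  · intro a _; exact min_le_left _ _
  · by_contra hcon
    push Not at hcon
    apply hne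
    apply lefts_injective
    symm
    apply Finset.eq_of_subset_of_card_le
    · intro a ha
      rw [mem_lefts]
      have := hcon a ha
      refine lt_of_le_of_ne ?_ (β.mate_ne a).symm
      rw [Fin.le_def]
      exact this.trans (min_le_right _ _)
    · rw [β.compat_lefts.card β.mate_isNoncrossing, α.compat_lefts.card α.mate_isNoncrossing]

/-- The indicators `compatInd β`, restricted to sets of left endpoints, are linearly
independent. -/
theorem eq_zero_of_sum_compatInd {N : ℕ} (c : PairPartition N → ℝ)
    (h : ∀ α : PairPartition N, ∑ β, c β * compatInd β α.lefts = 0) : c = 0 := by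
  funext α
  have : ∀ m, ∀ α : PairPartition N, leftSum α = m → c α = 0 := by
    intro m
    induction m using Nat.strong_induction_on with
    | _ m ih =>
      intro α hα
      have h1 := h α
      rw [Finset.sum_eq_single α] at h1
      · rwa [compatInd, if_pos α.compat_lefts, mul_one] at h1
      · intro β _ hβ
        by_cases hc : Compat β.mate α.lefts
        · rw [ih (leftSum β) (hα ▸ leftSum_lt hc hβ) β rfl, zero_mul]
        · rw [compatInd, if_neg hc, mul_zero]
      · intro h; exact absurd (Finset.mem_univ _) h
  exact this _ α rfl

theorem compatInd_ext {N : ℕ} {c d : PairPartition N → ℝ}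
    (h : ∀ I, ∑ β, c β * compatInd β I = ∑ β, d β * compatInd β I) : c = d := by
  rw [← sub_eq_zero]
  apply eq_zero_of_sum_compatInd
  intro α
  simp only [Pi.sub_apply, sub_mul, Finset.sum_sub_distrib, h, sub_self]

theorem isUnit_incidence (N : ℕ) : IsUnit (incidence N) := by
  rw [← Matrix.mulVec_injective_iff_isUnit]
  intro c d hcd
  rw [← sub_eq_zero]
  apply eq_zero_of_sum_compatInd
  intro α
  have := congrFun hcd α
  simp only [Matrix.mulVec, dotProduct, incidence_apply] at this
  simp only [Pi.sub_apply, sub_mul, Finset.sum_sub_distrib]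
  rw [sub_eq_zero]
  simpa only [mul_comm] using this

/-! ### Twisted transposition of colours -/

/-- The pair partition obtained by joining `i` to `j = i + 1` and their partners to each other. -/
noncomputable def capPP {N : ℕ} (α : PairPartition N) (i j : Fin (2 * N)) (hij : (j : ℕ) = i + 1) :
    PairPartition N := ofMate (capFun α.mate i j) (α.mate_isNoncrossing.capFun hij)

open Classical in
/-- Exchange the colours of `i` and `j`, with a sign if they agree. -/
noncomputable def twist {n : ℕ} (i j : Fin n) (t : Finset (Fin n) → ℝ) (I : Finset (Fin n)) : ℝ :=
  if i ∈ I ↔ j ∈ I then -t I else t (I.map (Equiv.swap i j).toEmbedding)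

theorem mem_map_swap {n : ℕ} (i j : Fin n) (I : Finset (Fin n)) (k : Fin n) :
    k ∈ I.map (Equiv.swap i j).toEmbedding ↔ Equiv.swap i j k ∈ I := by
  rw [Finset.mem_map_equiv, Equiv.symm_swap]

theorem mem_map_swap_of_ne {n : ℕ} {i j : Fin n} {I : Finset (Fin n)} {k : Fin n} (h1 : k ≠ i)
    (h2 : k ≠ j) : k ∈ I.map (Equiv.swap i j).toEmbedding ↔ k ∈ I := by
  rw [mem_map_swap, Equiv.swap_apply_of_ne_of_ne h1 h2]

theorem twist_compatInd_of_eq {N : ℕ} (β : PairPartition N) {i j : Fin (2 * N)} (h : β.mate i = j) :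
    twist i j (compatInd β) = compatInd β := by
  funext I
  have h' := β.mate_eq_comm.1 h
  unfold twist
  split_ifs with hI
  · have : ¬ Compat β.mate I := fun hc => by
      have := hc i
      rw [h] at this
      tauto
    rw [compatInd, if_neg this, neg_zero]
  · unfold compatInd
    congr 1
    apply propext
    have key : ∀ a, a ≠ i → a ≠ j → β.mate a ≠ i ∧ β.mate a ≠ j := fun a ha hb =>
      ⟨fun h1 => hb (by rw [← h, ← h1, β.mate_mate]),
        fun h1 => ha (by rw [← h', ← h1, β.mate_mate])⟩
    have m2 : i ∈ I.map (Equiv.swap i j).toEmbedding ↔ j ∈ I := by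
      rw [mem_map_swap, Equiv.swap_apply_left]
    have m3 : j ∈ I.map (Equiv.swap i j).toEmbedding ↔ i ∈ I := by
      rw [mem_map_swap, Equiv.swap_apply_right]
    constructor
    all_goals
      intro hc a
      by_cases ha : a = i
      · rw [ha, h]; tauto
      by_cases hb : a = j
      · rw [hb, h']; tauto
      have := hc a
      have hk := key a ha hb
    · rwa [mem_map_swap_of_ne ha hb, mem_map_swap_of_ne hk.1 hk.2] at this
    · rwa [mem_map_swap_of_ne ha hb, mem_map_swap_of_ne hk.1 hk.2]

theorem twist_compatInd_of_ne {N : ℕ} (β : PairPartition N) {i j : Fin (2 * N)}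
    (hij : (j : ℕ) = i + 1) (h : β.mate i ≠ j) :
    twist i j (compatInd β) = compatInd (capPP β i j hij) - compatInd β := by
  have hne : i ≠ j := fun h => by rw [h] at hij; omega
  have h1 : ∀ a, β.mate (β.mate a) = a := β.mate_mate
  have h2 : ∀ a, β.mate a ≠ a := β.mate_ne
  have hinj : ∀ a b, β.mate a = β.mate b → a = b := fun a b => β.mate_inj.1
  have hcap : (capPP β i j hij).mate = capFun β.mate i j := mate_ofMate _ _
  funext I
  rw [Pi.sub_apply]
  -- compatibility away from the four points involved
  let R : Prop := ∀ a, a ≠ i → a ≠ j → a ≠ β.mate i → a ≠ β.mate j → (β.mate a ∈ I ↔ a ∉ I)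
  have c1 : Compat β.mate I ↔ R ∧ (β.mate i ∈ I ↔ i ∉ I) ∧ (β.mate j ∈ I ↔ j ∉ I) := by
    constructor
    · intro hc
      exact ⟨fun a _ _ _ _ => hc a, hc i, hc j⟩
    · rintro ⟨hR, hi, hj⟩ a
      by_cases e1 : a = i
      · rw [e1]; exact hi
      by_cases e2 : a = j
      · rw [e2]; exact hj
      by_cases e3 : a = β.mate i
      · rw [e3, h1]; exact iff_not_comm.1 hi
      by_cases e4 : a = β.mate j
      · rw [e4, h1]; exact iff_not_comm.1 hj
      exact hR a e1 e2 e3 e4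
  have c2 : Compat (capPP β i j hij).mate I ↔
      R ∧ (j ∈ I ↔ i ∉ I) ∧ (β.mate i ∈ I ↔ β.mate j ∉ I) := by
    rw [hcap]
    constructor
    · intro hc
      refine ⟨fun a e1 e2 e3 e4 => ?_, ?_, ?_⟩
      · have := hc a
        rwa [capFun, if_neg e1, if_neg e2, if_neg e3, if_neg e4] at this
      · have := hc i
        rwa [capFun, if_pos rfl] at this
      · have := hc (β.mate j)
        have e : β.mate j ≠ β.mate i := fun e => hne (hinj _ _ e).symm
        have e' : β.mate j ≠ i := fun e => h (by rw [← e, h1])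
        rwa [capFun, if_neg e', if_neg (h2 j), if_neg e, if_pos rfl] at this
    · rintro ⟨hR, hi, hj⟩ a
      unfold capFun
      split_ifs with e1 e2 e3 e4
      · rw [e1]; exact hi
      · rw [e2]; exact iff_not_comm.1 hi
      · rw [e3]; exact iff_not_comm.1 hj
      · rw [e4]; exact hj
      · exact hR a e1 e2 e3 e4
  have c3 : ¬ (i ∈ I ↔ j ∈ I) → (Compat β.mate (I.map (Equiv.swap i j).toEmbedding) ↔
      R ∧ (β.mate i ∈ I ↔ j ∉ I) ∧ (β.mate j ∈ I ↔ i ∉ I)) := by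
    intro hI
    have m1 : ∀ k, k ≠ i → k ≠ j → (k ∈ I.map (Equiv.swap i j).toEmbedding ↔ k ∈ I) :=
      fun k e1 e2 => mem_map_swap_of_ne e1 e2
    have m2 : i ∈ I.map (Equiv.swap i j).toEmbedding ↔ j ∈ I := by
      rw [mem_map_swap, Equiv.swap_apply_left]
    have m3 : j ∈ I.map (Equiv.swap i j).toEmbedding ↔ i ∈ I := by
      rw [mem_map_swap, Equiv.swap_apply_right]
    have e' : β.mate j ≠ i := fun e => h (by rw [← e, h1])
    constructor
    · intro hc
      refine ⟨fun a e1 e2 e3 e4 => ?_, ?_, ?_⟩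
      · have := hc a
        rwa [m1 a e1 e2, m1 _ (fun e => e3 (by rw [← e, h1])) (fun e => e4 (by rw [← e, h1]))]
          at this
      · have := hc i
        rwa [m2, m1 _ (h2 i) h] at this
      · have := hc j
        rwa [m3, m1 _ e' (h2 j)] at this
    · rintro ⟨hR, hi, hj⟩ a
      by_cases e1 : a = i
      · rw [e1, m2, m1 _ (h2 i) h]; exact hi
      by_cases e2 : a = j
      · rw [e2, m3, m1 _ e' (h2 j)]; exact hj
      by_cases e3 : a = β.mate i
      · rw [e3, h1, m2, m1 _ (h2 i) h]; exact iff_not_comm.1 hi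
      by_cases e4 : a = β.mate j
      · rw [e4, h1, m3, m1 _ e' (h2 j)]; exact iff_not_comm.1 hj
      rw [m1 a e1 e2, m1 _ (fun e => e3 (by rw [← e, h1])) (fun e => e4 (by rw [← e, h1]))]
      exact hR a e1 e2 e3 e4
  unfold twist compatInd
  have aux : ∀ (p q r : Prop) [Decidable p] [Decidable q] [Decidable r], (p → ¬ q) →
      (r ↔ p ∨ q) → (if q then (1 : ℝ) else 0) = (if r then 1 else 0) - (if p then 1 else 0) := by
    intro p q r _ _ _ h1 h2
    by_cases hp : p <;> by_cases hq : q <;> simp [h2, hp, hq]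
    exact h1 hp hq
  clear_value R
  have t1 : ∀ R a b c d : Prop, (a ↔ b) → ¬ (R ∧ (b ↔ ¬ a) ∧ (c ↔ ¬ d)) := by
    clear * -; grind
  have t2 : ∀ R a b c d : Prop, ¬ (a ↔ b) → R ∧ (c ↔ ¬ a) ∧ (d ↔ ¬ b) →
      ¬ (R ∧ (c ↔ ¬ b) ∧ (d ↔ ¬ a)) := by
    clear * -; grind
  have t3 : ∀ R a b c d : Prop, ¬ (a ↔ b) → (R ∧ (b ↔ ¬ a) ∧ (c ↔ ¬ d) ↔
      (R ∧ (c ↔ ¬ a) ∧ (d ↔ ¬ b)) ∨ (R ∧ (c ↔ ¬ b) ∧ (d ↔ ¬ a))) := by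
    clear * -; grind
  by_cases hI : i ∈ I ↔ j ∈ I
  · have : ¬ Compat (capPP β i j hij).mate I := by rw [c2]; exact t1 _ _ _ _ _ hI
    rw [if_pos hI, if_neg this, zero_sub]
  · rw [if_neg hI]
    classical
    refine aux _ _ _ ?_ ?_
    · rw [c1, c3 hI]; exact t2 _ _ _ _ _ hI
    · rw [c1, c2, c3 hI]; exact t3 _ _ _ _ _ hI

/-! ### Products of complementary minors -/

/-- The minor of `p` with rows in `I`. -/
noncomputable def minor {n N : ℕ} (I : Finset (Fin n)) (p : Fin n → Fin N → ℝ) : ℝ :=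
  if h : I.card = N then (Matrix.of fun r => p (I.orderEmbOfFin h r)).det else 0

theorem minor_of_card {n N : ℕ} {I : Finset (Fin n)} (h : I.card = N) (p : Fin n → Fin N → ℝ) :
    minor I p = (Matrix.of fun r => p (I.orderEmbOfFin h r)).det := dif_pos h

theorem minor_of_card_ne {n N : ℕ} {I : Finset (Fin n)} (h : I.card ≠ N) (p : Fin n → Fin N → ℝ) :
    minor I p = 0 := dif_neg h

theorem exists_orderEmb_eq {n N : ℕ} {I : Finset (Fin n)} (h : I.card = N) {k : Fin n}
    (hk : k ∈ I) : ∃ r, I.orderEmbOfFin h r = k := by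
  have : k ∈ Set.range (I.orderEmbOfFin h) := by rw [Finset.range_orderEmbOfFin]; exact hk
  exact this

theorem minor_update_of_notMem {n N : ℕ} {I : Finset (Fin n)} {k : Fin n} (hk : k ∉ I)
    (p : Fin n → Fin N → ℝ) (u : Fin N → ℝ) : minor I (Function.update p k u) = minor I p := by
  by_cases h : I.card = N
  · rw [minor_of_card h, minor_of_card h]
    congr 2
    funext r
    rw [Function.update_of_ne]
    intro e
    exact hk (e ▸ I.orderEmbOfFin_mem h r)
  · rw [minor_of_card_ne h, minor_of_card_ne h]

theorem exists_minor_update_of_mem {n N : ℕ} {I : Finset (Fin n)} (h : I.card = N) {k : Fin n}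
    (hk : k ∈ I) (p : Fin n → Fin N → ℝ) : ∃ (A : Matrix (Fin N) (Fin N) ℝ) (r : Fin N), ∀ u,
      minor I (Function.update p k u) = (A.updateRow r u).det := by
  obtain ⟨r, rfl⟩ := exists_orderEmb_eq h hk
  refine ⟨Matrix.of fun r => p (I.orderEmbOfFin h r), r, fun u => ?_⟩
  rw [minor_of_card h]
  congr 1
  ext s c
  rw [Matrix.updateRow_apply, Matrix.of_apply]
  by_cases hs : s = r
  · rw [if_pos hs, hs, Function.update_self]
  · rw [if_neg hs, Function.update_of_ne]
    · rfl
    · exact fun e => hs ((I.orderEmbOfFin h).injective e)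

theorem minor_update_add {n N : ℕ} {I : Finset (Fin n)} {k : Fin n}
    (hk : k ∈ I) (p : Fin n → Fin N → ℝ) (u v : Fin N → ℝ) :
    minor I (Function.update p k (u + v)) =
      minor I (Function.update p k u) + minor I (Function.update p k v) := by
  by_cases h : I.card = N
  · obtain ⟨A, r, hA⟩ := exists_minor_update_of_mem h hk p
    simp only [hA, Matrix.det_updateRow_add]
  · simp only [minor_of_card_ne h, add_zero]

theorem minor_update_smul {n N : ℕ} {I : Finset (Fin n)} {k : Fin n}
    (hk : k ∈ I) (p : Fin n → Fin N → ℝ) (c : ℝ) (u : Fin N → ℝ) :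
    minor I (Function.update p k (c • u)) = c * minor I (Function.update p k u) := by
  by_cases h : I.card = N
  · obtain ⟨A, r, hA⟩ := exists_minor_update_of_mem h hk p
    simp only [hA, Matrix.det_updateRow_smul]
  · simp only [minor_of_card_ne h, mul_zero]

theorem minor_eq_zero {n N : ℕ} {I : Finset (Fin n)} {k l : Fin n} (hk : k ∈ I) (hl : l ∈ I)
    (hkl : k ≠ l) (p : Fin n → Fin N → ℝ) (h : p k = p l) : minor I p = 0 := by
  by_cases hc : I.card = N
  · obtain ⟨r, rfl⟩ := exists_orderEmb_eq hc hk
    obtain ⟨s, rfl⟩ := exists_orderEmb_eq hc hl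
    rw [minor_of_card hc]
    refine Matrix.det_zero_of_row_eq (i := r) (j := s) (fun e => hkl (by rw [e])) ?_
    exact h
  · exact minor_of_card_ne hc p

theorem minor_mulVec {n N : ℕ} (I : Finset (Fin n)) (p : Fin n → Fin N → ℝ)
    (A : Matrix (Fin N) (Fin N) ℝ) : minor I (fun k => A.mulVec (p k)) = A.det * minor I p := by
  by_cases h : I.card = N
  · rw [minor_of_card h, minor_of_card h, ← Matrix.det_transpose A, mul_comm, ← Matrix.det_mul]
    congr 1
    ext r c
    simp only [Matrix.of_apply, Matrix.mul_apply, Matrix.mulVec, dotProduct,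
      Matrix.transpose_apply]
    exact Finset.sum_congr rfl fun _ _ => mul_comm _ _
  · rw [minor_of_card_ne h, minor_of_card_ne h, mul_zero]

theorem minor_swap_of_mem {n N : ℕ} {I : Finset (Fin n)} {i j : Fin n} (hi : i ∈ I) (hj : j ∈ I)
    (hij : i ≠ j) (p : Fin n → Fin N → ℝ) : minor I (p ∘ Equiv.swap i j) = - minor I p := by
  by_cases h : I.card = N
  · obtain ⟨r, rfl⟩ := exists_orderEmb_eq h hi
    obtain ⟨s, rfl⟩ := exists_orderEmb_eq h hj
    have hrs : r ≠ s := fun e => hij (by rw [e])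
    rw [minor_of_card h, minor_of_card h]
    have := Matrix.det_permute (Equiv.swap r s) (Matrix.of fun r => p (I.orderEmbOfFin h r))
    rw [Equiv.Perm.sign_swap hrs] at this
    have h2 : (Matrix.of fun r' => (p ∘ Equiv.swap (I.orderEmbOfFin h r) (I.orderEmbOfFin h s))
        (I.orderEmbOfFin h r')) = (Matrix.of fun r => p (I.orderEmbOfFin h r)).submatrix
          (Equiv.swap r s) id := by
      ext a c
      simp only [Matrix.of_apply, Matrix.submatrix_apply, Function.comp_apply, id]
      rw [← (I.orderEmbOfFin h).injective.map_swap]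
    rw [h2, this]
    simp
  · rw [minor_of_card_ne h, minor_of_card_ne h, neg_zero]

theorem swap_lt_swap {n : ℕ} {i j : Fin n} (hij : (j : ℕ) = i + 1) {a b : Fin n} (hab : a < b)
    (h : ¬ (a = i ∧ b = j)) : Equiv.swap i j a < Equiv.swap i j b := by
  rw [Equiv.swap_apply_def, Equiv.swap_apply_def]
  simp only [Fin.lt_def, Fin.ext_iff] at *
  split_ifs <;> omega

theorem minor_swap_of_notMem {n N : ℕ} {I : Finset (Fin n)} {i j : Fin n} (hij : (j : ℕ) = i + 1)
    (h : ¬ (i ∈ I ∧ j ∈ I)) (p : Fin n → Fin N → ℝ) :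
    minor I (p ∘ Equiv.swap i j) = minor (I.map (Equiv.swap i j).toEmbedding) p := by
  by_cases hc : I.card = N
  · have hc' : (I.map (Equiv.swap i j).toEmbedding).card = N := by rw [Finset.card_map, hc]
    rw [minor_of_card hc, minor_of_card hc']
    have := Finset.orderEmbOfFin_unique hc' (f := fun r => Equiv.swap i j (I.orderEmbOfFin hc r))
      (fun r => by
        rw [mem_map_swap, Equiv.swap_apply_self]; exact I.orderEmbOfFin_mem hc r)
      (fun r s hrs => swap_lt_swap hij ((I.orderEmbOfFin hc).strictMono hrs) (fun ⟨h1, h2⟩ =>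
        h ⟨h1 ▸ I.orderEmbOfFin_mem hc r, h2 ▸ I.orderEmbOfFin_mem hc s⟩))
    rw [← this]
    rfl
  · rw [minor_of_card_ne hc, minor_of_card_ne (by rwa [Finset.card_map])]

/-- The product of complementary minors. -/
noncomputable def dblMinor {n N : ℕ} (I : Finset (Fin n)) (p : Fin n → Fin N → ℝ) : ℝ :=
  minor I p * minor Iᶜ p

theorem dblMinor_eq_zero {n N : ℕ} {I : Finset (Fin n)} {k l : Fin n} (hI : k ∈ I ↔ l ∈ I)
    (hkl : k ≠ l) (p : Fin n → Fin N → ℝ) (h : p k = p l) : dblMinor I p = 0 := by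
  unfold dblMinor
  by_cases hk : k ∈ I
  · rw [minor_eq_zero hk (hI.1 hk) hkl p h, zero_mul]
  · rw [minor_eq_zero (I := Iᶜ) (Finset.mem_compl.2 hk) (Finset.mem_compl.2 fun h => hk (hI.2 h))
      hkl p h, mul_zero]

theorem dblMinor_mulVec {n N : ℕ} (I : Finset (Fin n)) (p : Fin n → Fin N → ℝ)
    (A : Matrix (Fin N) (Fin N) ℝ) :
    dblMinor I (fun k => A.mulVec (p k)) = A.det ^ 2 * dblMinor I p := by
  unfold dblMinor
  rw [minor_mulVec, minor_mulVec]
  ring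

theorem dblMinor_swap {n N : ℕ} (I : Finset (Fin n)) {i j : Fin n} (hij : (j : ℕ) = i + 1)
    (p : Fin n → Fin N → ℝ) :
    dblMinor I (p ∘ Equiv.swap i j) = twist i j (fun I => dblMinor I p) I := by
  have hne : i ≠ j := fun h => by rw [h] at hij; omega
  unfold twist dblMinor
  split_ifs with h
  · by_cases hi : i ∈ I
    · have hj := h.1 hi
      rw [minor_swap_of_mem hi hj hne, minor_swap_of_notMem (I := Iᶜ) hij (by simp [hi])]
      have : Iᶜ.map (Equiv.swap i j).toEmbedding = Iᶜ := by
        ext k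
        rw [mem_map_swap]
        by_cases e1 : k = i
        · rw [e1, Equiv.swap_apply_left]; simp [hi, hj]
        by_cases e2 : k = j
        · rw [e2, Equiv.swap_apply_right]; simp [hi, hj]
        rw [Equiv.swap_apply_of_ne_of_ne e1 e2]
      rw [this]; ring
    · have hj : j ∉ I := fun h' => hi (h.2 h')
      rw [minor_swap_of_mem (I := Iᶜ) (by simpa) (by simpa) hne,
        minor_swap_of_notMem (I := I) hij (by simp [hi])]
      have : I.map (Equiv.swap i j).toEmbedding = I := by
        ext k
        rw [mem_map_swap]
        by_cases e1 : k = i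
        · rw [e1, Equiv.swap_apply_left]; simp [hi, hj]
        by_cases e2 : k = j
        · rw [e2, Equiv.swap_apply_right]; simp [hi, hj]
        rw [Equiv.swap_apply_of_ne_of_ne e1 e2]
      rw [this]; ring
  · rw [minor_swap_of_notMem hij (by tauto), minor_swap_of_notMem hij (by
      simp only [Finset.mem_compl]; tauto)]
    congr 2
    ext k
    simp only [Finset.mem_compl, mem_map_swap]

/-- The product of complementary minors as a multilinear map. -/
noncomputable def dblMinorM {n N : ℕ} (I : Finset (Fin n)) :
    MultilinearMap ℝ (fun _ : Fin n => Fin N → ℝ) ℝ where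
  toFun := dblMinor I
  map_update_add' p k u v := by
    rename_i inst
    have : inst = instDecidableEqFin n := Subsingleton.elim _ _
    subst this
    unfold dblMinor
    by_cases hk : k ∈ I
    · have hk' : k ∉ Iᶜ := by simpa
      simp only [minor_update_of_notMem hk', minor_update_add hk]; ring
    · have hk' : k ∈ Iᶜ := by simpa
      simp only [minor_update_of_notMem hk, minor_update_add hk']; ring
  map_update_smul' p k c u := by
    rename_i inst
    have : inst = instDecidableEqFin n := Subsingleton.elim _ _
    subst this
    unfold dblMinor
    rw [smul_eq_mul]
    by_cases hk : k ∈ I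
    · have hk' : k ∉ Iᶜ := by simpa
      simp only [minor_update_of_notMem hk', minor_update_smul hk]; ring
    · have hk' : k ∈ Iᶜ := by simpa
      simp only [minor_update_of_notMem hk, minor_update_smul hk']; ring

@[simp] theorem dblMinorM_apply {n N : ℕ} (I : Finset (Fin n)) (p : Fin n → Fin N → ℝ) :
    dblMinorM I p = dblMinor I p := rfl

/-! ### Sorted basis vectors -/

theorem eq_half_of_monotone {N : ℕ} (l : Fin (2 * N) → ℕ) (hN : ∀ k, l k < N)
    (h : ∀ k k' : Fin (2 * N), (k' : ℕ) = k + 2 → l k < l k') (k : Fin (2 * N)) :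
    l k = k / 2 := by
  have lo : ∀ m, ∀ k : Fin (2 * N), (k : ℕ) = m → m / 2 ≤ l k := by
    intro m
    induction m using Nat.strong_induction_on with
    | _ m ih =>
      intro k hk
      by_cases hm : m < 2
      · omega
      · have h1 := ih (m - 2) (by omega) ⟨m - 2, by omega⟩ rfl
        have h2 := h ⟨m - 2, by omega⟩ k (by simp only; omega)
        omega
  have hi : ∀ m, ∀ k : Fin (2 * N), (k : ℕ) + m + 1 = 2 * N → l k + m / 2 + 1 ≤ N := by
    intro m
    induction m using Nat.strong_induction_on with
    | _ m ih =>
      intro k hk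
      by_cases hm : m < 2
      · have := hN k; omega
      · have h1 := ih (m - 2) (by omega) ⟨k + 2, by omega⟩ (by simp only; omega)
        have h2 := h k ⟨k + 2, by omega⟩ rfl
        omega
  have h1 := lo k k rfl
  have h2 := hi (2 * N - 1 - k) k (by omega)
  omega

/-- The involution exchanging `2 r` and `2 r + 1`. -/
def pairFun {N : ℕ} (k : Fin (2 * N)) : Fin (2 * N) :=
  if h : (k : ℕ) % 2 = 0 then ⟨k + 1, by omega⟩ else ⟨k - 1, by omega⟩

theorem pairFun_val {N : ℕ} (k : Fin (2 * N)) :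
    (pairFun k : ℕ) = if (k : ℕ) % 2 = 0 then (k : ℕ) + 1 else k - 1 := by
  unfold pairFun
  split_ifs <;> rfl

theorem isNoncrossing_pairFun (N : ℕ) : IsNoncrossing (pairFun : Fin (2 * N) → _) := by
  constructor
  · intro a
    rw [Fin.ext_iff, pairFun_val, pairFun_val]
    split_ifs <;> omega
  · intro a h
    unfold pairFun at h
    rw [Fin.ext_iff] at h
    split_ifs at h <;> dsimp only at h <;> omega
  · intro a b h1 h2 h3
    unfold pairFun at h2 h3
    rw [Fin.lt_def] at h1 h2 h3
    split_ifs at h2 h3 <;> dsimp only at h2 h3 <;> omega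

/-- The pair partition `{{0, 1}, {2, 3}, …}`. -/
def pairPP (N : ℕ) : PairPartition N := ofMate pairFun (isNoncrossing_pairFun N)

theorem dblMinor_half {N : ℕ} (I : Finset (Fin (2 * N))) :
    dblMinor I (fun k => (Pi.single (halve k) 1 : Fin N → ℝ)) = compatInd (pairPP N) I := by
  have hm : (pairPP N).mate = pairFun := mate_ofMate _ _
  by_cases h : Compat pairFun I
  · have key : ∀ J : Finset (Fin (2 * N)), Compat pairFun J →
        minor J (fun k => (Pi.single (halve k) 1 : Fin N → ℝ)) = 1 := by
      classical
      intro J hJ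
      have hc := hJ.card (isNoncrossing_pairFun N)
      have e := Finset.orderEmbOfFin_unique hc (f := fun r : Fin N =>
        if (⟨2 * r, by omega⟩ : Fin (2 * N)) ∈ J then ⟨2 * r, by omega⟩ else ⟨2 * r + 1, by omega⟩)
        (fun r => by
          split_ifs with hr
          · exact hr
          · have := (hJ ⟨2 * r, by omega⟩).2 hr
            unfold pairFun at this
            rw [dif_pos (by simp)] at this
            exact this)
        (fun r s hrs => by
          have hrs' : (r : ℕ) < s := hrs
          dsimp only
          split_ifs <;> rw [Fin.lt_def] <;> simp only <;> omega)
      rw [minor_of_card hc, ← e]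
      rw [show (Matrix.of fun r : Fin N => (Pi.single (halve (if (⟨2 * r, by omega⟩ : Fin (2 * N)) ∈ J then
        ⟨2 * r, by omega⟩ else ⟨2 * r + 1, by omega⟩)) 1 : Fin N → ℝ))
        = (1 : Matrix (Fin N) (Fin N) ℝ) from ?_, Matrix.det_one]
      ext r c
      have : halve (if (⟨2 * r, by omega⟩ : Fin (2 * N)) ∈ J then
        ⟨2 * r, by omega⟩ else ⟨2 * r + 1, by omega⟩) = r := by
        split_ifs <;> simp only [halve, Fin.ext_iff] <;> omega
      rw [Matrix.of_apply, this, Matrix.one_apply, Pi.single_apply]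
      simp only [eq_comm]
    rw [compatInd, hm, if_pos h, dblMinor, key I h, key _ h.compl, one_mul]
  · rw [compatInd, hm, if_neg h]
    obtain ⟨a, ha⟩ := not_forall.1 h
    refine dblMinor_eq_zero (k := a) (l := pairFun a) (by tauto)
      ((isNoncrossing_pairFun N).ne a).symm _ ?_
    have : halve (pairFun a) = halve a := by
      unfold pairFun halve
      split_ifs <;> simp only [Fin.ext_iff] <;> omega
    simp only [this]

/-! ### Expansion of products of minors -/

/-- The span of the indicators `compatInd β`. -/
noncomputable def compatSpan (N : ℕ) : Submodule ℝ (Finset (Fin (2 * N)) → ℝ) :=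
  Submodule.span ℝ (Set.range compatInd)

theorem twist_mem_compatSpan {N : ℕ} {i j : Fin (2 * N)} (hij : (j : ℕ) = i + 1)
    {t : Finset (Fin (2 * N)) → ℝ} (ht : t ∈ compatSpan N) : twist i j t ∈ compatSpan N := by
  unfold compatSpan at ht
  induction ht using Submodule.span_induction with
  | mem t h =>
    obtain ⟨β, rfl⟩ := h
    by_cases hβ : β.mate i = j
    · rw [twist_compatInd_of_eq β hβ]
      exact Submodule.subset_span ⟨β, rfl⟩
    · rw [twist_compatInd_of_ne β hij hβ]
      exact Submodule.sub_mem _ (Submodule.subset_span ⟨_, rfl⟩) (Submodule.subset_span ⟨β, rfl⟩)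
  | zero =>
    convert Submodule.zero_mem _ using 1
    funext I; unfold twist; split_ifs <;> simp
  | add s t _ _ h1 h2 =>
    convert Submodule.add_mem _ h1 h2 using 1
    funext I
    simp only [twist, Pi.add_apply]
    split_ifs
    · ring
    · rfl
  | smul c t _ h1 =>
    convert Submodule.smul_mem _ c h1 using 1
    funext I
    simp only [twist, Pi.smul_apply, smul_eq_mul]
    split_ifs
    · ring
    · rfl

theorem dblMinor_mem_of_swap {N : ℕ} (p : Fin (2 * N) → Fin N → ℝ)
    (σ : Equiv.Perm (Fin (2 * N))) (hp : (fun I => dblMinor I p) ∈ compatSpan N) :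
    (fun I => dblMinor I (p ∘ σ)) ∈ compatSpan N := by
  rcases Nat.eq_zero_or_pos N with h0 | h0
  · subst h0
    rwa [show p ∘ σ = p from funext fun k => k.elim0]
  obtain ⟨n, hn⟩ : ∃ n, 2 * N = n + 1 := ⟨2 * N - 1, by omega⟩
  have hσ : ∀ σ : Equiv.Perm (Fin (2 * N)), σ ∈ Submonoid.closure
      {τ : Equiv.Perm (Fin (2 * N)) | ∃ i j : Fin (2 * N), (j : ℕ) = i + 1 ∧ τ = Equiv.swap i j} := by
    rw [hn]
    intro σ
    have := Equiv.Perm.mclosure_swap_castSucc_succ n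
    have h1 : σ ∈ (⊤ : Submonoid (Equiv.Perm (Fin (n + 1)))) := trivial
    rw [← this] at h1
    refine Submonoid.closure_mono ?_ h1
    rintro _ ⟨i, rfl⟩
    exact ⟨i.castSucc, i.succ, by simp, rfl⟩
  have := hσ σ
  induction this using Submonoid.closure_induction generalizing p with
  | mem τ h =>
    obtain ⟨i, j, hij, rfl⟩ := h
    have := twist_mem_compatSpan hij hp
    convert this using 1
    funext I
    exact dblMinor_swap I hij p
  | one => exact hp
  | mul τ ρ _ _ h1 h2 => exact h2 _ (h1 p hp)

theorem dblMinor_mem_compatSpan {N : ℕ} (p : Fin (2 * N) → Fin N → ℝ) :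
    (fun I => dblMinor I p) ∈ compatSpan N := by
  have hM : (compatSpan N).mkQ.compMultilinearMap
      (MultilinearMap.pi fun I => dblMinorM (n := 2 * N) (N := N) I) = 0 := by
    refine Module.Basis.ext_multilinear (fun _ => Pi.basisFun ℝ (Fin N)) fun g => ?_
    simp only [LinearMap.compMultilinearMap_apply, Pi.basisFun_apply, zero_apply,
      Submodule.mkQ_apply, Submodule.Quotient.mk_eq_zero]
    change (fun I => dblMinor I fun k => (Pi.single (g k) 1 : Fin N → ℝ)) ∈ compatSpan N
    -- sort the basis vectors
    have hsort := dblMinor_mem_of_swap (fun k => (Pi.single ((g ∘ Tuple.sort g) k) 1 : Fin N → ℝ))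
      (Tuple.sort g)⁻¹
    have e : (fun k => (Pi.single ((g ∘ Tuple.sort g) k) 1 : Fin N → ℝ)) ∘ ⇑(Tuple.sort g)⁻¹
        = fun k => Pi.single (g k) 1 := by
      funext k; simp
    rw [e] at hsort
    apply hsort
    have hmono := Tuple.monotone_sort g
    generalize g ∘ Tuple.sort g = g' at hmono
    by_cases h : ∀ k k' : Fin (2 * N), (k' : ℕ) = k + 2 → (g' k : ℕ) < g' k'
    · have := eq_half_of_monotone (fun k => (g' k : ℕ)) (fun k => (g' k).2) h
      have h2 : g' = halve := funext fun k => Fin.ext (this k)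
      rw [h2]
      simp only [dblMinor_half]
      exact Submodule.subset_span ⟨_, rfl⟩
    · push Not at h
      obtain ⟨k, k', hk, hle⟩ := h
      have hk1 : (k : ℕ) + 1 < 2 * N := by omega
      have e1 : g' k = g' k' := le_antisymm (hmono (by rw [Fin.le_def]; omega)) (Fin.le_def.2 hle)
      have e2 : g' k = g' ⟨k + 1, hk1⟩ :=
        le_antisymm (hmono (by rw [Fin.le_def]; simp)) (by
          rw [e1]; exact hmono (by rw [Fin.le_def]; simp; omega))
      convert Submodule.zero_mem (compatSpan N) using 1
      funext I
      rw [Pi.zero_apply]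
      by_cases c1 : k ∈ I ↔ k' ∈ I
      · exact dblMinor_eq_zero c1 (by rw [ne_eq, Fin.ext_iff]; omega) _ (by rw [e1])
      by_cases c2 : k ∈ I ↔ (⟨k + 1, hk1⟩ : Fin (2 * N)) ∈ I
      · exact dblMinor_eq_zero c2 (by rw [ne_eq, Fin.ext_iff]; simp) _ (by rw [← e2])
      · exact dblMinor_eq_zero (k := k') (l := ⟨k + 1, hk1⟩) (by tauto)
          (by rw [ne_eq, Fin.ext_iff]; simp only; omega) _ (by rw [← e1, ← e2])
  have := congrArg (fun f => f p) hM
  simp only [LinearMap.compMultilinearMap_apply, zero_apply,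
    Submodule.mkQ_apply, Submodule.Quotient.mk_eq_zero] at this
  exact this

/-- The coefficients of products of complementary minors in terms of `compatInd`. -/
noncomputable def pureM {N : ℕ} (α : PairPartition N) :
    MultilinearMap ℝ (fun _ : Fin (2 * N) => Fin N → ℝ) ℝ :=
  ∑ β, (incidence N)⁻¹ α β • dblMinorM β.lefts

theorem pureM_apply {N : ℕ} (α : PairPartition N) (p : Fin (2 * N) → Fin N → ℝ) :
    pureM α p = ∑ β, (incidence N)⁻¹ α β * dblMinor β.lefts p := by
  simp [pureM]

theorem dblMinor_eq_sum {N : ℕ} (I : Finset (Fin (2 * N))) (p : Fin (2 * N) → Fin N → ℝ) :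
    dblMinor I p = ∑ β, pureM β p * compatInd β I := by
  have h := dblMinor_mem_compatSpan p
  rw [compatSpan, Submodule.mem_span_range_iff_exists_fun] at h
  obtain ⟨c, hc⟩ := h
  have hc' : ∀ I, dblMinor I p = ∑ β, c β * compatInd β I := fun I => by
    rw [← congrFun hc I]
    simp
  have hcoef : ∀ α, pureM α p = c α := by
    intro α
    have h1 : (fun β : PairPartition N => dblMinor β.lefts p) = (incidence N).mulVec c := by
      funext β
      rw [hc']
      simp only [Matrix.mulVec, dotProduct, incidence_apply, mul_comm]
    have h2 : (incidence N)⁻¹.mulVec (fun β : PairPartition N => dblMinor β.lefts p) = c := by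
      rw [h1, Matrix.mulVec_mulVec, Matrix.nonsing_inv_mul _
        ((Matrix.isUnit_iff_isUnit_det _).1 (isUnit_incidence N)), Matrix.one_mulVec]
    rw [pureM_apply, ← h2]
    rfl
  rw [hc' I]
  simp only [hcoef]

theorem pureM_mulVec {N : ℕ} (α : PairPartition N) (p : Fin (2 * N) → Fin N → ℝ)
    (A : Matrix (Fin N) (Fin N) ℝ) : pureM α (fun k => A.mulVec (p k)) = A.det ^ 2 * pureM α p := by
  rw [pureM_apply, pureM_apply, Finset.mul_sum]
  refine Finset.sum_congr rfl fun β _ => ?_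
  rw [dblMinor_mulVec]; ring

theorem pureM_half {N : ℕ} (α : PairPartition N) :
    pureM α (fun k => (Pi.single (halve k) 1 : Fin N → ℝ)) = if α = pairPP N then 1 else 0 := by
  have := compatInd_ext (N := N)
    (c := fun α => pureM α (fun k => (Pi.single (halve k) 1 : Fin N → ℝ)))
    (d := fun α => if α = pairPP N then 1 else 0) (fun I => by
      rw [← dblMinor_eq_sum, dblMinor_half]
      simp)
  exact congrFun this α

open Classical in
theorem pureM_swap_eq {N : ℕ} (p : Fin (2 * N) → Fin N → ℝ) {i j : Fin (2 * N)}
    (hij : (j : ℕ) = i + 1) (α : PairPartition N) :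
    pureM α (p ∘ Equiv.swap i j) = (if α.mate i = j then pureM α p else - pureM α p) +
      ∑ β, if β.mate i ≠ j ∧ capPP β i j hij = α then pureM β p else 0 := by
  have := compatInd_ext (N := N) (c := fun α => pureM α (p ∘ Equiv.swap i j))
    (d := fun α => (if α.mate i = j then pureM α p else - pureM α p) +
      ∑ β, if β.mate i ≠ j ∧ capPP β i j hij = α then pureM β p else 0) (fun I => by
    rw [← dblMinor_eq_sum, dblMinor_swap I hij]
    have e1 : (fun I => dblMinor I p) = ∑ β, pureM β p • compatInd β := by
      funext I
      rw [dblMinor_eq_sum]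
      simp
    have e2 : twist i j (fun I => dblMinor I p) = ∑ β, pureM β p • twist i j (compatInd β) := by
      rw [e1]
      funext J
      simp only [twist, Finset.sum_apply, Pi.smul_apply, smul_eq_mul]
      split_ifs <;> simp
    rw [e2]
    simp only [add_mul, Finset.sum_add_distrib, Finset.sum_mul, ite_mul, zero_mul]
    rw [Finset.sum_comm, ← Finset.sum_add_distrib, Finset.sum_apply]
    refine Finset.sum_congr rfl fun β _ => ?_
    rw [Pi.smul_apply, smul_eq_mul]
    by_cases hβ : β.mate i = j
    · rw [twist_compatInd_of_eq β hβ]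
      simp [hβ]
    · rw [twist_compatInd_of_ne β hij hβ]
      simp only [ne_eq, hβ, not_false_eq_true, true_and, if_false, Pi.sub_apply]
      rw [Finset.sum_ite_eq]
      simp
      ring)
  exact congrFun this α

theorem capPP_mate_left {N : ℕ} (α : PairPartition N) (i j : Fin (2 * N)) (hij : (j : ℕ) = i + 1) :
    (capPP α i j hij).mate i = j := by
  rw [capPP, mate_ofMate, capFun, if_pos rfl]

theorem pureM_swap_of_ne {N : ℕ} (p : Fin (2 * N) → Fin N → ℝ) {i j : Fin (2 * N)}
    (hij : (j : ℕ) = i + 1) (α : PairPartition N) (h : α.mate i ≠ j) :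
    pureM α (p ∘ Equiv.swap i j) = - pureM α p := by
  rw [pureM_swap_eq p hij, if_neg h, add_eq_left]
  refine Finset.sum_eq_zero fun β _ => if_neg ?_
  rintro ⟨-, rfl⟩
  exact h (capPP_mate_left _ _ _ _)

open Classical in
theorem pureM_swap_of_eq {N : ℕ} (p : Fin (2 * N) → Fin N → ℝ) {i j : Fin (2 * N)}
    (hij : (j : ℕ) = i + 1) (α : PairPartition N) (h : α.mate i = j) :
    pureM α (p ∘ Equiv.swap i j) = pureM α p +
      ∑ β ∈ Finset.univ.filter (fun β => β.mate i ≠ j ∧ capPP β i j hij = α), pureM β p := by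
  rw [pureM_swap_eq p hij, if_pos h, Finset.sum_filter]

theorem pureM_eq_zero {N : ℕ} (p : Fin (2 * N) → Fin N → ℝ) {i j : Fin (2 * N)}
    (hij : (j : ℕ) = i + 1) (α : PairPartition N) (h : α.mate i ≠ j) (hp : p i = p j) :
    pureM α p = 0 := by
  have h1 := pureM_swap_of_ne p hij α h
  have h2 : p ∘ Equiv.swap i j = p := by
    funext k
    rw [Function.comp_apply, Equiv.swap_apply_def]
    split_ifs with h3 h4
    · rw [h3, hp]
    · rw [h4, hp]
    · rfl
  rw [h2] at h1
  linarith

/-! ### Relations between successive cappings -/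

theorem capFun_capFun_left {n : ℕ} {f : Fin n → Fin n} (hf : IsNoncrossing f) {i j k : Fin n}
    (hik : i ≠ k) (h : f i = j) : capFun (capFun f j k) i j = f := by
  have h1 := hf.invol
  have h2 := hf.ne
  have e1 := h1 i
  have e2 := h1 j
  have e3 := h1 k
  have e4 := h2 i
  have e5 := h2 j
  have e6 := h2 k
  funext a
  have a1 := h1 a
  have a2 := h2 a
  unfold capFun
  grind

theorem capFun_capFun_right {n : ℕ} {f : Fin n → Fin n} (hf : IsNoncrossing f) {i j k : Fin n}
    (hik : i ≠ k) (hij : i ≠ j) (h : f j = k) : capFun (capFun f i j) j k = f := by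
  have h1 := hf.invol
  have h2 := hf.ne
  have e1 := h1 i
  have e2 := h1 j
  have e3 := h1 k
  have e4 := h2 i
  have e5 := h2 j
  have e6 := h2 k
  funext a
  have a1 := h1 a
  have a2 := h2 a
  unfold capFun
  grind

theorem capPP_mate {N : ℕ} (α : PairPartition N) (i j : Fin (2 * N)) (hij : (j : ℕ) = i + 1) :
    (capPP α i j hij).mate = capFun α.mate i j := mate_ofMate _ _

theorem capPP_capPP_left {N : ℕ} (α : PairPartition N) {i j k : Fin (2 * N)}
    (hij : (j : ℕ) = i + 1) (hjk : (k : ℕ) = j + 1) (h : α.mate i = j) :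
    capPP (capPP α j k hjk) i j hij = α := by
  apply mate_injective
  rw [capPP_mate, capPP_mate]
  exact capFun_capFun_left α.mate_isNoncrossing (by rw [ne_eq, Fin.ext_iff]; omega) h

theorem capPP_capPP_right {N : ℕ} (α : PairPartition N) {i j k : Fin (2 * N)}
    (hij : (j : ℕ) = i + 1) (hjk : (k : ℕ) = j + 1) (h : α.mate j = k) :
    capPP (capPP α i j hij) j k hjk = α := by
  apply mate_injective
  rw [capPP_mate, capPP_mate]
  exact capFun_capFun_right α.mate_isNoncrossing (by rw [ne_eq, Fin.ext_iff]; omega)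
    (by rw [ne_eq, Fin.ext_iff]; omega) h

theorem capPP_mate_of_ne {N : ℕ} (α : PairPartition N) {i j : Fin (2 * N)} (hij : (j : ℕ) = i + 1)
    {a : Fin (2 * N)} (h1 : a ≠ i) (h2 : a ≠ j) (h3 : a ≠ α.mate i) (h4 : a ≠ α.mate j) :
    (capPP α i j hij).mate a = α.mate a := by
  rw [capPP_mate, capFun, if_neg h1, if_neg h2, if_neg h3, if_neg h4]

/-! ### Continuity and derivatives -/

theorem continuous_minor {n N : ℕ} (I : Finset (Fin n)) :
    Continuous (minor I : (Fin n → Fin N → ℝ) → ℝ) := by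
  by_cases h : I.card = N
  · rw [show (minor I : (Fin n → Fin N → ℝ) → ℝ) = fun p => _ from funext (minor_of_card h)]
    apply Continuous.matrix_det
    fun_prop
  · rw [show (minor I : (Fin n → Fin N → ℝ) → ℝ) = fun p => 0 from funext (minor_of_card_ne h)]
    exact continuous_const

/-- `pureM α` as a continuous multilinear map. -/
noncomputable def pureC {N : ℕ} (α : PairPartition N) :
    ContinuousMultilinearMap ℝ (fun _ : Fin (2 * N) => Fin N → ℝ) ℝ :=
  { pureM α with
    cont := by
      change Continuous (pureM α)
      rw [show (pureM α : _ → ℝ) = fun p => _ from funext (pureM_apply α)]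
      unfold dblMinor
      have := fun I => continuous_minor (n := 2 * N) (N := N) I
      fun_prop }

theorem contDiff_pureM {N : ℕ} (α : PairPartition N) : ContDiff ℝ ∞ (pureM α) :=
  (pureC α).contDiff

theorem hasDerivAt_pureM {N : ℕ} (α : PairPartition N) {p : Fin (2 * N) → ℝ → Fin N → ℝ}
    {p' : Fin (2 * N) → Fin N → ℝ} {t : ℝ} (h : ∀ k, HasDerivAt (p k) (p' k) t) :
    HasDerivAt (fun s => pureM α fun k => p k s)
      (∑ k, pureM α (Function.update (fun k => p k t) k (p' k))) t := by
  have := HasFDerivAt.multilinear_comp (f := pureC α) (fun k => (h k).hasFDerivAt)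
  have h2 := this.hasDerivAt
  refine h2.congr_deriv ?_
  simp
  rfl

/-- The `l`-th derivative of the moment curve `(1, t, t², …)`. -/
noncomputable def flag {N : ℕ} (l : ℕ) (t : ℝ) : Fin N → ℝ :=
  fun c => (Nat.descFactorial c l : ℝ) * t ^ ((c : ℕ) - l)

theorem hasDerivAt_flag {N : ℕ} (l : ℕ) (t : ℝ) :
    HasDerivAt (flag l : ℝ → Fin N → ℝ) (flag (l + 1) t) t := by
  rw [hasDerivAt_pi]
  intro c
  unfold flag
  have := ((hasDerivAt_pow ((c : ℕ) - l) t).const_mul (Nat.descFactorial c l : ℝ))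
  refine this.congr_deriv ?_
  rw [Nat.descFactorial_succ]
  push_cast
  rw [Nat.sub_sub]
  ring

theorem flag_eq_zero {N l : ℕ} (h : N ≤ l) (t : ℝ) : (flag l t : Fin N → ℝ) = 0 := by
  funext c
  unfold flag
  rw [Nat.descFactorial_eq_zero_iff_lt.2 (by omega)]
  simp

theorem flag_half_pos {N : ℕ} (t : ℝ) :
    0 < pureM (pairPP N) (fun k => flag (halve k : ℕ) t) := by
  let A : Matrix (Fin N) (Fin N) ℝ := Matrix.of fun c l => flag (l : ℕ) t c
  have h1 : (fun k : Fin (2 * N) => (flag (halve k : ℕ) t : Fin N → ℝ))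
      = fun k => A.mulVec (Pi.single (halve k) 1) := by
    funext k
    rw [Matrix.mulVec_single_one]
    rfl
  rw [h1, pureM_mulVec, pureM_half, if_pos rfl, mul_one]
  have hdet : A.det ≠ 0 := by
    rw [Matrix.det_of_isLowerTriangular, Finset.prod_ne_zero_iff]
    · intro c _
      simp [A, flag, Nat.descFactorial_self, Nat.factorial_ne_zero]
    · intro c l hcl
      have hcl' : c < l := hcl
      simp only [A, Matrix.of_apply, flag]
      rw [Nat.descFactorial_eq_zero_iff_lt.2 hcl']
      simp
  positivity

/-! ### Positivity along a flow -/

/-- The vectors `u k` for `k < K` and the derivatives of the moment curve of orders `l k` at `t`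
for the other `k`. -/
noncomputable def mixed {N : ℕ} (K : ℕ) (u : Fin (2 * N) → Fin N → ℝ) (l : Fin (2 * N) → ℕ)
    (t : ℝ) (k : Fin (2 * N)) : Fin N → ℝ :=
  if (k : ℕ) < K then u k else flag (l k) t

/-- The orders `l` are weakly increasing from `K` on. -/
def MonoFrom {n : ℕ} (K : ℕ) (l : Fin n → ℕ) : Prop :=
  ∀ k k' : Fin n, (k' : ℕ) = k + 1 → K ≤ k → l k ≤ l k'

/-- The orders `l` are weakly increasing and less than `N` from `K` on, and neighbours of the same
order are linked. -/
structure Admissible {N : ℕ} (K : ℕ) (α : PairPartition N) (l : Fin (2 * N) → ℕ) : Prop where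
  lt : ∀ k : Fin (2 * N), K ≤ k → l k < N
  mono : MonoFrom K l
  link : ∀ k k' : Fin (2 * N), (k' : ℕ) = k + 1 → K ≤ k → l k = l k' → α.mate k = k'

theorem pureM_mixed_eq_zero {N K : ℕ} {α : PairPartition N} {l : Fin (2 * N) → ℕ}
    (hm : MonoFrom K l) (h : ¬ Admissible K α l) (u : Fin (2 * N) → Fin N → ℝ) (t : ℝ) :
    pureM α (mixed K u l t) = 0 := by
  by_cases h1 : ∀ k : Fin (2 * N), K ≤ k → l k < N
  · have h2 : ¬ ∀ k k' : Fin (2 * N), (k' : ℕ) = k + 1 → K ≤ k → l k = l k' → α.mate k = k' :=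
      fun h2 => h ⟨h1, hm, h2⟩
    push Not at h2
    obtain ⟨k, k', hk, hK, hl, hne⟩ := h2
    refine pureM_eq_zero _ hk α hne ?_
    rw [mixed, mixed, if_neg (by omega), if_neg (by omega), hl]
  · push Not at h1
    obtain ⟨k, hk, hl⟩ := h1
    refine MultilinearMap.map_coord_zero _ k ?_
    rw [mixed, if_neg (by omega), flag_eq_zero hl]

/-- Raise the order at `k` by one. -/
def raise {n : ℕ} (l : Fin n → ℕ) (k : Fin n) : Fin n → ℕ := Function.update l k (l k + 1)

theorem raise_self {n : ℕ} (l : Fin n → ℕ) (k : Fin n) : raise l k k = l k + 1 :=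
  Function.update_self _ _ _

theorem raise_of_ne {n : ℕ} (l : Fin n → ℕ) {k a : Fin n} (h : a ≠ k) : raise l k a = l a :=
  Function.update_of_ne h _ _

theorem hasDerivAt_mixed {N : ℕ} (K : ℕ) (α : PairPartition N) (u : Fin (2 * N) → Fin N → ℝ)
    (l : Fin (2 * N) → ℕ) (t : ℝ) :
    HasDerivAt (fun s => pureM α (mixed K u l s))
      (∑ k : Fin (2 * N), if (k : ℕ) < K then 0 else pureM α (mixed K u (raise l k) t)) t := by
  have h : ∀ k : Fin (2 * N), HasDerivAt (fun s => mixed K u l s k)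
      (if (k : ℕ) < K then 0 else flag (l k + 1) t) t := by
    intro k
    unfold mixed
    split_ifs
    · exact hasDerivAt_const _ _
    · exact hasDerivAt_flag _ _
  convert hasDerivAt_pureM α h using 1
  refine Finset.sum_congr rfl fun k _ => ?_
  split_ifs with hk
  · rw [MultilinearMap.map_update_zero]
  · congr 1
    funext a
    by_cases ha : a = k
    · rw [ha, Function.update_self, mixed, if_neg hk, raise_self]
    · rw [Function.update_of_ne ha]
      unfold mixed
      rw [raise_of_ne _ ha]

theorem mixed_raise_swap {N K : ℕ} {l : Fin (2 * N) → ℕ} {k k' : Fin (2 * N)}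
    (hk : (k' : ℕ) = k + 1) (hK : K ≤ k) (hl : l k = l k') (u : Fin (2 * N) → Fin N → ℝ) (t : ℝ) :
    mixed K u (raise l k) t = mixed K u (raise l k') t ∘ Equiv.swap k k' := by
  have hne : k ≠ k' := by rw [ne_eq, Fin.ext_iff]; omega
  funext a
  rw [Function.comp_apply, Equiv.swap_apply_def]
  split_ifs with h1 h2
  · rw [h1, mixed, mixed, if_neg (by omega), if_neg (by omega), raise_self, raise_self, hl]
  · rw [h2, mixed, mixed, if_neg (by omega), if_neg (by omega), raise_of_ne _ hne,
      raise_of_ne _ hne.symm, hl]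
  · unfold mixed
    rw [raise_of_ne _ h1, raise_of_ne _ h2]

theorem MonoFrom.raise {N K : ℕ} {l : Fin (2 * N) → ℕ} (hm : MonoFrom K l) {k : Fin (2 * N)}
    (h : ∀ k' : Fin (2 * N), (k' : ℕ) = k + 1 → l k' ≠ l k) :
    MonoFrom K (_root_.raise l k) := by
  intro a a' ha hK
  have h1 := hm a a' ha hK
  by_cases e1 : a = k
  · have h2 := h a' (by rw [← e1]; exact ha)
    have e2 : a' ≠ k := by rw [ne_eq, Fin.ext_iff, ← e1]; omega
    rw [raise_of_ne _ e2, e1, raise_self]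
    rw [e1] at h1
    omega
  · rw [raise_of_ne _ e1]
    by_cases e2 : a' = k
    · rw [e2, raise_self]; rw [e2] at h1; omega
    · rwa [raise_of_ne _ e2]

/-- No order can be raised so that the state remains admissible, up to a change of the pair
partition. -/
structure NoSuccessor {N : ℕ} (K : ℕ) (α : PairPartition N) (l : Fin (2 * N) → ℕ) : Prop where
  single : ∀ k : Fin (2 * N), K ≤ k → (∀ k' : Fin (2 * N), (k' : ℕ) = k + 1 → l k' ≠ l k) →
    l k + 1 < N → ∃ k' : Fin (2 * N), (k' : ℕ) = k + 1 ∧ l k' = l k + 1 ∧ α.mate k ≠ k'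
  double : ∀ k k' k'' : Fin (2 * N), (k' : ℕ) = k + 1 → (k'' : ℕ) = k' + 1 → K ≤ k →
    l k = l k' → l k'' = l k' + 1 → ∃ k''' : Fin (2 * N), (k''' : ℕ) = k'' + 1 ∧ l k''' = l k''

theorem raise_potential {N : ℕ} {l : Fin (2 * N) → ℕ} {k : Fin (2 * N)} (h : l k < N) :
    ∑ a, (N - raise l k a) < ∑ a, (N - l a) := by
  apply Finset.sum_lt_sum
  · intro a _
    by_cases ha : a = k
    · rw [ha, raise_self]; omega
    · rw [raise_of_ne _ ha]
  · exact ⟨k, Finset.mem_univ _, by rw [raise_self]; omega⟩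

theorem pureM_mixed_pos {N K : ℕ} (A : PairPartition N → Prop)
    (hA : ∀ (α β : PairPartition N) (k k' : Fin (2 * N)) (hk : (k' : ℕ) = k + 1), K ≤ k → A α →
      capPP β k k' hk = α → A β)
    (u : Fin (2 * N) → Fin N → ℝ) (t₀ : ℝ)
    (h0 : ∀ α l, A α → Admissible K α l → 0 ≤ pureM α (mixed K u l t₀))
    (h1 : ∀ α l, A α → Admissible K α l → NoSuccessor K α l → 0 < pureM α (mixed K u l t₀)) :
    ∀ α l, A α → Admissible K α l → ∀ t > t₀, 0 < pureM α (mixed K u l t) := by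
  have main : ∀ d : ℕ, ∀ α l, A α → Admissible K α l → ∑ a, (N - l a) = d →
      ∀ t > t₀, 0 < pureM α (mixed K u l t) := by
    intro d
    induction d using Nat.strong_induction_on with
    | _ d ih =>
      intro α l hα hl hd
      have hpos : ∀ β k, A β → K ≤ (k : Fin (2 * N)) → Admissible K β (raise l k) →
          ∀ t > t₀, 0 < pureM β (mixed K u (raise l k) t) := fun β k hβ hk had =>
        ih _ (hd ▸ raise_potential (hl.lt k hk)) β _ hβ had rfl
      have hnn : ∀ β k, A β → K ≤ (k : Fin (2 * N)) → MonoFrom K (raise l k) →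
          ∀ t > t₀, 0 ≤ pureM β (mixed K u (raise l k) t) := by
        intro β k hβ hk hm t ht
        by_cases had : Admissible K β (raise l k)
        · exact (hpos β k hβ hk had t ht).le
        · rw [pureM_mixed_eq_zero hm had]
      -- raising the first of two linked points of the same order
      have hdouble : ∀ k k' : Fin (2 * N), (k' : ℕ) = k + 1 → K ≤ k → l k = l k' →
          MonoFrom K (raise l k') := by
        intro k k' hk hK hlk
        refine hl.mono.raise fun k'' hk'' he => ?_
        have e1 := hl.link k k' hk hK hlk
        have e2 := hl.link k' k'' hk'' (by omega) he.symm
        rw [α.mate_eq_comm.1 e1, Fin.ext_iff] at e2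
        omega
      have hterm : ∀ k : Fin (2 * N), K ≤ k → ∀ t > t₀,
          0 ≤ pureM α (mixed K u (raise l k) t) := by
        classical
        intro k hK t ht
        by_cases hs : ∃ k' : Fin (2 * N), (k' : ℕ) = k + 1 ∧ l k' = l k
        · obtain ⟨k', hk, hlk⟩ := hs
          rw [mixed_raise_swap hk hK hlk.symm, pureM_swap_of_eq _ hk α (hl.link k k' hk hK hlk.symm)]
          have hm := hdouble k k' hk hK hlk.symm
          refine add_nonneg (hnn α k' hα (by omega) hm t ht) (Finset.sum_nonneg fun β hβ => ?_)
          rw [Finset.mem_filter] at hβ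
          exact hnn β k' (hA α β k k' hk hK hα hβ.2.2) (by omega) hm t ht
        · push Not at hs
          exact hnn α k hα hK (hl.mono.raise hs) t ht
      have hderiv : ∀ t > t₀, 0 ≤ deriv (fun s => pureM α (mixed K u l s)) t := by
        intro t ht
        rw [(hasDerivAt_mixed K α u l t).deriv]
        refine Finset.sum_nonneg fun k _ => ?_
        split_ifs with hk
        · exact le_rfl
        · exact hterm k (not_lt.1 hk) t ht
      have hcont : Continuous fun s => pureM α (mixed K u l s) :=
        continuous_iff_continuousAt.2 fun t => (hasDerivAt_mixed K α u l t).continuousAt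
      have hdiff : Differentiable ℝ fun s => pureM α (mixed K u l s) :=
        fun t => (hasDerivAt_mixed K α u l t).differentiableAt
      intro t ht
      by_cases hsucc : NoSuccessor K α l
      · have hmono := monotoneOn_of_deriv_nonneg (convex_Ici t₀) hcont.continuousOn
          hdiff.differentiableOn (fun s hs => hderiv s (by simpa using hs))
        exact (h1 α l hα hl hsucc).trans_le (hmono Set.self_mem_Ici ht.le ht.le)
      · -- a successor
        have hex : ∃ k : Fin (2 * N), K ≤ k ∧ ∀ t > t₀,
            0 < pureM α (mixed K u (raise l k) t) := by
          by_contra hno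
          push Not at hno
          apply hsucc
          constructor
          · intro k hK hs hlt
            by_contra hcon
            push Not at hcon
            obtain ⟨t, ht, hle⟩ := hno k hK
            refine absurd (hpos α k hα hK ⟨?_, hl.mono.raise hs, ?_⟩ t ht) (not_lt.2 hle)
            · intro a ha
              by_cases e : a = k
              · rw [e, raise_self]; exact hlt
              · rw [raise_of_ne _ e]; exact hl.lt a ha
            · intro a a' ha hKa hla
              by_cases e1 : a = k
              · have e2 : a' ≠ k := by rw [ne_eq, Fin.ext_iff, ← e1]; omega
                rw [e1, raise_self, raise_of_ne _ e2] at hla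
                rw [e1]
                exact hcon a' (by rw [← e1]; exact ha) hla.symm
              · by_cases e2 : a' = k
                · rw [e2, raise_self, raise_of_ne _ e1] at hla
                  have := hl.mono a a' ha hKa
                  rw [e2] at this
                  omega
                · rw [raise_of_ne _ e1, raise_of_ne _ e2] at hla
                  exact hl.link a a' ha hKa hla
          · intro k k' k'' hk hk' hK hlk hlk'
            by_contra hcon
            push Not at hcon
            obtain ⟨t, ht, hle⟩ := hno k hK
            refine absurd ?_ (not_lt.2 hle)
            classical
            have hmate := hl.link k k' hk hK hlk
            have hne1 : k ≠ k'' := by rw [ne_eq, Fin.ext_iff]; omega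
            have hne2 : k' ≠ k'' := by rw [ne_eq, Fin.ext_iff]; omega
            have hne3 : k ≠ k' := by rw [ne_eq, Fin.ext_iff]; omega
            rw [mixed_raise_swap hk hK hlk, pureM_swap_of_eq _ hk α hmate]
            have hm := hdouble k k' hk hK hlk
            set β := capPP α k' k'' hk' with hβ
            have hcap : capPP β k k' hk = α := capPP_capPP_left α hk hk' hmate
            have hβA : A β := hA α β k k' hk hK hα hcap
            refine add_pos_of_nonneg_of_pos (hnn α k' hα (by omega) hm t ht)
              (Finset.sum_pos' (fun γ hγ => ?_) ⟨β, ?_, ?_⟩)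
            · rw [Finset.mem_filter] at hγ
              exact hnn γ k' (hA α γ k k' hk hK hα hγ.2.2) (by omega) hm t ht
            · rw [Finset.mem_filter]
              refine ⟨Finset.mem_univ _, fun h => ?_, hcap⟩
              rw [β.mate_eq_comm, hβ, capPP_mate_left] at h
              exact hne1 h.symm
            · refine hpos β k' hβA (by omega) ⟨?_, hm, ?_⟩ t ht
              · intro a ha
                by_cases e : a = k'
                · rw [e, raise_self, ← hlk']; exact hl.lt k'' (by omega)
                · rw [raise_of_ne _ e]; exact hl.lt a ha
              · intro a a' ha hKa hla
                by_cases e1 : a = k'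
                · have e2 : a' = k'' := by rw [Fin.ext_iff]; rw [e1] at ha; omega
                  rw [e1, e2, hβ]; exact capPP_mate_left _ _ _ _
                by_cases e2 : a' = k'
                · have e3 : a = k := by rw [Fin.ext_iff]; rw [e2] at ha; omega
                  rw [e2, e3, raise_self, raise_of_ne _ hne3] at hla
                  omega
                rw [raise_of_ne _ e1, raise_of_ne _ e2] at hla
                have hlink := hl.link a a' ha hKa hla
                have e3 : a ≠ k'' := fun e => hcon a' (by rw [← e]; exact ha) (by rw [← hla, e])
                have e4 : a ≠ k := fun e => e2 (by
                  rw [Fin.ext_iff]; rw [e] at ha; omega)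
                rw [hβ, capPP_mate_of_ne α hk' e1 e3, hlink]
                · rw [α.mate_eq_comm.1 hmate]; exact e4
                · intro e5
                  rw [e5, α.mate_mate] at hlink
                  rw [← hlink] at ha
                  have e6 : a = k' := by rw [Fin.ext_iff]; omega
                  exact e1 e6
        obtain ⟨k, hK, hk⟩ := hex
        have hstrict : StrictMonoOn (fun s => pureM α (mixed K u l s)) (Set.Ici t₀) := by
          refine strictMonoOn_of_deriv_pos (convex_Ici t₀) hcont.continuousOn fun s hs => ?_
          have hs' : t₀ < s := by simpa using hs
          rw [(hasDerivAt_mixed K α u l s).deriv]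
          refine Finset.sum_pos' (fun a _ => ?_) ⟨k, Finset.mem_univ _, ?_⟩
          · split_ifs with ha
            · exact le_rfl
            · exact hterm a (not_lt.1 ha) s hs'
          · rw [if_neg (not_lt.2 hK)]; exact hk s hs'
        exact (h0 α l hα hl).trans_lt (hstrict Set.self_mem_Ici ht.le ht)
  intro α l hα hl
  exact main _ α l hα hl rfl

/-! ### States without successor -/

theorem IsNoncrossing.exists_adjacent {n : ℕ} {f : Fin n → Fin n} (hf : IsNoncrossing f)
    {k : Fin n} (h : k < f k) :
    ∃ a a' : Fin n, (a' : ℕ) = a + 1 ∧ f a = a' ∧ k ≤ a ∧ a' ≤ f k := by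
  have main : ∀ d : ℕ, ∀ k : Fin n, k < f k → (f k : ℕ) - k = d →
      ∃ a a' : Fin n, (a' : ℕ) = a + 1 ∧ f a = a' ∧ k ≤ a ∧ a' ≤ f k := by
    intro d
    induction d using Nat.strong_induction_on with
    | _ d ih =>
      intro k hk hd
      rw [Fin.lt_def] at hk
      by_cases h1 : (f k : ℕ) = k + 1
      · exact ⟨k, f k, h1, rfl, le_rfl, le_rfl⟩
      · let b : Fin n := ⟨k + 1, by omega⟩
        have hb : (b : ℕ) = k + 1 := rfl
        have n1 := hf.nc k b (by rw [Fin.lt_def]; omega) (by rw [Fin.lt_def]; omega)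
        have n2 : f b ≠ f k := fun e => by
          have := congrArg Fin.val (hf.inj.1 e); omega
        have n3 : f b ≠ k := fun e => by
          have := congrArg Fin.val (hf.eq_comm.1 e); omega
        have n4 := hf.ne b
        have n5 : ¬ (f b < k) := fun e => by
          refine hf.nc (f b) k e ?_ ?_
          · rw [hf.invol, Fin.lt_def]; omega
          · rw [hf.invol, Fin.lt_def]; omega
        simp only [Fin.lt_def, ne_eq, Fin.ext_iff] at n1 n2 n3 n4 n5
        obtain ⟨a, a', e1, e2, e3, e4⟩ := ih (f b - b) (by omega) b (by rw [Fin.lt_def]; omega) rfl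
        rw [Fin.le_def] at e3 e4
        exact ⟨a, a', e1, e2, by rw [Fin.le_def]; omega, by rw [Fin.le_def]; omega⟩
  exact main _ k h rfl

/-- If there are no successors, then from `K` on there are singly occupied orders up to a point
`m` followed by doubly occupied ones. -/
theorem NoSuccessor.exists_split {N K : ℕ} {α : PairPartition N} {l : Fin (2 * N) → ℕ}
    (hl : Admissible K α l) (h : NoSuccessor K α l) (hKN : K ≤ 2 * N) :
    ∃ m b : ℕ, K ≤ m ∧ m + 2 * b = 2 * N ∧ (∀ k : Fin (2 * N), m ≤ k → m ≤ (α.mate k : ℕ)) ∧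
      (∀ k : Fin (2 * N), (k : ℕ) = m → l k + b = N) ∧
      (∀ k : Fin (2 * N), K ≤ k → (k : ℕ) < m → l k + (m - k) + b = N ∧
        ∀ k' : Fin (2 * N), (k' : ℕ) = k + 1 → α.mate k ≠ k') := by
  have main : ∀ d L : ℕ, K ≤ L → L + d = 2 * N →
      (∀ k k' : Fin (2 * N), (k' : ℕ) = L → (k' : ℕ) = k + 1 → K ≤ k → l k ≠ l k') →
      ∃ m b : ℕ, L ≤ m ∧ m + 2 * b = 2 * N ∧ (∀ k : Fin (2 * N), m ≤ k → m ≤ (α.mate k : ℕ)) ∧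
      (∀ k : Fin (2 * N), (k : ℕ) = m → l k + b = N ∧
        ∃ k' : Fin (2 * N), (k' : ℕ) = k + 1 ∧ l k' = l k) ∧
      (∀ k : Fin (2 * N), L ≤ k → (k : ℕ) < m → l k + (m - k) + b = N ∧
        ∀ k' : Fin (2 * N), (k' : ℕ) = k + 1 → α.mate k ≠ k') := by
    intro d
    induction d using Nat.strong_induction_on with
    | _ d ih =>
      intro L hKL hLd hbd
      rcases Nat.eq_zero_or_pos d with hd | hd
      · exact ⟨L, 0, le_rfl, by omega, fun k hk => by omega, fun k hk => by omega,
          fun k hk => by omega⟩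
      let k0 : Fin (2 * N) := ⟨L, by omega⟩
      have hk0 : (k0 : ℕ) = L := rfl
      have hlt0 := hl.lt k0 (by omega)
      by_cases hdbl : ∃ k1 : Fin (2 * N), (k1 : ℕ) = k0 + 1 ∧ l k1 = l k0
      · obtain ⟨k1, hk1, hl1⟩ := hdbl
        have hmate := hl.link k0 k1 hk1 (by omega) hl1.symm
        have hmate' := α.mate_eq_comm.1 hmate
        have hnext : ∀ k2 : Fin (2 * N), (k2 : ℕ) = k1 + 1 → l k2 ≠ l k1 := fun k2 hk2 e => by
          have := hl.link k1 k2 hk2 (by omega) e.symm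
          rw [hmate', Fin.ext_iff] at this
          omega
        obtain ⟨m, b, h1, h2, h3, h4, h5⟩ := ih (d - 2) (by omega) (L + 2) (by omega) (by omega)
          (fun k k' hk' hkk _ => by
            have : k = k1 := by rw [Fin.ext_iff]; omega
            rw [this]
            exact (hnext k' (by omega)).symm)
        have hs := h.single k1 (by omega) hnext
        have hm : m = L + 2 := by
          by_contra hne
          let k2 : Fin (2 * N) := ⟨L + 2, by omega⟩
          have hk2 : (k2 : ℕ) = L + 2 := rfl
          have e5 := (h5 k2 (by omega) (by omega)).1
          have hlt2 := hl.lt k2 (by omega)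
          have hmono := hl.mono k1 k2 (by omega) (by omega)
          have hne2 := hnext k2 (by omega)
          obtain ⟨k', hk', hl', -⟩ := hs (by omega)
          have : k' = k2 := by rw [Fin.ext_iff]; omega
          rw [this] at hl'
          obtain ⟨k3, hk3, hl3⟩ := h.double k0 k1 k2 hk1 (by omega) (by omega) hl1.symm hl'
          by_cases hm3 : (k3 : ℕ) < m
          · have e6 := (h5 k3 (by omega) hm3).1
            omega
          · have e6 := (h4 k3 (by omega)).1
            omega
        subst hm
        refine ⟨L, b + 1, le_rfl, by omega, ?_, ?_, fun k hk hk' => by omega⟩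
        · intro k hk
          by_cases e0 : k = k0
          · rw [e0, hmate]; omega
          by_cases e1 : k = k1
          · rw [e1, hmate']
          · have := h3 k (by
              rw [Fin.ext_iff] at e0 e1; omega)
            omega
        · intro k hk
          have e0 : k = k0 := by rw [Fin.ext_iff]; omega
          rw [e0]
          refine ⟨?_, k1, hk1, hl1⟩
          by_cases hN : L + 2 = 2 * N
          · by_contra hcon
            obtain ⟨k', hk', -⟩ := hs (by omega)
            have := k'.2
            omega
          · let k2 : Fin (2 * N) := ⟨L + 2, by omega⟩
            have hk2 : (k2 : ℕ) = L + 2 := rfl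
            have hlt2 := hl.lt k2 (by omega)
            have hmono := hl.mono k1 k2 (by omega) (by omega)
            have hne2 := hnext k2 (by omega)
            have e6 := (h4 k2 (by omega)).1
            obtain ⟨k', hk', hl', -⟩ := hs (by omega)
            have : k' = k2 := by rw [Fin.ext_iff]; omega
            rw [this] at hl'
            omega
      · push Not at hdbl
        obtain ⟨m, b, h1, h2, h3, h4, h5⟩ := ih (d - 1) (by omega) (L + 1) (by omega) (by omega)
          (fun k k' hk' hkk _ => by
            have : k = k0 := by rw [Fin.ext_iff]; omega
            rw [this]
            exact (hdbl k' (by omega)).symm)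
        have hs := h.single k0 (by omega) hdbl
        have key : l k0 + (m - k0) + b = N ∧
            ∀ k' : Fin (2 * N), (k' : ℕ) = k0 + 1 → α.mate k0 ≠ k' := by
          by_cases hN : L + 1 = 2 * N
          · constructor
            · by_contra hcon
              obtain ⟨k', hk', -⟩ := hs (by omega)
              have := k'.2
              omega
            · intro k' hk'
              have := k'.2
              omega
          · let k1 : Fin (2 * N) := ⟨L + 1, by omega⟩
            have hk1 : (k1 : ℕ) = L + 1 := rfl
            have hlt1 := hl.lt k1 (by omega)
            have hmono := hl.mono k0 k1 (by omega) (by omega)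
            have hne1 := hdbl k1 (by omega)
            obtain ⟨k', hk', hl', hm'⟩ := hs (by omega)
            have e : k' = k1 := by rw [Fin.ext_iff]; omega
            rw [e] at hl' hm'
            constructor
            · by_cases hm3 : (k1 : ℕ) < m
              · have e6 := (h5 k1 (by omega) hm3).1
                omega
              · have e6 := (h4 k1 (by omega)).1
                omega
            · intro k'' hk''
              have e : k'' = k1 := by rw [Fin.ext_iff]; omega
              rw [e]; exact hm'
        refine ⟨m, b, by omega, h2, h3, h4, fun k hk hk' => ?_⟩
        by_cases e0 : k = k0
        · rw [e0]; exact key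
        · exact h5 k (by rw [Fin.ext_iff] at e0; omega) hk'
  obtain ⟨m, b, h1, h2, h3, h4, h5⟩ := main (2 * N - K) K le_rfl (by omega)
    (fun k k' h1 h2 h3 => by omega)
  exact ⟨m, b, h1, h2, h3, fun k hk => (h4 k hk).1, h5⟩

/-- If there are no successors, then the singly occupied orders from `K` on are linked to points
before `K`. -/
theorem NoSuccessor.structure {N K : ℕ} {α : PairPartition N} {l : Fin (2 * N) → ℕ}
    (hl : Admissible K α l) (h : NoSuccessor K α l) (hKN : K ≤ 2 * N) :
    ∃ m : ℕ, K ≤ m ∧ m ≤ 2 * N ∧ (∀ k : Fin (2 * N), m ≤ k → m ≤ (α.mate k : ℕ)) ∧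
      (∀ k : Fin (2 * N), (k : ℕ) = K → 2 * l k + m = 2 * K) ∧
      (∀ k : Fin (2 * N), K ≤ k → (k : ℕ) < m → 2 * l k + m = 2 * k ∧ (α.mate k : ℕ) < K) ∧
      (∀ k k' : Fin (2 * N), K ≤ k → (k : ℕ) ≤ k' → (k' : ℕ) < m →
        (α.mate k' : ℕ) + (k' - k) ≤ α.mate k) := by
  obtain ⟨m, b, h1, h2, h3, h4, h5⟩ := h.exists_split hl hKN
  have hmate : ∀ k : Fin (2 * N), K ≤ k → (k : ℕ) < m → (α.mate k : ℕ) < K := by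
    intro k hK hk
    by_contra hcon
    have hlt : (α.mate k : ℕ) < m := by
      by_contra hge
      have := h3 _ (not_lt.1 hge)
      rw [α.mate_mate] at this
      omega
    have hne := α.mate_ne k
    have key : ∀ a : Fin (2 * N), K ≤ a → a < α.mate a → (α.mate a : ℕ) < m → False := by
      intro a ha hlt hm
      obtain ⟨c, c', e1, e2, e3, e4⟩ := α.mate_isNoncrossing.exists_adjacent hlt
      rw [Fin.le_def] at e3 e4
      exact (h5 c (by omega) (by omega)).2 c' e1 e2
    rcases lt_or_gt_of_ne hne with e | e
    · exact key (α.mate k) (not_lt.1 hcon) (by rw [α.mate_mate]; exact e)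
        (by rw [α.mate_mate]; exact hk)
    · exact key k hK e hlt
  refine ⟨m, h1, by omega, h3, ?_, fun k hK hk => ⟨?_, hmate k hK hk⟩, ?_⟩
  · intro k hk
    by_cases e : K < m
    · have := (h5 k (by omega) (by omega)).1
      omega
    · have := h4 k (by omega)
      omega
  · have := (h5 k hK hk).1
    omega
  · have main : ∀ s : ℕ, ∀ k k' : Fin (2 * N), K ≤ k → (k' : ℕ) = k + s → (k' : ℕ) < m →
        (α.mate k' : ℕ) + s ≤ α.mate k := by
      intro s
      induction s with
      | zero =>
        intro k k' _ hk _
        have : k' = k := by rw [Fin.ext_iff]; omega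
        rw [this]; rfl
      | succ s ih =>
        intro k k' hK hk hm
        let c : Fin (2 * N) := ⟨k + s, by omega⟩
        have hc : (c : ℕ) = k + s := rfl
        have h6 := ih k c hK hc (by omega)
        have m1 := hmate c (by omega) (by omega)
        have m2 := hmate k' (by omega) hm
        have n1 := α.mate_isNoncrossing.nc (α.mate c) (α.mate k')
        rw [α.mate_mate, α.mate_mate] at n1
        simp only [Fin.lt_def] at n1
        have n2 : (α.mate c : ℕ) ≠ α.mate k' := fun e => by
          have := congrArg Fin.val (α.mate_inj.1 (Fin.ext e)); omega
        omega
    intro k k' hK hkk hm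
    exact main _ k k' hK (by omega) hm

/-! ### Positivity at distinct points -/

theorem pureM_mixed_zero_pos {N : ℕ} {α : PairPartition N} {l : Fin (2 * N) → ℕ}
    (hl : Admissible 0 α l) (u : Fin (2 * N) → Fin N → ℝ) (t : ℝ) :
    0 < pureM α (mixed 0 u l t) := by
  have hhalf := eq_half_of_monotone l (fun k => hl.lt k (Nat.zero_le _)) (fun k k' hk => by
    let c : Fin (2 * N) := ⟨k + 1, by omega⟩
    have h1 := hl.mono k c rfl (Nat.zero_le _)
    have h2 := hl.mono c k' (by rw [hk]) (Nat.zero_le _)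
    by_contra hcon
    have h3 := hl.link k c rfl (Nat.zero_le _) (by omega)
    have h4 := hl.link c k' (by rw [hk]) (Nat.zero_le _) (by omega)
    rw [α.mate_eq_comm.1 h3, Fin.ext_iff] at h4
    omega)
  have hα : α = pairPP N := by
    apply mate_injective
    rw [pairPP, mate_ofMate]
    have key : ∀ k : Fin (2 * N), (k : ℕ) % 2 = 0 → α.mate k = pairFun k := by
      intro k hk
      have hv : (pairFun k : ℕ) = k + 1 := by rw [pairFun_val, if_pos hk]
      exact hl.link k _ hv (Nat.zero_le _) (by rw [hhalf, hhalf, hv]; omega)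
    funext k
    by_cases hk : (k : ℕ) % 2 = 0
    · exact key k hk
    · have hv : (pairFun k : ℕ) = k - 1 := by rw [pairFun_val, if_neg hk]
      have := key (pairFun k) (by rw [hv]; omega)
      rw [(isNoncrossing_pairFun N).invol] at this
      exact α.mate_eq_comm.1 this
  have hv : mixed 0 u l t = fun k => flag (halve k : ℕ) t := by
    funext k
    rw [mixed, if_neg (by omega), hhalf k]
    rfl
  rw [hv, hα]
  exact flag_half_pos t

theorem flow_pos_of_strictMono {N : ℕ} {x : Fin (2 * N) → ℝ} (hx : StrictMono x) :
    ∀ K ≤ 2 * N, ∀ (α : PairPartition N) (l : Fin (2 * N) → ℕ), Admissible K α l →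
      ∀ t, (∀ k : Fin (2 * N), (k : ℕ) < K → x k < t) →
        0 < pureM α (mixed K (fun k => flag 0 (x k)) l t) := by
  intro K
  induction K with
  | zero => intro _ α l hl t _; exact pureM_mixed_zero_pos hl _ t
  | succ K ih =>
    intro hK α l hl t ht
    let c : Fin (2 * N) := ⟨K, by omega⟩
    have hc : (c : ℕ) = K := rfl
    have hinit : ∀ l : Fin (2 * N) → ℕ, mixed (K + 1) (fun k => flag 0 (x k)) l (x c)
        = mixed K (fun k => flag 0 (x k)) (Function.update l c 0) (x c) := by
      intro l
      funext k
      unfold mixed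
      by_cases h1 : (k : ℕ) < K
      · rw [if_pos h1, if_pos (by omega)]
      · rw [if_neg h1]
        by_cases h2 : k = c
        · rw [h2, Function.update_self, if_pos (by omega)]
        · rw [Function.update_of_ne h2, if_neg]
          rw [Fin.ext_iff] at h2; omega
    have hmono : ∀ l : Fin (2 * N) → ℕ, MonoFrom (K + 1) l →
        MonoFrom K (Function.update l c 0) := by
      intro l hl k k' hk hKk
      by_cases h2 : k = c
      · rw [h2, Function.update_self]; exact Nat.zero_le _
      · have h3 : k' ≠ c := by rw [ne_eq, Fin.ext_iff]; omega
        rw [Function.update_of_ne h2, Function.update_of_ne h3]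
        exact hl k k' hk (by rw [Fin.ext_iff] at h2; omega)
    have hxc : ∀ k : Fin (2 * N), (k : ℕ) < K → x k < x c := fun k hk => hx (Fin.lt_def.2 hk)
    have hpos : ∀ α l, Admissible K α (Function.update l c 0) →
        0 < pureM α (mixed (K + 1) (fun k => flag 0 (x k)) l (x c)) := by
      intro α l hl
      rw [hinit]
      exact ih (by omega) α _ hl (x c) hxc
    refine pureM_mixed_pos (K := K + 1) (fun _ => True) (fun _ _ _ _ _ _ _ _ => trivial) _ (x c)
      ?_ ?_ α l trivial hl t (ht c (by omega))
    · intro α l _ hl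
      by_cases h : Admissible K α (Function.update l c 0)
      · exact (hpos α l h).le
      · rw [hinit, pureM_mixed_eq_zero (hmono l hl.mono) h]
    · intro α l _ hl hs
      apply hpos
      refine ⟨?_, hmono l hl.mono, ?_⟩
      · intro k hk
        by_cases h2 : k = c
        · rw [h2, Function.update_self]; omega
        · rw [Function.update_of_ne h2]
          exact hl.lt k (by rw [Fin.ext_iff] at h2; omega)
      · intro k k' hk hKk hlk
        have h3 : k' ≠ c := by rw [ne_eq, Fin.ext_iff]; omega
        rw [Function.update_of_ne h3] at hlk
        by_cases h2 : k = c
        · rw [h2, Function.update_self] at hlk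
          rw [h2] at hk ⊢
          obtain ⟨m, e1, e2, -, e4, e5, e6⟩ := hs.structure hl hK
          have a1 := e4 k' (by omega)
          have a2 := (e5 k' (by omega) (by omega)).2
          have a3 := e6 k' ⟨m - 1, by omega⟩ (by omega) (by dsimp only; omega)
            (by dsimp only; omega)
          dsimp only at a3
          rw [α.mate_eq_comm, Fin.ext_iff]
          omega
        · rw [Function.update_of_ne h2] at hlk
          exact hl.link k k' hk (by rw [Fin.ext_iff] at h2; omega) hlk

theorem pureM_moment_pos {N : ℕ} (α : PairPartition N) {x : Fin (2 * N) → ℝ} (hx : StrictMono x) :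
    0 < pureM α (fun k => flag 0 (x k)) := by
  obtain ⟨t, ht⟩ : ∃ t, ∀ k, x k < t := by
    obtain ⟨M, hM⟩ := (Set.finite_range x).bddAbove
    exact ⟨M + 1, fun k => (hM ⟨k, rfl⟩).trans_lt (lt_add_one M)⟩
  have := flow_pos_of_strictMono hx (2 * N) le_rfl α 0
    ⟨fun k hk => by have := k.2; omega, fun k _ _ hk => by have := k.2; omega,
      fun k _ _ hk => by have := k.2; omega⟩ t (fun k _ => ht k)
  convert this using 2
  funext k
  rw [mixed, if_pos k.2]

/-! ### Positivity at double points -/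

/-- The moment curve at `y j` for the first point over `j`, and its derivative for the second. -/
noncomputable def doubled {N : ℕ} (y : Fin N → ℝ) (k : Fin (2 * N)) : Fin N → ℝ :=
  flag ((k : ℕ) % 2) (y (halve k))

theorem flow_pos_doubled {N : ℕ} {y : Fin N → ℝ} (hy : StrictMono y) :
    ∀ M ≤ N, ∀ (α : PairPartition N) (l : Fin (2 * N) → ℕ),
      (∀ k k' : Fin (2 * N), (k' : ℕ) = k + 1 → (k : ℕ) % 2 = 0 → (k' : ℕ) < 2 * M →
        α.mate k ≠ k') →
      Admissible (2 * M) α l → ∀ t, (∀ k : Fin N, (k : ℕ) < M → y k < t) →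
        0 < pureM α (mixed (2 * M) (doubled y) l t) := by
  intro M
  induction M with
  | zero => intro _ α l _ hl t _; exact pureM_mixed_zero_pos hl _ t
  | succ M ih =>
    intro hM α l hα hl t ht
    let A : ℕ → PairPartition N → Prop := fun M α =>
      ∀ k k' : Fin (2 * N), (k' : ℕ) = k + 1 → (k : ℕ) % 2 = 0 → (k' : ℕ) < 2 * M → α.mate k ≠ k'
    have hA : ∀ (M : ℕ) (α β : PairPartition N) (k k' : Fin (2 * N)) (hk : (k' : ℕ) = k + 1),
        2 * M ≤ (k : ℕ) → A M α → capPP β k k' hk = α → A M β := by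
      rintro M _ β k k' hk hK hα rfl a a' ha hpar hlt hmate
      refine hα a a' ha hpar hlt ?_
      have hβ := β.mate_eq_comm.1 hmate
      have n1 : a ≠ k := by rw [ne_eq, Fin.ext_iff]; omega
      have n2 : a ≠ k' := by rw [ne_eq, Fin.ext_iff]; omega
      rw [capPP_mate_of_ne β hk n1 n2, hmate]
      · intro e
        rw [e, β.mate_mate, Fin.ext_iff] at hmate
        omega
      · intro e
        rw [e, β.mate_mate, Fin.ext_iff] at hmate
        omega
    let j : Fin N := ⟨M, by omega⟩
    have hj : (j : ℕ) = M := rfl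
    let c : Fin (2 * N) := ⟨2 * M, by omega⟩
    have hc : (c : ℕ) = 2 * M := rfl
    let d : Fin (2 * N) := ⟨2 * M + 1, by omega⟩
    have hd : (d : ℕ) = 2 * M + 1 := rfl
    have hcd : c ≠ d := by rw [ne_eq, Fin.ext_iff]; omega
    let L : (Fin (2 * N) → ℕ) → Fin (2 * N) → ℕ := fun l =>
      Function.update (Function.update l c 0) d 1
    have Lc : ∀ l, L l c = 0 := fun l => by
      simp only [L]; rw [Function.update_of_ne hcd, Function.update_self]
    have Ld : ∀ l, L l d = 1 := fun l => by simp only [L]; rw [Function.update_self]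
    have Lo : ∀ l (k : Fin (2 * N)), 2 * (M + 1) ≤ (k : ℕ) → L l k = l k := fun l k hk => by
      simp only [L]
      rw [Function.update_of_ne, Function.update_of_ne] <;> rw [ne_eq, Fin.ext_iff] <;> omega
    have hcases : ∀ k : Fin (2 * N), 2 * M ≤ k → k = c ∨ k = d ∨ 2 * (M + 1) ≤ (k : ℕ) := by
      intro k hk
      rw [Fin.ext_iff, Fin.ext_iff]; omega
    have hinit : ∀ l : Fin (2 * N) → ℕ, mixed (2 * (M + 1)) (doubled y) l (y j)
        = mixed (2 * M) (doubled y) (L l) (y j) := by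
      intro l
      funext k
      unfold mixed
      by_cases h1 : (k : ℕ) < 2 * M
      · rw [if_pos h1, if_pos (by omega)]
      · rw [if_neg h1]
        rcases hcases k (not_lt.1 h1) with rfl | rfl | h2
        · rw [if_pos (by omega), Lc, doubled]
          have e1 : (c : ℕ) % 2 = 0 := by omega
          have e2 : halve c = j := by rw [Fin.ext_iff, halve]; dsimp only; omega
          rw [e1, e2]
        · rw [if_pos (by omega), Ld, doubled]
          have e1 : (d : ℕ) % 2 = 1 := by omega
          have e2 : halve d = j := by rw [Fin.ext_iff, halve]; dsimp only; omega
          rw [e1, e2]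
        · rw [if_neg (by omega), Lo l k h2]
    have hyj : ∀ k : Fin N, (k : ℕ) < M → y k < y j := fun k hk => hy (Fin.lt_def.2 hk)
    have hpos : ∀ α l, A M α → Admissible (2 * M) α l →
        0 < pureM α (mixed (2 * M) (doubled y) l (y j)) := fun α l hα hl =>
      ih (by omega) α l hα hl (y j) hyj
    have hnn : ∀ α l, A M α → MonoFrom (2 * M) l →
        0 ≤ pureM α (mixed (2 * M) (doubled y) l (y j)) := by
      intro α l hα hm
      by_cases h : Admissible (2 * M) α l
      · exact (hpos α l hα h).le
      · rw [pureM_mixed_eq_zero hm h]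
    have hAsucc : ∀ α, A (M + 1) α → A M α := fun α h k k' h1 h2 h3 =>
      h k k' h1 h2 (by omega)
    -- the case where the order `0` is occupied
    let e : ∀ (k : Fin (2 * N)), (Fin (2 * N) → ℕ) → Fin (2 * N) → ℕ := fun k l =>
      Function.update (Function.update (Function.update l c 0) d 0) k 1
    have ec : ∀ (k : Fin (2 * N)) l, (k : ℕ) = 2 * M + 2 → e k l c = 0 := fun k l hk => by
      simp only [e]
      rw [Function.update_of_ne (by rw [ne_eq, Fin.ext_iff]; omega), Function.update_of_ne hcd,
        Function.update_self]
    have ed : ∀ (k : Fin (2 * N)) l, (k : ℕ) = 2 * M + 2 → e k l d = 0 := fun k l hk => by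
      simp only [e]
      rw [Function.update_of_ne (by rw [ne_eq, Fin.ext_iff]; omega), Function.update_self]
    have ek : ∀ k l, e k l k = 1 := fun k l => by simp only [e]; rw [Function.update_self]
    have eo : ∀ (k : Fin (2 * N)) l (a : Fin (2 * N)), (k : ℕ) = 2 * M + 2 → 2 * M + 3 ≤ (a : ℕ) →
        e k l a = l a := fun k l a hk ha => by
      simp only [e]
      rw [Function.update_of_ne, Function.update_of_ne, Function.update_of_ne] <;>
        rw [ne_eq, Fin.ext_iff] <;> omega
    have hswap : ∀ (k : Fin (2 * N)) l, (k : ℕ) = 2 * M + 2 → l k = 0 →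
        mixed (2 * (M + 1)) (doubled y) l (y j)
        = mixed (2 * M) (doubled y) (e k l) (y j) ∘ Equiv.swap d k := by
      intro k l hk hlk
      rw [hinit]
      funext a
      rw [Function.comp_apply, Equiv.swap_apply_def]
      by_cases h1 : a = d
      · rw [if_pos h1, h1, mixed, mixed, if_neg (by omega), if_neg (by omega), Ld, ek]
      rw [if_neg h1]
      by_cases h2 : a = k
      · rw [if_pos h2, h2, mixed, mixed, if_neg (by omega), if_neg (by omega), Lo _ _ (by omega),
          ed k l hk, hlk]
      rw [if_neg h2]
      unfold mixed
      by_cases h3 : (a : ℕ) < 2 * M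
      · rw [if_pos h3, if_pos h3]
      · rw [if_neg h3, if_neg h3]
        rcases hcases a (not_lt.1 h3) with h4 | h4 | h4
        · rw [h4, Lc, ec k l hk]
        · exact absurd h4 h1
        · rw [Lo _ _ h4, eo k l a hk]
          rw [Fin.ext_iff] at h2; omega
    have hLmono : ∀ l, MonoFrom (2 * (M + 1)) l →
        (∀ k : Fin (2 * N), (k : ℕ) = 2 * M + 2 → 1 ≤ l k) → MonoFrom (2 * M) (L l) := by
      intro l hl h1 k k' hk hK
      rcases hcases k hK with h4 | h4 | h4
      · rw [h4, Lc]; exact Nat.zero_le _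
      · rw [h4] at hk ⊢
        rw [Ld, Lo _ _ (by omega)]
        exact h1 k' (by omega)
      · rw [Lo _ _ h4, Lo _ _ (by omega)]
        exact hl k k' hk h4
    have hemono : ∀ (k : Fin (2 * N)) l (α : PairPartition N), (k : ℕ) = 2 * M + 2 → l k = 0 →
        α.mate d = k → Admissible (2 * (M + 1)) α l → MonoFrom (2 * M) (e k l) := by
      intro k l α hk hlk hmate hl a a' ha hK
      rcases hcases a hK with h4 | h4 | h4
      · rw [h4, ec k l hk]; exact Nat.zero_le _
      · rw [h4, ed k l hk]; exact Nat.zero_le _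
      · have ha' := eo k l a' hk (by omega)
        rw [ha']
        by_cases h5 : a = k
        · rw [h5, ek]
          by_contra hcon
          have := hl.link k a' (by rw [← h5]; exact ha) (by omega) (by omega)
          rw [α.mate_eq_comm.1 hmate, Fin.ext_iff] at this
          rw [h5] at ha
          omega
        · rw [eo k l a hk (by rw [Fin.ext_iff] at h5; omega)]
          exact hl.mono a a' ha h4
    have hcapA : ∀ (k : Fin (2 * N)) (hk : (k : ℕ) = d + 1) α β, A M α → capPP β d k hk = α →
        A M β := fun k hk α β hα hβ => hA M α β d k hk (by omega) hα hβ
    refine pureM_mixed_pos (K := 2 * (M + 1)) (A (M + 1))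
      (fun α β k k' hk hK => hA (M + 1) α β k k' hk (by omega)) _ (y j) ?_ ?_ α l hα hl t
      (ht j (by omega))
    · intro α l hα hl
      by_cases h1 : ∀ k : Fin (2 * N), (k : ℕ) = 2 * M + 2 → 1 ≤ l k
      · rw [hinit]
        exact hnn α _ (hAsucc α hα) (hLmono l hl.mono h1)
      · push Not at h1
        obtain ⟨k, hk, hlk⟩ := h1
        have hlk : l k = 0 := by omega
        have hk' : (k : ℕ) = d + 1 := by omega
        rw [hswap k l hk hlk]
        by_cases hmate : α.mate d = k
        · classical
          have hm := hemono k l α hk hlk hmate hl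
          rw [pureM_swap_of_eq _ hk' α hmate]
          refine add_nonneg (hnn α _ (hAsucc α hα) hm) (Finset.sum_nonneg fun β hβ => ?_)
          rw [Finset.mem_filter] at hβ
          exact hnn β _ (hcapA k hk' α β (hAsucc α hα) hβ.2.2) hm
        · rw [pureM_swap_of_ne _ hk' α hmate, pureM_eq_zero _ (i := c) (j := d) (by omega) α, neg_zero]
          · exact hα c d (by omega) (by omega) (by omega)
          · rw [mixed, mixed, if_neg (by omega), if_neg (by omega), ec k l hk, ed k l hk]
    · intro α l hα hl hs
      have hαcd := hα c d (by omega) (by omega) (by omega)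
      obtain ⟨m, e1, e2, e3, e4, e5, e6⟩ := hs.structure hl (by omega)
      have hN : 2 ≤ N := by
        by_contra hcon
        have h1 := (α.mate c).2
        have h2 := α.mate_ne c
        rw [ne_eq, Fin.ext_iff] at h2 hαcd
        omega
      by_cases h1 : ∀ k : Fin (2 * N), (k : ℕ) = 2 * M + 2 → 1 ≤ l k
      · rw [hinit]
        refine hpos α _ (hAsucc α hα) ⟨?_, hLmono l hl.mono h1, ?_⟩
        · intro k hk
          rcases hcases k hk with h4 | h4 | h4
          · rw [h4, Lc]; omega
          · rw [h4, Ld]; omega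
          · rw [Lo _ _ h4]; exact hl.lt k h4
        · intro k k' hk hK hlk
          rcases hcases k hK with h4 | h4 | h4
          · have h5 : k' = d := by rw [Fin.ext_iff]; rw [h4] at hk; omega
            rw [h4, h5, Lc, Ld] at hlk
            omega
          · rw [h4] at hk hlk ⊢
            rw [Ld, Lo _ _ (by omega)] at hlk
            have a1 := e4 k' (by omega)
            have hmd := α.mate_mate d
            rw [α.mate_eq_comm, Fin.ext_iff]
            by_cases hm : m = 2 * (M + 1)
            · -- then there are two points before the double ones
              exfalso
              have b1 : ∀ a : Fin (2 * N), (a : ℕ) < m → (α.mate a : ℕ) < m := fun a ha => by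
                by_contra hcon
                have := e3 _ (not_lt.1 hcon)
                rw [α.mate_mate] at this
                omega
              have b2 := b1 c (by omega)
              have b3 := α.mate_ne c
              rw [ne_eq, Fin.ext_iff] at hαcd b3
              omega
            · have a2 := (e5 k' (by omega) (by omega)).2
              have a3 := e6 k' ⟨m - 1, by omega⟩ (by omega) (by dsimp only; omega)
                (by dsimp only; omega)
              dsimp only at a3
              by_contra hne
              have n1 : ∀ a : Fin (2 * N), (α.mate k' : ℕ) < a → (a : ℕ) < k' →
                  (α.mate k' : ℕ) < α.mate a ∧ (α.mate a : ℕ) < k' := by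
                intro a ha ha'
                have q1 := α.mate_isNoncrossing.nc (α.mate k') a
                have q2 := α.mate_isNoncrossing.nc (α.mate a) (α.mate k')
                rw [α.mate_mate] at q1 q2
                have q3 : (α.mate a : ℕ) ≠ k' := fun h => by
                  have := α.mate_eq_comm.1 (Fin.ext h)
                  rw [this] at ha
                  omega
                have q4 : (α.mate a : ℕ) ≠ α.mate k' := fun h => by
                  have := congrArg Fin.val (α.mate_inj.1 (Fin.ext h))
                  omega
                simp only [Fin.lt_def] at q1 q2
                rw [α.mate_mate] at q2
                omega
              have n2 := n1 d (by omega) (by omega)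
              have n3 := α.mate_ne d
              have hαdc : α.mate d ≠ c := fun h => hαcd (α.mate_eq_comm.1 h)
              rw [ne_eq, Fin.ext_iff] at n3 hαdc
              omega
          · rw [Lo _ _ h4, Lo _ _ (by omega)] at hlk
            exact hl.link k k' hk h4 hlk
      · push Not at h1
        obtain ⟨k, hk, hlk⟩ := h1
        have hlk : l k = 0 := by omega
        have hk' : (k : ℕ) = d + 1 := by omega
        have hd' : (d : ℕ) = c + 1 := by omega
        have a1 := e4 k (by omega)
        have a2 := (e5 k (by omega) (by omega)).2
        have a3 := e6 k ⟨m - 1, by omega⟩ (by omega) (by dsimp only; omega) (by dsimp only; omega)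
        dsimp only at a3
        have hmate : α.mate d = k := by
          rw [α.mate_eq_comm, Fin.ext_iff]; omega
        let k' : Fin (2 * N) := ⟨2 * M + 3, by omega⟩
        have hk'' : (k' : ℕ) = 2 * M + 3 := rfl
        have a4 := e6 k' ⟨m - 1, by omega⟩ (by omega) (by dsimp only; omega)
          (by dsimp only; omega)
        have a5 := e6 k k' (by omega) (by omega) (by omega)
        dsimp only at a4
        have hmate2 : α.mate c = k' := by
          rw [α.mate_eq_comm, Fin.ext_iff]; omega
        classical
        have hm := hemono k l α hk hlk hmate hl
        rw [hswap k l hk hlk, pureM_swap_of_eq _ hk' α hmate]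
        set β := capPP α c d hd' with hβ
        have hcap : capPP β d k hk' = α := capPP_capPP_right α hd' hk' hmate
        have hβA : A M β := hcapA k hk' α β (hAsucc α hα) hcap
        have hβd : β.mate d = c := by
          rw [β.mate_eq_comm, hβ, capPP_mate_left]
        refine add_pos_of_nonneg_of_pos (hnn α _ (hAsucc α hα) hm)
          (Finset.sum_pos' (fun γ hγ => ?_) ⟨β, ?_, ?_⟩)
        · rw [Finset.mem_filter] at hγ
          exact hnn γ _ (hcapA k hk' α γ (hAsucc α hα) hγ.2.2) hm
        · rw [Finset.mem_filter]
          refine ⟨Finset.mem_univ _, fun h => ?_, hcap⟩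
          rw [hβd, Fin.ext_iff] at h
          omega
        · refine hpos β _ hβA ⟨?_, hm, ?_⟩
          · intro a ha
            rcases hcases a ha with h4 | h4 | h4
            · rw [h4, ec k l hk]; omega
            · rw [h4, ed k l hk]; omega
            · by_cases h5 : a = k
              · rw [h5, ek]; omega
              · rw [eo k l a hk (by rw [Fin.ext_iff] at h5; omega)]; exact hl.lt a h4
          · intro a a' ha hK hla
            rcases hcases a hK with h4 | h4 | h4
            · have h5 : a' = d := by rw [Fin.ext_iff]; rw [h4] at ha; omega
              rw [h4, h5, hβ, capPP_mate_left]
            · have h5 : a' = k := by rw [Fin.ext_iff]; rw [h4] at ha; omega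
              rw [h4, h5, ed k l hk, ek] at hla
              omega
            · by_cases h5 : a = k
              · have h6 : a' = k' := by rw [Fin.ext_iff]; rw [h5] at ha; omega
                have n1 : k ≠ c := by rw [ne_eq, Fin.ext_iff]; omega
                have n2 : k ≠ d := by rw [ne_eq, Fin.ext_iff]; omega
                have n3 : k ≠ k' := by rw [ne_eq, Fin.ext_iff]; omega
                rw [h5, h6, hβ, capPP_mate, capFun, if_neg n1, if_neg n2, hmate2, if_neg n3,
                  hmate, if_pos rfl]
              · have h6 : 2 * M + 3 ≤ (a : ℕ) := by rw [Fin.ext_iff] at h5; omega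
                rw [eo k l a hk h6, eo k l a' hk (by omega)] at hla
                have hlink := hl.link a a' ha h4 hla
                rw [hβ, capPP_mate_of_ne α hd', hlink]
                · rw [ne_eq, Fin.ext_iff]; omega
                · rw [ne_eq, Fin.ext_iff]; omega
                · rw [hmate2]
                  intro h7
                  rw [h7, ← hmate2, α.mate_mate, Fin.ext_iff] at hlink
                  omega
                · rw [hmate]; exact h5

theorem pureM_doubled_pos {N : ℕ} (α : PairPartition N)
    (hα : ∀ k k' : Fin (2 * N), (k' : ℕ) = k + 1 → (k : ℕ) % 2 = 0 → α.mate k ≠ k')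
    {y : Fin N → ℝ} (hy : StrictMono y) : 0 < pureM α (doubled y) := by
  obtain ⟨t, ht⟩ : ∃ t, ∀ k, y k < t := by
    obtain ⟨M, hM⟩ := (Set.finite_range y).bddAbove
    exact ⟨M + 1, fun k => (hM ⟨k, rfl⟩).trans_lt (lt_add_one M)⟩
  have := flow_pos_doubled hy N le_rfl α 0 (fun k k' h1 h2 _ => hα k k' h1 h2)
    ⟨fun k hk => by have := k.2; omega, fun k _ _ hk => by have := k.2; omega,
      fun k _ _ hk => by have := k.2; omega⟩ t (fun k _ => ht k)
  convert this using 2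
  funext k
  rw [mixed, if_pos k.2]

/-! ### Conformal blocks of colourings -/

open Classical in
/-- The sign comparing the colours of two points. -/
noncomputable def colorSign {n : ℕ} (I : Finset (Fin n)) (i j : Fin n) : ℝ :=
  if (i ∈ I ↔ j ∈ I) then 1 else -1

theorem colorSign_comm {n : ℕ} (I : Finset (Fin n)) (i j : Fin n) :
    colorSign I i j = colorSign I j i := by
  unfold colorSign
  simp only [iff_comm]

theorem colorSign_mul_self {n : ℕ} (I : Finset (Fin n)) (i j : Fin n) :
    colorSign I i j * colorSign I i j = 1 := by
  unfold colorSign; split_ifs <;> norm_num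

theorem colorSign_mul {n : ℕ} (I : Finset (Fin n)) (j i k : Fin n) :
    colorSign I j i * colorSign I j k = colorSign I i k := by
  unfold colorSign
  by_cases h1 : i ∈ I <;> by_cases h2 : j ∈ I <;> by_cases h3 : k ∈ I <;> simp [h1, h2, h3]

theorem theta_eq_colorSign {N : ℕ} (β : PairPartition N) (i j : Fin (2 * N)) :
    theta β i j = colorSign β.lefts i j := by
  unfold theta colorSign
  congr 1
  rw [isLeft_iff, isLeft_iff, isRight_iff, isRight_iff, ← mem_lefts, ← mem_lefts, ← notMem_lefts,
    ← notMem_lefts]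
  apply propext
  tauto

/-- The conformal block of a colouring. -/
noncomputable def colorBlock {n : ℕ} (I : Finset (Fin n)) (x : Fin n → ℝ) : ℝ :=
  ∏ i, ∏ j ∈ Finset.Ioi i, (x j - x i) ^ (1 / 2 * colorSign I i j)

theorem conformalBlock_eq {N : ℕ} (β : PairPartition N) (x : Fin (2 * N) → ℝ) :
    conformalBlock β x = colorBlock β.lefts x := by
  simp only [conformalBlock, colorBlock, theta_eq_colorSign]

theorem pureZ_eq {N : ℕ} (α : PairPartition N) (x : Fin (2 * N) → ℝ) :
    pureZ α x = ∑ β, (incidence N)⁻¹ α β * colorBlock β.lefts x := by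
  simp only [pureZ, conformalBlock_eq]

theorem sub_pos_of_config {n : ℕ} {x : Fin n → ℝ} (hx : x ∈ config n) {i j : Fin n}
    (hij : j ∈ Finset.Ioi i) : 0 < x j - x i :=
  sub_pos.2 (hx (Finset.mem_Ioi.1 hij))

/-- The product of the square roots of all the differences. -/
noncomputable def sqrtVandermonde {n : ℕ} (x : Fin n → ℝ) : ℝ :=
  ∏ i, ∏ j ∈ Finset.Ioi i, (x j - x i) ^ (1 / 2 : ℝ)

theorem sqrtVandermonde_pos {n : ℕ} {x : Fin n → ℝ} (hx : x ∈ config n) :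
    0 < sqrtVandermonde x :=
  Finset.prod_pos fun _ _ => Finset.prod_pos fun _ hj =>
    Real.rpow_pos_of_pos (sub_pos_of_config hx hj) _

open Classical in
theorem minor_moment {n N : ℕ} {I : Finset (Fin n)} (h : I.card = N) (x : Fin n → ℝ) :
    minor I (fun k => (flag 0 (x k) : Fin N → ℝ)) =
      ∏ i, ∏ j ∈ Finset.Ioi i, if i ∈ I ∧ j ∈ I then x j - x i else 1 := by
  rw [minor_of_card h]
  have h1 : (Matrix.of fun r => (flag 0 (x (I.orderEmbOfFin h r)) : Fin N → ℝ))
      = Matrix.vandermonde fun r => x (I.orderEmbOfFin h r) := by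
    ext r c
    simp [flag, Matrix.vandermonde_apply]
  rw [h1, Matrix.det_vandermonde]
  have h2 : ∀ g : Fin n → ℝ, ∏ r, g (I.orderEmbOfFin h r) = ∏ i, if i ∈ I then g i else 1 := by
    intro g
    rw [Finset.prod_ite_mem, Finset.univ_inter]
    conv_rhs => rw [← Finset.map_orderEmbOfFin_univ I h]
    rw [Finset.prod_map]
    rfl
  have h3 : ∀ r, ∏ s ∈ Finset.Ioi r, (x (I.orderEmbOfFin h s) - x (I.orderEmbOfFin h r))
      = (fun i => ∏ j ∈ Finset.Ioi i, if j ∈ I then x j - x i else 1) (I.orderEmbOfFin h r) := by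
    intro r
    have := h2 fun j => if I.orderEmbOfFin h r < j then x j - x (I.orderEmbOfFin h r) else 1
    simp only [OrderEmbedding.lt_iff_lt] at this
    rw [← Finset.prod_filter, show Finset.univ.filter (fun s => r < s) = Finset.Ioi r by
      ext; simp] at this
    rw [this]
    dsimp only
    rw [show Finset.Ioi (I.orderEmbOfFin h r)
      = Finset.univ.filter fun s => I.orderEmbOfFin h r < s by ext; simp, Finset.prod_filter]
    refine Finset.prod_congr rfl fun j _ => ?_
    split_ifs <;> rfl
  rw [Finset.prod_congr rfl fun r _ => h3 r]
  refine (h2 fun i => ∏ j ∈ Finset.Ioi i, if j ∈ I then x j - x i else 1).trans ?_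
  refine Finset.prod_congr rfl fun i _ => ?_
  split_ifs with hi
  · refine Finset.prod_congr rfl fun j _ => ?_
    simp only [hi, true_and]
  · simp [hi]

theorem colorBlock_eq_div {N : ℕ} {I : Finset (Fin (2 * N))} (h : I.card = N)
    {x : Fin (2 * N) → ℝ} (hx : x ∈ config (2 * N)) :
    colorBlock I x = dblMinor I (fun k => (flag 0 (x k) : Fin N → ℝ)) / sqrtVandermonde x := by
  classical
  have hc : Iᶜ.card = N := by
    rw [Finset.card_compl, h, Fintype.card_fin]; omega
  rw [eq_div_iff (sqrtVandermonde_pos hx).ne', dblMinor, minor_moment h, minor_moment hc,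
    colorBlock, sqrtVandermonde]
  simp only [← Finset.prod_mul_distrib]
  refine Finset.prod_congr rfl fun i _ => Finset.prod_congr rfl fun j hj => ?_
  have hpos := sub_pos_of_config hx hj
  rw [← Real.rpow_add hpos]
  unfold colorSign
  by_cases h1 : i ∈ I <;> by_cases h2 : j ∈ I <;> simp [h1, h2] <;> norm_num

theorem pureZ_eq_div {N : ℕ} (α : PairPartition N) {x : Fin (2 * N) → ℝ}
    (hx : x ∈ config (2 * N)) :
    pureZ α x = pureM α (fun k => flag 0 (x k)) / sqrtVandermonde x := by
  rw [pureZ_eq, pureM_apply, Finset.sum_div]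
  refine Finset.sum_congr rfl fun β _ => ?_
  rw [colorBlock_eq_div (β.compat_lefts.card β.mate_isNoncrossing) hx, mul_div_assoc]

theorem colorBlock_eq_sum {N : ℕ} {I : Finset (Fin (2 * N))} (h : I.card = N)
    {x : Fin (2 * N) → ℝ} (hx : x ∈ config (2 * N)) :
    colorBlock I x = ∑ β, pureZ β x * compatInd β I := by
  rw [colorBlock_eq_div h hx, dblMinor_eq_sum, Finset.sum_div]
  refine Finset.sum_congr rfl fun β _ => ?_
  rw [pureZ_eq_div β hx]
  ring

theorem pureZ_pos {N : ℕ} (α : PairPartition N) {x : Fin (2 * N) → ℝ} (hx : x ∈ config (2 * N)) :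
    0 < pureZ α x := by
  rw [pureZ_eq_div α hx]
  exact div_pos (pureM_moment_pos α hx) (sqrtVandermonde_pos hx)

/-! ### Smoothness and bounds -/

theorem isOpen_config (n : ℕ) : IsOpen (config n) := by
  have : config n = ⋂ i : Fin n, ⋂ j : Fin n, ⋂ _ : i < j, {x | x i < x j} := by
    ext x
    simp only [config, Set.mem_ofPred_eq, Set.mem_iInter, StrictMono]
  rw [this]
  refine isOpen_iInter_of_finite fun i => isOpen_iInter_of_finite fun j =>
    isOpen_iInter_of_finite fun _ => isOpen_lt (continuous_apply i) (continuous_apply j)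

theorem contDiffOn_colorBlock {n : ℕ} (I : Finset (Fin n)) :
    ContDiffOn ℝ ∞ (colorBlock I) (config n) := by
  unfold colorBlock
  refine contDiffOn_prod fun i _ => contDiffOn_prod fun j hj => ?_
  refine ContDiffOn.rpow_const_of_ne ?_ fun x hx => (sub_pos_of_config hx hj).ne'
  exact ((contDiff_apply ℝ ℝ j).sub (contDiff_apply ℝ ℝ i)).contDiffOn

theorem contDiffOn_pureZ {N : ℕ} (α : PairPartition N) :
    ContDiffOn ℝ ∞ (pureZ α) (config (2 * N)) := by
  rw [show pureZ α = fun x => _ from funext (pureZ_eq α)]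
  exact ContDiffOn.sum fun β _ => contDiffOn_const.mul (contDiffOn_colorBlock _)

theorem pureZ_bound {N : ℕ} (α : PairPartition N) : ∃ C > 0, ∃ q > 0, ∀ x ∈ config (2 * N),
    |pureZ α x| ≤ C * ∏ i, ∏ j ∈ Finset.Ioi i,
      (x j - x i) ^ (if 1 < |x j - x i| then q else -q : ℝ) := by
  refine ⟨∑ β, |(incidence N)⁻¹ α β| + 1, by positivity, 1 / 2, by norm_num, fun x hx => ?_⟩
  set B := ∏ i, ∏ j ∈ Finset.Ioi i,
      (x j - x i) ^ (if 1 < |x j - x i| then 1 / 2 else -(1 / 2) : ℝ) with hB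
  have hB0 : 0 ≤ B := Finset.prod_nonneg fun i _ => Finset.prod_nonneg fun j hj =>
    (Real.rpow_pos_of_pos (sub_pos_of_config hx hj) _).le
  have h1 : ∀ I, |colorBlock I x| ≤ B := by
    intro I
    unfold colorBlock
    rw [abs_of_nonneg (Finset.prod_nonneg fun i _ => Finset.prod_nonneg fun j hj =>
      (Real.rpow_pos_of_pos (sub_pos_of_config hx hj) _).le)]
    refine Finset.prod_le_prod (fun i _ => Finset.prod_nonneg fun j hj =>
      (Real.rpow_pos_of_pos (sub_pos_of_config hx hj) _).le) fun i _ =>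
      Finset.prod_le_prod (fun j hj =>
      (Real.rpow_pos_of_pos (sub_pos_of_config hx hj) _).le) fun j hj => ?_
    have hpos := sub_pos_of_config hx hj
    rw [abs_of_pos hpos]
    have h2 : colorSign I i j = 1 ∨ colorSign I i j = -1 := by
      unfold colorSign; split_ifs <;> simp
    split_ifs with h
    · apply Real.rpow_le_rpow_of_exponent_le h.le
      rcases h2 with h2 | h2 <;> rw [h2] <;> norm_num
    · apply Real.rpow_le_rpow_of_exponent_ge hpos (not_lt.1 h)
      rcases h2 with h2 | h2 <;> rw [h2] <;> norm_num
  rw [pureZ_eq]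
  calc |∑ β, (incidence N)⁻¹ α β * colorBlock β.lefts x|
      ≤ ∑ β, |(incidence N)⁻¹ α β * colorBlock β.lefts x| := Finset.abs_sum_le_sum_abs _ _
    _ ≤ ∑ β, |(incidence N)⁻¹ α β| * B := Finset.sum_le_sum fun β _ => by
        rw [abs_mul]; exact mul_le_mul_of_nonneg_left (h1 _) (abs_nonneg _)
    _ = (∑ β, |(incidence N)⁻¹ α β|) * B := by rw [Finset.sum_mul]
    _ ≤ (∑ β, |(incidence N)⁻¹ α β| + 1) * B := by nlinarith

theorem pureZ_zero (α : PairPartition 0) (x : Fin (2 * 0) → ℝ) : pureZ α x = 1 := by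
  have hx : x ∈ config (2 * 0) := fun i => i.elim0
  have hcard : (∅ : Finset (Fin (2 * 0))).card = 0 := rfl
  have h1 := colorBlock_eq_sum hcard hx
  have hsub : ∀ β : PairPartition 0, β = α := fun β =>
    mate_injective (funext fun k => k.elim0)
  rw [Finset.sum_eq_single α (fun β _ h => absurd (hsub β) h)
    (fun h => absurd (Finset.mem_univ _) h), compatInd, if_pos (show Compat α.mate ∅ from fun a => a.elim0), mul_one] at h1
  rw [← h1]
  exact Finset.prod_eq_one fun i => i.elim0

/-! ### Möbius covariance -/

theorem hasDerivAt_mobius (a b c d t : ℝ) (h : c * t + d ≠ 0) :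
    HasDerivAt (mobius a b c d) ((a * d - b * c) / (c * t + d) ^ 2) t := by
  have h1 : HasDerivAt (fun t => a * t + b) a t := by
    simpa using ((hasDerivAt_id t).const_mul a).add_const b
  have h2 : HasDerivAt (fun t => c * t + d) c t := by
    simpa using ((hasDerivAt_id t).const_mul c).add_const d
  refine (h1.div h2 h).congr_deriv ?_
  congr 1
  ring

theorem mobius_sub (a b c d s t : ℝ) (hs : c * s + d ≠ 0) (ht : c * t + d ≠ 0) :
    mobius a b c d t - mobius a b c d s =
      (a * d - b * c) * (t - s) / ((c * s + d) * (c * t + d)) := by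
  unfold mobius
  rw [div_sub_div _ _ ht hs, mul_comm (c * t + d) (c * s + d)]
  congr 1
  ring

/-- Differences of images under a Möbius map in terms of the square roots of the derivatives. -/
theorem exists_mobius_factor {n : ℕ} {a b c d : ℝ} (hD : 0 < a * d - b * c) {x : Fin n → ℝ}
    (hx : x ∈ config n) (hne : ∀ i, c * x i + d ≠ 0) (hφ : mobius a b c d ∘ x ∈ config n) :
    ∃ m : Fin n → ℝ, (∀ i, 0 < m i) ∧ (∀ i, deriv (mobius a b c d) (x i) = m i ^ 2) ∧
      ∀ i j, i < j → mobius a b c d (x j) - mobius a b c d (x i) = (x j - x i) * (m i * m j) := by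
  refine ⟨fun i => Real.sqrt (a * d - b * c) / |c * x i + d|, fun i =>
    div_pos (Real.sqrt_pos.2 hD) (abs_pos.2 (hne i)), fun i => ?_, fun i j hij => ?_⟩
  · rw [(hasDerivAt_mobius a b c d _ (hne i)).deriv, div_pow, Real.sq_sqrt hD.le, sq_abs]
  · have h1 : 0 < mobius a b c d (x j) - mobius a b c d (x i) := sub_pos.2 (hφ hij)
    have h2 : 0 < x j - x i := sub_pos.2 (hx hij)
    rw [mobius_sub _ _ _ _ _ _ (hne i) (hne j)] at h1 ⊢
    have h3 : 0 < (c * x i + d) * (c * x j + d) := by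
      by_contra hcon
      exact absurd h1 (not_lt.2 (div_nonpos_of_nonneg_of_nonpos (mul_pos hD h2).le
        (not_lt.1 hcon)))
    rw [div_mul_div_comm, Real.mul_self_sqrt hD.le, ← abs_mul, abs_of_pos h3]
    ring

theorem sum_colorSign {N : ℕ} {I : Finset (Fin (2 * N))} (h : I.card = N) (i : Fin (2 * N)) :
    ∑ j ∈ {i}ᶜ, colorSign I j i = -1 := by
  classical
  have h1 : ∑ j, colorSign I j i = 0 := by
    have hc : Iᶜ.card = N := by
      rw [Finset.card_compl, h, Fintype.card_fin]; omega
    rw [← Finset.sum_add_sum_compl I]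
    have e1 : ∑ j ∈ I, colorSign I j i = ∑ j ∈ I, (if i ∈ I then (1 : ℝ) else -1) :=
      Finset.sum_congr rfl fun j hj => by simp [colorSign, hj]
    have e2 : ∑ j ∈ Iᶜ, colorSign I j i = ∑ j ∈ Iᶜ, (if i ∈ I then (-1 : ℝ) else 1) :=
      Finset.sum_congr rfl fun j hj => by
        rw [Finset.mem_compl] at hj
        by_cases hi : i ∈ I <;> simp [colorSign, hj, hi]
    rw [e1, e2, Finset.sum_const, Finset.sum_const, h, hc]
    split_ifs <;> simp
  rw [← Finset.sum_add_sum_compl {i}, Finset.sum_singleton] at h1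
  have h2 : colorSign I i i = 1 := by simp [colorSign]
  linarith

theorem colorBlock_mobius {N : ℕ} {I : Finset (Fin (2 * N))} (h : I.card = N)
    {a b c d : ℝ} (hD : 0 < a * d - b * c) {x : Fin (2 * N) → ℝ}
    (hx : x ∈ config (2 * N)) (hne : ∀ i, c * x i + d ≠ 0)
    (hφ : mobius a b c d ∘ x ∈ config (2 * N)) :
    colorBlock I x =
      (∏ i, deriv (mobius a b c d) (x i) ^ (1 / 4 : ℝ)) * colorBlock I (mobius a b c d ∘ x) := by
  obtain ⟨m, hm, hm1, hm2⟩ := exists_mobius_factor hD hx hne hφ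
  have e1 : colorBlock I (mobius a b c d ∘ x) = colorBlock I x *
      ∏ i, ∏ j ∈ Finset.Ioi i, (m i ^ (1 / 2 * colorSign I j i) * m j ^ (1 / 2 * colorSign I i j)) := by
    unfold colorBlock
    simp only [← Finset.prod_mul_distrib]
    refine Finset.prod_congr rfl fun i _ => Finset.prod_congr rfl fun j hj => ?_
    rw [Function.comp_apply, Function.comp_apply, hm2 i j (Finset.mem_Ioi.1 hj),
      Real.mul_rpow (sub_pos_of_config hx hj).le (mul_pos (hm i) (hm j)).le,
      Real.mul_rpow (hm i).le (hm j).le, colorSign_comm I j i]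
  have e2 : ∏ i, ∏ j ∈ Finset.Ioi i, (m i ^ (1 / 2 * colorSign I j i) *
      m j ^ (1 / 2 * colorSign I i j)) = ∏ i, m i ^ (-(1 / 2) : ℝ) := by
    rw [Finset.prod_prod_Ioi_mul_eq_prod_prod_off_diag
      (fun j i => m i ^ (1 / 2 * colorSign I j i))]
    refine Finset.prod_congr rfl fun i _ => ?_
    rw [← Real.rpow_sum_of_pos (hm i), ← Finset.mul_sum, sum_colorSign h i]
    norm_num
  have e3 : (∏ i, deriv (mobius a b c d) (x i) ^ (1 / 4 : ℝ)) * ∏ i, m i ^ (-(1 / 2) : ℝ) = 1 := by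
    rw [← Finset.prod_mul_distrib]
    refine Finset.prod_eq_one fun i _ => ?_
    rw [hm1, ← Real.rpow_natCast, ← Real.rpow_mul (hm i).le, ← Real.rpow_add (hm i)]
    norm_num
  rw [e1, e2]
  linear_combination (-colorBlock I x) * e3

theorem pureZ_covariant {N : ℕ} (α : PairPartition N) : IsMobiusCovariant (1 / 4) (pureZ α) := by
  intro a b c d hD x hx hne hφ
  rw [pureZ_eq, pureZ_eq, Finset.mul_sum]
  refine Finset.sum_congr rfl fun β _ => ?_
  rw [colorBlock_mobius (β.compat_lefts.card β.mate_isNoncrossing) hD hx hne hφ]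
  ring

/-! ### The second order equations -/

theorem sum_bpz {ι : Type*} [DecidableEq ι] (s : Finset ι) (A e : ι → ℝ) (hA : ∀ i ∈ s, A i * A i = 1)
    (he : ∀ i ∈ s, e i ≠ 0) (hinj : ∀ i ∈ s, ∀ k ∈ s, i ≠ k → e i ≠ e k) :
    2 * ((∑ k ∈ s, -(1 / 2 * A k / e k)) ^ 2 - ∑ k ∈ s, 1 / 2 * A k / e k ^ 2) +
      ∑ i ∈ s, (2 / e i * (1 / 2 * A i / e i + ∑ k ∈ s.erase i, 1 / 2 * (A i * A k) / (e i - e k))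
        - 1 / 2 / e i ^ 2) = 0 := by
  have h1 : ∀ i ∈ s, ∑ k ∈ s.erase i, 1 / 2 * (A i * A k) / (e i - e k)
      = ∑ k ∈ s, 1 / 2 * (A i * A k) / (e i - e k) := by
    intro i hi
    rw [← Finset.add_sum_erase s _ hi]
    simp
  have h2 : ∑ i ∈ s, ∑ k ∈ s, A i * A k / (e i * (e i - e k))
      = ∑ i ∈ s, ∑ k ∈ s, A i * A k / (e k * (e k - e i)) := by
    rw [Finset.sum_comm]
    refine Finset.sum_congr rfl fun i _ => Finset.sum_congr rfl fun k _ => ?_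
    rw [mul_comm (A i)]
  have h3 : ∑ i ∈ s, ∑ k ∈ s, A i * A k / (e i * (e i - e k)) +
      ∑ i ∈ s, ∑ k ∈ s, A i * A k / (e k * (e k - e i)) =
      ∑ i ∈ s, 1 / e i ^ 2 - (∑ k ∈ s, A k / e k) ^ 2 := by
    rw [sq, Finset.sum_mul_sum, ← Finset.sum_add_distrib, ← Finset.sum_sub_distrib]
    refine Finset.sum_congr rfl fun i hi => ?_
    rw [← Finset.sum_add_distrib, eq_sub_iff_add_eq, ← Finset.sum_add_distrib,
      Finset.sum_eq_single i]
    · have := he i hi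
      simp only [sub_self, mul_zero, div_zero, zero_add]
      rw [div_mul_div_comm, hA i hi, sq]
    · intro k hk hki
      have e1 := he i hi
      have e2 := he k hk
      have e3 : e i - e k ≠ 0 := sub_ne_zero.2 (hinj i hi k hk hki.symm)
      have e4 : e k - e i ≠ 0 := sub_ne_zero.2 (hinj k hk i hi hki)
      rw [← neg_sub (e i) (e k)]
      field_simp
      ring
    · intro h; exact absurd hi h
  have h4 : ∑ i ∈ s, (2 / e i * (1 / 2 * A i / e i +
      ∑ k ∈ s.erase i, 1 / 2 * (A i * A k) / (e i - e k)) - 1 / 2 / e i ^ 2)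
      = ∑ i ∈ s, A i / e i ^ 2 + ∑ i ∈ s, ∑ k ∈ s, A i * A k / (e i * (e i - e k))
        - 1 / 2 * ∑ i ∈ s, 1 / e i ^ 2 := by
    rw [Finset.mul_sum, ← Finset.sum_add_distrib, ← Finset.sum_sub_distrib]
    refine Finset.sum_congr rfl fun i hi => ?_
    have e1 := he i hi
    rw [h1 i hi, mul_add, Finset.mul_sum]
    congr 1
    · congr 1
      · field_simp
      · refine Finset.sum_congr rfl fun k _ => ?_
        rw [div_mul_div_comm]
        ring
    · field_simp
  have h5 : ∑ k ∈ s, -(1 / 2 * A k / e k) = -(1 / 2) * ∑ k ∈ s, A k / e k := by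
    rw [Finset.mul_sum]; exact Finset.sum_congr rfl fun k _ => by ring
  have h6 : ∑ k ∈ s, 1 / 2 * A k / e k ^ 2 = 1 / 2 * ∑ k ∈ s, A k / e k ^ 2 := by
    rw [Finset.mul_sum]; exact Finset.sum_congr rfl fun k _ => by ring
  rw [h4, h5, h6]
  linear_combination (1 / 2) * h3 + (1 / 2) * h2

/-- The logarithmic derivative of a conformal block. -/
noncomputable def logDer {n : ℕ} (I : Finset (Fin n)) (m : Fin n) (x : Fin n → ℝ) : ℝ :=
  ∑ k ∈ Finset.univ.erase m, 1 / 2 * colorSign I m k / (x m - x k)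

theorem hasDerivAt_update_apply {n : ℕ} (x : Fin n → ℝ) (m i : Fin n) (t : ℝ) :
    HasDerivAt (fun t => Function.update x m t i) (if i = m then 1 else 0) t := by
  by_cases h : i = m
  · subst h
    simp only [Function.update_self, if_true]
    exact hasDerivAt_id t
  · simp only [Function.update_of_ne h, if_neg h]
    exact hasDerivAt_const _ _

theorem hasDerivAt_colorBlock {n : ℕ} (I : Finset (Fin n)) {x : Fin n → ℝ} (hx : x ∈ config n)
    (m : Fin n) :
    HasDerivAt (fun t => colorBlock I (Function.update x m t)) (colorBlock I x * logDer I m x)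
      (x m) := by
  have hup : Function.update x m (x m) = x := Function.update_eq_self _ _
  have hne : ∀ i, ∀ j ∈ Finset.Ioi i, x j - x i ≠ 0 := fun i j hj => (sub_pos_of_config hx hj).ne'
  have hfac : ∀ i, ∀ j ∈ Finset.Ioi i, HasDerivAt
      (fun t => (Function.update x m t j - Function.update x m t i) ^ (1 / 2 * colorSign I i j))
      ((x j - x i) ^ (1 / 2 * colorSign I i j) * (1 / 2 * colorSign I i j *
        ((if j = m then 1 else 0) - (if i = m then 1 else 0)) / (x j - x i))) (x m) := by
    intro i j hj
    have h1 := ((hasDerivAt_update_apply x m j (x m)).sub (hasDerivAt_update_apply x m i (x m)))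
    have h2 := h1.rpow_const (p := 1 / 2 * colorSign I i j) (Or.inl (by
      simp only [Pi.sub_apply, hup]; exact hne i j hj))
    refine h2.congr_deriv ?_
    simp only [Pi.sub_apply, hup]
    rw [Real.rpow_sub_one (hne i j hj)]
    ring
  have hlog : ∑ i, ∑ j ∈ Finset.Ioi i, (1 / 2 * colorSign I i j *
        ((if j = m then 1 else 0) - (if i = m then 1 else 0)) / (x j - x i)) = logDer I m x := by
    have e1 : ∀ i, ∑ j ∈ Finset.Ioi i, (1 / 2 * colorSign I i j *
        ((if j = m then 1 else 0) - (if i = m then 1 else 0)) / (x j - x i))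
        = (if i < m then 1 / 2 * colorSign I m i / (x m - x i) else 0) -
          (if i = m then ∑ j ∈ Finset.Ioi m, 1 / 2 * colorSign I m j / (x j - x m) else 0) := by
      intro i
      have e2 : ∀ j, (1 / 2 * colorSign I i j *
        ((if j = m then 1 else 0) - (if i = m then 1 else 0)) / (x j - x i)) =
        (if j = m then 1 / 2 * colorSign I i m / (x m - x i) else 0) -
        (if i = m then 1 / 2 * colorSign I i j / (x j - x i) else 0) := by
        intro j
        by_cases h1 : j = m
        · subst h1; by_cases h2 : i = j <;> simp [h2]
        · by_cases h2 : i = m <;> simp [h1, h2]; ring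
      rw [Finset.sum_congr rfl fun j _ => e2 j, Finset.sum_sub_distrib, Finset.sum_ite_eq']
      congr 1
      · simp only [Finset.mem_Ioi, colorSign_comm I i m]
      · split_ifs with h
        · rw [h]
        · exact Finset.sum_const_zero
    rw [Finset.sum_congr rfl fun i _ => e1 i, Finset.sum_sub_distrib, Finset.sum_ite_eq']
    rw [if_pos (Finset.mem_univ _), ← Finset.sum_filter, logDer]
    have e3 : Finset.univ.erase m = (Finset.univ.filter fun i => i < m) ∪ Finset.Ioi m := by
      ext k; simp
    rw [e3, Finset.sum_union, sub_eq_add_neg, ← Finset.sum_neg_distrib]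
    · congr 1
      refine Finset.sum_congr rfl fun k _ => ?_
      rw [← neg_sub (x m) (x k), div_neg, neg_neg]
    · rw [Finset.disjoint_left]
      intro k h1 h2
      rw [Finset.mem_filter] at h1
      exact absurd h1.2 (Finset.mem_Ioi.1 h2).asymm
  -- products of functions with given logarithmic derivatives
  have hprod : ∀ {κ : Type} (s : Finset κ) (f : κ → ℝ → ℝ) (g : κ → ℝ) (t : ℝ),
      (∀ k ∈ s, HasDerivAt (f k) (f k t * g k) t) →
      HasDerivAt (fun t => ∏ k ∈ s, f k t) ((∏ k ∈ s, f k t) * ∑ k ∈ s, g k) t := by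
    classical
    intro κ s f g t
    induction s using Finset.induction_on with
    | empty =>
      intro _
      simp only [Finset.prod_empty, Finset.sum_empty, mul_zero]
      exact hasDerivAt_const _ _
    | insert k s hk ih =>
      intro h
      simp only [Finset.prod_insert hk, Finset.sum_insert hk]
      refine ((h k (Finset.mem_insert_self k s)).mul
        (ih fun k' hk' => h k' (Finset.mem_insert_of_mem hk'))).congr_deriv ?_
      ring
  have h1 := hprod Finset.univ (fun i t => ∏ j ∈ Finset.Ioi i,
    (Function.update x m t j - Function.update x m t i) ^ (1 / 2 * colorSign I i j))
    (fun i => ∑ j ∈ Finset.Ioi i, (1 / 2 * colorSign I i j *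
        ((if j = m then 1 else 0) - (if i = m then 1 else 0)) / (x j - x i))) (x m)
    (fun i _ => hprod (Finset.Ioi i) _ _ (x m) fun j hj => by
      have := hfac i j hj
      simpa only [hup] using this)
  rw [hlog] at h1
  simp only [hup] at h1
  exact h1

theorem eventually_update_mem {n : ℕ} {S : Set (Fin n → ℝ)} (hS : IsOpen S) {x : Fin n → ℝ}
    (hx : x ∈ S) (m : Fin n) : ∀ᶠ t in 𝓝 (x m), Function.update x m t ∈ S := by
  have hc : Continuous fun t => Function.update x m t := continuous_const.update m continuous_id
  refine hc.continuousAt.preimage_mem_nhds (hS.mem_nhds ?_)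
  rwa [Function.update_eq_self]

theorem partialDeriv_pureZ {N : ℕ} (α : PairPartition N) {x : Fin (2 * N) → ℝ}
    (hx : x ∈ config (2 * N)) (m : Fin (2 * N)) :
    partialDeriv m (pureZ α) x =
      ∑ β, (incidence N)⁻¹ α β * (colorBlock β.lefts x * logDer β.lefts m x) := by
  have h := HasDerivAt.fun_sum (u := Finset.univ) (x := x m)
    (fun (β : PairPartition N) _ =>
      (hasDerivAt_colorBlock β.lefts hx m).const_mul ((incidence N)⁻¹ α β))
  unfold partialDeriv
  simp only [pureZ_eq]
  exact h.deriv

theorem partialDeriv_partialDeriv_pureZ {N : ℕ} (α : PairPartition N) {x : Fin (2 * N) → ℝ}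
    (hx : x ∈ config (2 * N)) (m : Fin (2 * N)) :
    partialDeriv m (partialDeriv m (pureZ α)) x =
      ∑ β, (incidence N)⁻¹ α β * (colorBlock β.lefts x * (logDer β.lefts m x ^ 2 -
        ∑ k ∈ Finset.univ.erase m, 1 / 2 * colorSign β.lefts m k / (x m - x k) ^ 2)) := by
  have hup : Function.update x m (x m) = x := Function.update_eq_self _ _
  have hlog : ∀ I : Finset (Fin (2 * N)), HasDerivAt (fun t => logDer I m (Function.update x m t))
      (-∑ k ∈ Finset.univ.erase m, 1 / 2 * colorSign I m k / (x m - x k) ^ 2) (x m) := by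
    intro I
    unfold logDer
    rw [← Finset.sum_neg_distrib]
    refine HasDerivAt.fun_sum fun k hk => ?_
    have hkm : k ≠ m := Finset.ne_of_mem_erase hk
    simp only [Function.update_self, Function.update_of_ne hkm]
    have hne : x m - x k ≠ 0 := sub_ne_zero.2 (hx.injective.ne hkm.symm)
    have h1 : HasDerivAt (fun t => t - x k) 1 (x m) := (hasDerivAt_id _).sub_const _
    refine ((hasDerivAt_const (x m) (1 / 2 * colorSign I m k)).div h1 hne).congr_deriv ?_
    ring
  have h := HasDerivAt.fun_sum (u := Finset.univ) (x := x m)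
    (fun (β : PairPartition N) _ =>
      ((hasDerivAt_colorBlock β.lefts hx m).mul (hlog β.lefts)).const_mul ((incidence N)⁻¹ α β))
  have hev : (fun t => partialDeriv m (pureZ α) (Function.update x m t)) =ᶠ[𝓝 (x m)]
      fun t => ∑ β, (incidence N)⁻¹ α β * (colorBlock β.lefts (Function.update x m t) *
        logDer β.lefts m (Function.update x m t)) := by
    filter_upwards [eventually_update_mem (isOpen_config _) hx m] with t ht
    exact partialDeriv_pureZ α ht m
  change deriv (fun t => partialDeriv m (pureZ α) (Function.update x m t)) (x m) = _
  rw [hev.deriv_eq]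
  refine h.deriv.trans (Finset.sum_congr rfl fun β _ => ?_)
  rw [hup]
  ring

theorem pureZ_bpz {N : ℕ} (α : PairPartition N) (j : Fin (2 * N)) {x : Fin (2 * N) → ℝ}
    (hx : x ∈ config (2 * N)) : secondOrderBPZ 4 (1 / 4) j (pureZ α) x = 0 := by
  unfold secondOrderBPZ
  rw [partialDeriv_partialDeriv_pureZ α hx j]
  simp only [partialDeriv_pureZ α hx]
  rw [pureZ_eq]
  simp only [Finset.mul_sum, ← Finset.sum_sub_distrib]
  rw [Finset.sum_comm, ← Finset.sum_add_distrib]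
  refine Finset.sum_eq_zero fun β _ => ?_
  have key := sum_bpz (Finset.univ.erase j) (colorSign β.lefts j) (fun k => x k - x j)
    (fun i _ => colorSign_mul_self _ _ _)
    (fun i hi => sub_ne_zero.2 (hx.injective.ne (Finset.ne_of_mem_erase hi)))
    (fun i _ k _ hik h => hik (hx.injective (by linarith)))
  have e1 : logDer β.lefts j x
      = ∑ k ∈ Finset.univ.erase j, -(1 / 2 * colorSign β.lefts j k / (x k - x j)) := by
    unfold logDer
    refine Finset.sum_congr rfl fun k _ => ?_
    rw [← neg_sub (x k) (x j), div_neg]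
  have e2 : ∀ i ∈ Finset.univ.erase j, logDer β.lefts i x
      = 1 / 2 * colorSign β.lefts j i / (x i - x j) + ∑ k ∈ (Finset.univ.erase j).erase i,
        1 / 2 * (colorSign β.lefts j i * colorSign β.lefts j k) /
          ((x i - x j) - (x k - x j)) := by
    intro i hi
    have hji : j ∈ Finset.univ.erase i :=
      Finset.mem_erase.2 ⟨(Finset.ne_of_mem_erase hi).symm, Finset.mem_univ _⟩
    unfold logDer
    rw [← Finset.add_sum_erase _ _ hji, Finset.erase_right_comm, colorSign_comm]
    congr 1
    refine Finset.sum_congr rfl fun k _ => ?_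
    rw [colorSign_mul, sub_sub_sub_cancel_right]
  have e3 : ∑ k ∈ Finset.univ.erase j, 1 / 2 * colorSign β.lefts j k / (x j - x k) ^ 2
      = ∑ k ∈ Finset.univ.erase j, 1 / 2 * colorSign β.lefts j k / (x k - x j) ^ 2 :=
    Finset.sum_congr rfl fun k _ => by rw [← neg_sub (x k) (x j), neg_sq]
  rw [e3, e1]
  have e4 : ∑ i ∈ Finset.univ.erase j,
      (2 / (x i - x j) * ((incidence N)⁻¹ α β * (colorBlock β.lefts x * logDer β.lefts i x)) -
        2 * (1 / 4) / (x i - x j) ^ 2 * ((incidence N)⁻¹ α β * colorBlock β.lefts x))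
      = (incidence N)⁻¹ α β * colorBlock β.lefts x * ∑ i ∈ Finset.univ.erase j,
        (2 / (x i - x j) * (1 / 2 * colorSign β.lefts j i / (x i - x j) +
          ∑ k ∈ (Finset.univ.erase j).erase i,
        1 / 2 * (colorSign β.lefts j i * colorSign β.lefts j k) /
          ((x i - x j) - (x k - x j))) - 1 / 2 / (x i - x j) ^ 2) := by
    rw [Finset.mul_sum]
    refine Finset.sum_congr rfl fun i hi => ?_
    rw [e2 i hi]
    ring
  rw [e4]
  linear_combination ((incidence N)⁻¹ α β * colorBlock β.lefts x) * key

/-! ### Inserting and removing a short link -/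

section Insert

variable {N : ℕ} {j k : Fin (2 * (N + 1))}

theorem skipPair_val (j : ℕ) (i : Fin (2 * N)) :
    (skipPair j i : ℕ) = if (i : ℕ) < j then (i : ℕ) else i + 2 := by
  unfold skipPair; split_ifs <;> rfl

theorem skipPair_lt_skipPair (j : ℕ) {i i' : Fin (2 * N)} :
    skipPair j i < skipPair j i' ↔ i < i' := by
  rw [Fin.lt_def, Fin.lt_def, skipPair_val, skipPair_val]
  split_ifs <;> omega

theorem skipPair_injective (j : ℕ) : Function.Injective (skipPair (N := N) j) :=
  StrictMono.injective fun _ _ h => (skipPair_lt_skipPair j).2 h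

theorem skipPair_ne_left (j : Fin (2 * (N + 1))) (i : Fin (2 * N)) : skipPair (j : ℕ) i ≠ j := by
  intro h
  have := congrArg Fin.val h
  rw [skipPair_val] at this
  split_ifs at this <;> omega

theorem skipPair_ne_right (hjk : (k : ℕ) = j + 1) (i : Fin (2 * N)) : skipPair (j : ℕ) i ≠ k := by
  intro h
  have := congrArg Fin.val h
  rw [skipPair_val] at this
  split_ifs at this <;> omega

theorem skipPair_lt_iff (i : Fin (2 * N)) : skipPair (j : ℕ) i < j ↔ (i : ℕ) < j := by
  rw [Fin.lt_def, skipPair_val]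
  split_ifs <;> omega

theorem lt_skipPair_iff (i : Fin (2 * N)) : j < skipPair (j : ℕ) i ↔ ¬ (i : ℕ) < j := by
  rw [Fin.lt_def, skipPair_val]
  split_ifs <;> omega

theorem skipPair_lt_iff' (hjk : (k : ℕ) = j + 1) (i : Fin (2 * N)) :
    skipPair (j : ℕ) i < k ↔ (i : ℕ) < j := by
  rw [Fin.lt_def, skipPair_val, hjk]
  split_ifs <;> omega

theorem lt_skipPair_iff' (hjk : (k : ℕ) = j + 1) (i : Fin (2 * N)) :
    k < skipPair (j : ℕ) i ↔ ¬ (i : ℕ) < j := by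
  rw [Fin.lt_def, skipPair_val, hjk]
  split_ifs <;> omega

theorem exists_skipPair_eq (hjk : (k : ℕ) = j + 1) {m : Fin (2 * (N + 1))} (h1 : m ≠ j)
    (h2 : m ≠ k) : ∃ i : Fin (2 * N), skipPair (j : ℕ) i = m := by
  have e1 : (m : ℕ) ≠ j := fun h => h1 (Fin.ext h)
  have e2 : (m : ℕ) ≠ k := fun h => h2 (Fin.ext h)
  by_cases h : (m : ℕ) < j
  · refine ⟨⟨m, by omega⟩, Fin.ext ?_⟩
    rw [skipPair_val, if_pos h]
  · refine ⟨⟨m - 2, by omega⟩, Fin.ext ?_⟩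
    rw [skipPair_val]
    simp only
    rw [if_neg (by omega)]
    omega

open Classical in
/-- Insert a short link into an involution. -/
noncomputable def insertFun (j k : Fin (2 * (N + 1))) (f : Fin (2 * N) → Fin (2 * N))
    (m : Fin (2 * (N + 1))) : Fin (2 * (N + 1)) :=
  if m = j then k else if m = k then j else
    if h : ∃ i : Fin (2 * N), skipPair (j : ℕ) i = m then skipPair (j : ℕ) (f h.choose) else m

theorem insertFun_left (f : Fin (2 * N) → Fin (2 * N)) : insertFun j k f j = k := if_pos rfl

theorem insertFun_right (hjk : (k : ℕ) = j + 1) (f : Fin (2 * N) → Fin (2 * N)) :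
    insertFun j k f k = j := by
  have : k ≠ j := fun h => by rw [h] at hjk; omega
  rw [insertFun, if_neg this, if_pos rfl]

theorem insertFun_skipPair (hjk : (k : ℕ) = j + 1) (f : Fin (2 * N) → Fin (2 * N))
    (i : Fin (2 * N)) : insertFun j k f (skipPair (j : ℕ) i) = skipPair (j : ℕ) (f i) := by
  have h : ∃ i' : Fin (2 * N), skipPair (j : ℕ) i' = skipPair (j : ℕ) i := ⟨i, rfl⟩
  rw [insertFun, if_neg (skipPair_ne_left j i), if_neg (skipPair_ne_right hjk i), dif_pos h]
  rw [skipPair_injective _ h.choose_spec]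

theorem forall_skipPair_iff (hjk : (k : ℕ) = j + 1) {P : Fin (2 * (N + 1)) → Prop} :
    (∀ m, P m) ↔ P j ∧ P k ∧ ∀ i : Fin (2 * N), P (skipPair (j : ℕ) i) := by
  refine ⟨fun h => ⟨h _, h _, fun _ => h _⟩, fun ⟨h1, h2, h3⟩ m => ?_⟩
  by_cases e1 : m = j
  · rwa [e1]
  by_cases e2 : m = k
  · rwa [e2]
  obtain ⟨i, rfl⟩ := exists_skipPair_eq hjk e1 e2
  exact h3 i

theorem IsNoncrossing.insertFun (hjk : (k : ℕ) = j + 1) {f : Fin (2 * N) → Fin (2 * N)}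
    (hf : IsNoncrossing f) : IsNoncrossing (insertFun j k f) := by
  have hlt : j < k := Fin.lt_def.2 (by omega)
  constructor
  · rw [forall_skipPair_iff hjk]
    refine ⟨?_, ?_, fun i => ?_⟩
    · rw [insertFun_left, insertFun_right hjk]
    · rw [insertFun_right hjk, insertFun_left]
    · rw [insertFun_skipPair hjk, insertFun_skipPair hjk, hf.invol]
  · rw [forall_skipPair_iff hjk]
    refine ⟨?_, ?_, fun i => ?_⟩
    · rw [insertFun_left]; exact hlt.ne'
    · rw [insertFun_right hjk]; exact hlt.ne
    · rw [insertFun_skipPair hjk]; exact fun h => hf.ne i (skipPair_injective _ h)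
  · rw [forall_skipPair_iff hjk]
    refine ⟨?_, ?_, fun i => ?_⟩
    · rw [insertFun_left]
      intro b h1 h2
      exact absurd (Fin.lt_def.1 h1) (by have := Fin.lt_def.1 h2; omega)
    · rw [insertFun_right hjk]
      intro b h1 h2
      exact absurd (h1.trans h2) hlt.asymm
    · rw [forall_skipPair_iff hjk, insertFun_skipPair hjk, insertFun_left, insertFun_right hjk]
      refine ⟨fun _ h2 h3 => ?_, fun _ h2 h3 => ?_, fun i' => ?_⟩
      · rw [lt_skipPair_iff] at h2
        rw [skipPair_lt_iff' hjk] at h3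
        exact h2 h3
      · exact absurd (h2.trans h3) hlt.asymm
      · rw [insertFun_skipPair hjk, skipPair_lt_skipPair, skipPair_lt_skipPair,
          skipPair_lt_skipPair]
        exact hf.nc i i'

/-- The pair partition obtained by inserting a short link. -/
noncomputable def insertPP (hjk : (k : ℕ) = j + 1) (γ : PairPartition N) : PairPartition (N + 1) :=
  ofMate (insertFun j k γ.mate) (γ.mate_isNoncrossing.insertFun hjk)

theorem mate_insertPP (hjk : (k : ℕ) = j + 1) (γ : PairPartition N) :
    (insertPP hjk γ).mate = insertFun j k γ.mate := mate_ofMate _ _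

theorem insertPP_injective (hjk : (k : ℕ) = j + 1) :
    Function.Injective (insertPP hjk : PairPartition N → _) := by
  intro γ δ h
  apply mate_injective
  funext i
  have := congrArg (fun α => α.mate (skipPair (j : ℕ) i)) h
  simp only [mate_insertPP, insertFun_skipPair hjk] at this
  exact skipPair_injective _ this

theorem exists_insertPP_eq (hjk : (k : ℕ) = j + 1) (α : PairPartition (N + 1))
    (h : α.mate j = k) : ∃ γ, insertPP hjk γ = α := by
  have hk : α.mate k = j := α.mate_eq_comm.1 h
  have hex : ∀ i : Fin (2 * N), ∃ i' : Fin (2 * N),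
      skipPair (j : ℕ) i' = α.mate (skipPair (j : ℕ) i) := by
    intro i
    refine exists_skipPair_eq hjk (fun h1 => ?_) (fun h1 => ?_)
    · rw [α.mate_eq_comm, h] at h1
      exact skipPair_ne_right hjk i h1.symm
    · rw [α.mate_eq_comm, hk] at h1
      exact skipPair_ne_left j i h1.symm
  choose f hf using hex
  have hnc : IsNoncrossing f := by
    refine ⟨fun i => ?_, fun i h1 => ?_, fun a b => ?_⟩
    · apply skipPair_injective (j : ℕ)
      rw [hf, hf, mate_mate]
    · have := hf i
      rw [h1] at this
      exact α.mate_ne _ this.symm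
    · rw [← skipPair_lt_skipPair (j : ℕ), ← skipPair_lt_skipPair (j : ℕ) (i := b),
        ← skipPair_lt_skipPair (j : ℕ) (i := f a), hf, hf]
      exact α.mate_isNoncrossing.nc _ _
  refine ⟨ofMate f hnc, mate_injective ?_⟩
  rw [mate_insertPP, mate_ofMate]
  funext m
  revert m
  rw [forall_skipPair_iff hjk]
  refine ⟨?_, ?_, fun i => ?_⟩
  · rw [insertFun_left, h]
  · rw [insertFun_right hjk, hk]
  · rw [insertFun_skipPair hjk, hf]

theorem isRemoval_insertPP (hjk : (k : ℕ) = j + 1) (γ : PairPartition N) :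
    IsRemoval (insertPP hjk γ) j k γ := by
  have hlt : j < k := Fin.lt_def.2 (by omega)
  have hinj : Function.Injective (Prod.map (skipPair (N := N) (j : ℕ)) (skipPair (N := N) (j : ℕ))) :=
    (skipPair_injective _).prodMap (skipPair_injective _)
  unfold IsRemoval
  rw [(links_nodup _).ext]
  · rintro ⟨a, b⟩
    rw [mem_links_iff, mate_insertPP, Multiset.mem_cons, Multiset.mem_map]
    revert a
    rw [forall_skipPair_iff hjk, insertFun_left, insertFun_right hjk]
    refine ⟨⟨?_, ?_⟩, ⟨?_, ?_⟩, fun i => ⟨?_, ?_⟩⟩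
    · rintro ⟨-, rfl⟩
      exact Or.inl rfl
    · rintro (h | ⟨l, -, h⟩)
      · rw [Prod.mk.injEq] at h
        exact ⟨h.2 ▸ hlt, h.2.symm⟩
      · exact absurd (congrArg Prod.fst h) (skipPair_ne_left j _)
    · rintro ⟨h, rfl⟩
      exact absurd h hlt.asymm
    · rintro (h | ⟨l, -, h⟩)
      · exact absurd (congrArg Prod.fst h) hlt.ne'
      · exact absurd (congrArg Prod.fst h) (skipPair_ne_right hjk _)
    · rintro ⟨h, rfl⟩
      rw [insertFun_skipPair hjk] at h ⊢
      exact Or.inr ⟨(i, γ.mate i), (γ.mem_links_iff _ _).2 ⟨(skipPair_lt_skipPair _).1 h, rfl⟩, rfl⟩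
    · rintro (h | ⟨⟨c, d⟩, hl, h⟩)
      · exact absurd (congrArg Prod.fst h) (skipPair_ne_left j _)
      · rw [mem_links_iff] at hl
        rw [Prod.map_apply, Prod.mk.injEq] at h
        have hc := skipPair_injective _ h.1
        subst hc
        rw [← h.2, insertFun_skipPair hjk, hl.2]
        exact ⟨(skipPair_lt_skipPair _).2 hl.1, rfl⟩
  · rw [Multiset.nodup_cons]
    refine ⟨fun h => ?_, (links_nodup γ).map hinj⟩
    obtain ⟨l, -, h⟩ := Multiset.mem_map.1 h
    exact absurd (congrArg Prod.fst h) (skipPair_ne_left j _)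

/-- The restriction of a colouring to the indices other than `j` and `j + 1`. -/
noncomputable def skipColors (j : Fin (2 * (N + 1))) (I : Finset (Fin (2 * (N + 1)))) :
    Finset (Fin (2 * N)) :=
  I.preimage (skipPair (j : ℕ)) (skipPair_injective _).injOn

theorem mem_skipColors {I : Finset (Fin (2 * (N + 1)))} {i : Fin (2 * N)} :
    i ∈ skipColors j I ↔ skipPair (j : ℕ) i ∈ I := Finset.mem_preimage

open Classical in
theorem compatInd_insertPP (hjk : (k : ℕ) = j + 1) (γ : PairPartition N)
    (I : Finset (Fin (2 * (N + 1)))) :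
    compatInd (insertPP hjk γ) I = if (k ∈ I ↔ j ∉ I) then compatInd γ (skipColors j I) else 0 := by
  have h : Compat (insertPP hjk γ).mate I ↔ (k ∈ I ↔ j ∉ I) ∧ Compat γ.mate (skipColors j I) := by
    unfold Compat
    rw [mate_insertPP, forall_skipPair_iff hjk, insertFun_left, insertFun_right hjk]
    simp only [insertFun_skipPair hjk, mem_skipColors]
    tauto
  unfold compatInd
  simp only [h]
  split_ifs <;> tauto

open Classical in
theorem prod_skipPair {M : Type*} [CommMonoid M] (hjk : (k : ℕ) = j + 1)
    (φ : Fin (2 * (N + 1)) → M) :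
    ∏ m, φ m = φ j * (φ k * ∏ i : Fin (2 * N), φ (skipPair (j : ℕ) i)) := by
  have hne : j ≠ k := fun h => by rw [h] at hjk; omega
  have h : (Finset.univ : Finset (Fin (2 * (N + 1)))) =
      insert j (insert k (Finset.univ.map ⟨skipPair (N := N) (j : ℕ), skipPair_injective _⟩)) := by
    symm
    rw [Finset.eq_univ_iff_forall, forall_skipPair_iff hjk]
    simp
  rw [h, Finset.prod_insert, Finset.prod_insert, Finset.prod_map]
  · rfl
  · simp [skipPair_ne_right hjk]
  · simp [hne, skipPair_ne_left]

open Classical in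
theorem card_skipColors (hjk : (k : ℕ) = j + 1) {I : Finset (Fin (2 * (N + 1)))}
    (hI : I.card = N + 1) (h : k ∈ I ↔ j ∉ I) : (skipColors j I).card = N := by
  have e : ∀ {n : ℕ} (J : Finset (Fin n)),
      Multiplicative.ofAdd J.card = ∏ m, if m ∈ J then Multiplicative.ofAdd 1 else 1 := by
    intro n J
    rw [Finset.prod_ite_mem, Finset.univ_inter, Finset.prod_const, ← ofAdd_nsmul]
    simp
  have h1 := e I
  rw [prod_skipPair hjk] at h1
  have h2 := e (skipColors j I)
  simp only [mem_skipColors] at h2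
  rw [← h2, hI] at h1
  by_cases hj : j ∈ I
  · have hk : k ∉ I := by tauto
    rw [if_pos hj, if_neg hk, one_mul, ← ofAdd_add] at h1
    have := Multiplicative.ofAdd.injective h1
    omega
  · have hk : k ∈ I := by tauto
    rw [if_neg hj, if_pos hk, one_mul, ← ofAdd_add] at h1
    have := Multiplicative.ofAdd.injective h1
    omega

/-- The interaction of the points `j` and `k` with another point in a block. -/
noncomputable def crossFactor (j k : Fin (2 * (N + 1))) (I : Finset (Fin (2 * (N + 1))))
    (x : Fin (2 * (N + 1)) → ℝ) (i : Fin (2 * N)) : ℝ :=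
  |x (skipPair (j : ℕ) i) - x j| ^ (1 / 2 * colorSign I j (skipPair (j : ℕ) i)) *
    |x (skipPair (j : ℕ) i) - x k| ^ (1 / 2 * colorSign I k (skipPair (j : ℕ) i))

theorem colorBlock_skipPair (hjk : (k : ℕ) = j + 1) (I : Finset (Fin (2 * (N + 1))))
    {x : Fin (2 * (N + 1)) → ℝ} (hx : x ∈ config (2 * (N + 1))) :
    colorBlock I x = (x k - x j) ^ (1 / 2 * colorSign I j k) * (∏ i, crossFactor j k I x i) *
      colorBlock (skipColors j I) (x ∘ skipPair (j : ℕ)) := by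
  classical
  have hlt : j < k := Fin.lt_def.2 (by omega)
  have hIoi : ∀ {n : ℕ} (i : Fin n) (g : Fin n → ℝ),
      ∏ l ∈ Finset.Ioi i, g l = ∏ l, if i < l then g l else 1 := by
    intro n i g
    rw [← Finset.prod_filter]
    congr 1
    ext; simp
  unfold colorBlock
  rw [prod_skipPair hjk]
  simp only [hIoi]
  simp only [prod_skipPair hjk]
  simp only [lt_self_iff_false, if_false, if_pos hlt, if_neg hlt.asymm, one_mul,
    skipPair_lt_skipPair, skipPair_lt_iff, lt_skipPair_iff, skipPair_lt_iff' hjk,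
    lt_skipPair_iff' hjk, Finset.prod_mul_distrib, Function.comp_apply]
  have h1 : ∀ i l : Fin (2 * N), colorSign (skipColors j I) i l =
      colorSign I (skipPair (j : ℕ) i) (skipPair (j : ℕ) l) := by
    intro i l
    unfold colorSign
    simp only [mem_skipColors]
  have h2 : ∏ i, crossFactor j k I x i =
      (∏ i : Fin (2 * N), if ¬ (i : ℕ) < j then (x (skipPair (j : ℕ) i) - x j) ^
        (1 / 2 * colorSign I j (skipPair (j : ℕ) i)) else 1) *
      (∏ i : Fin (2 * N), if ¬ (i : ℕ) < j then (x (skipPair (j : ℕ) i) - x k) ^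
        (1 / 2 * colorSign I k (skipPair (j : ℕ) i)) else 1) *
      ((∏ i : Fin (2 * N), if (i : ℕ) < j then (x j - x (skipPair (j : ℕ) i)) ^
        (1 / 2 * colorSign I (skipPair (j : ℕ) i) j) else 1) *
      (∏ i : Fin (2 * N), if (i : ℕ) < j then (x k - x (skipPair (j : ℕ) i)) ^
        (1 / 2 * colorSign I (skipPair (j : ℕ) i) k) else 1)) := by
    simp only [← Finset.prod_mul_distrib]
    refine Finset.prod_congr rfl fun i _ => ?_
    unfold crossFactor
    by_cases hi : (i : ℕ) < j
    · have e1 : x (skipPair (j : ℕ) i) < x j := hx ((skipPair_lt_iff i).2 hi)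
      have e2 : x (skipPair (j : ℕ) i) < x k := hx ((skipPair_lt_iff' hjk i).2 hi)
      simp only [hi, not_true_eq_false, if_false, if_true, one_mul]
      rw [abs_of_neg (sub_neg.2 e1), abs_of_neg (sub_neg.2 e2), neg_sub, neg_sub,
        colorSign_comm I j, colorSign_comm I k]
    · have e1 : x j < x (skipPair (j : ℕ) i) := hx ((lt_skipPair_iff i).2 hi)
      have e2 : x k < x (skipPair (j : ℕ) i) := hx ((lt_skipPair_iff' hjk i).2 hi)
      simp only [hi, not_false_eq_true, if_false, if_true, mul_one]
      rw [abs_of_pos (sub_pos.2 e1), abs_of_pos (sub_pos.2 e2)]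
  rw [h2]
  simp only [h1]
  ring

end Insert

/-! ### Collision of two neighbouring points -/

section Collision

variable {N : ℕ} {j k : Fin (2 * (N + 1))}

theorem tendsto_colorBlock_collision (hjk : (k : ℕ) = j + 1) {I : Finset (Fin (2 * (N + 1)))}
    (hI : I.card = N + 1) {x : Fin (2 * (N + 1)) → ℝ} {ξ : ℝ}
    (hx : x ∘ skipPair (N := N) (j : ℕ) ∈ config (2 * N)) (h1 : ∀ i < j, x i < ξ)
    (h2 : ∀ i > k, ξ < x i) :
    Tendsto (fun p : ℝ × ℝ => colorBlock I (Function.update (Function.update x j p.1) k p.2)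
        / (p.2 - p.1) ^ (-(1 / 2) : ℝ)) (𝓝[{p | p.1 < p.2}] (ξ, ξ))
      (𝓝 (∑ γ, pureZ γ (x ∘ skipPair (j : ℕ)) * compatInd (insertPP hjk γ) I)) := by
  classical
  have hlt : j < k := Fin.lt_def.2 (by omega)
  set X : ℝ × ℝ → Fin (2 * (N + 1)) → ℝ :=
    fun p => Function.update (Function.update x j p.1) k p.2 with hX
  have Xj : ∀ p, X p j = p.1 := fun p => by
    simp only [hX, Function.update_of_ne hlt.ne, Function.update_self]
  have Xk : ∀ p, X p k = p.2 := fun p => by simp only [hX, Function.update_self]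
  have Xs : ∀ p i, X p (skipPair (N := N) (j : ℕ) i) = x (skipPair (j : ℕ) i) := fun p i => by
    simp only [hX, Function.update_of_ne (skipPair_ne_right hjk i),
      Function.update_of_ne (skipPair_ne_left j i)]
  have hne : ∀ i : Fin (2 * N), x (skipPair (j : ℕ) i) - ξ ≠ 0 := fun i => by
    rw [sub_ne_zero]
    by_cases hi : (i : ℕ) < j
    · exact (h1 _ ((skipPair_lt_iff i).2 hi)).ne
    · exact (h2 _ ((lt_skipPair_iff' hjk i).2 hi)).ne'
  have hfst : Tendsto (fun p : ℝ × ℝ => p.1) (𝓝[{p | p.1 < p.2}] (ξ, ξ)) (𝓝 ξ) :=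
    (continuous_fst.tendsto (ξ, ξ)).mono_left nhdsWithin_le_nhds
  have hsnd : Tendsto (fun p : ℝ × ℝ => p.2) (𝓝[{p | p.1 < p.2}] (ξ, ξ)) (𝓝 ξ) :=
    (continuous_snd.tendsto (ξ, ξ)).mono_left nhdsWithin_le_nhds
  have hconf : ∀ᶠ p in 𝓝[{p : ℝ × ℝ | p.1 < p.2}] (ξ, ξ), X p ∈ config (2 * (N + 1)) := by
    have e1 : ∀ᶠ p in 𝓝[{p : ℝ × ℝ | p.1 < p.2}] (ξ, ξ), ∀ i : Fin (2 * N),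
        (i : ℕ) < j → x (skipPair (j : ℕ) i) < p.1 := by
      rw [eventually_all]
      intro i
      by_cases hi : (i : ℕ) < j
      · filter_upwards [hfst.eventually_const_lt (h1 _ ((skipPair_lt_iff i).2 hi))] with p hp _
        exact hp
      · exact Eventually.of_forall fun p h => absurd h hi
    have e2 : ∀ᶠ p in 𝓝[{p : ℝ × ℝ | p.1 < p.2}] (ξ, ξ), ∀ i : Fin (2 * N),
        ¬ (i : ℕ) < j → p.2 < x (skipPair (j : ℕ) i) := by
      rw [eventually_all]
      intro i
      by_cases hi : (i : ℕ) < j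
      · exact Eventually.of_forall fun p h => absurd hi h
      · filter_upwards [hsnd.eventually_lt_const (h2 _ ((lt_skipPair_iff' hjk i).2 hi))] with p hp _
        exact hp
    filter_upwards [e1, e2, self_mem_nhdsWithin] with p hp1 hp2 hp3
    have hp3' : p.1 < p.2 := hp3
    change ∀ a, _
    rw [forall_skipPair_iff hjk]
    refine ⟨?_, ?_, fun i => ?_⟩ <;> rw [forall_skipPair_iff hjk]
    · simp only [Xj, Xk, Xs, lt_skipPair_iff, lt_self_iff_false, false_imp_iff, true_and]
      exact ⟨fun _ => hp3', fun i hi => hp3'.trans (hp2 i hi)⟩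
    · simp only [Xj, Xk, Xs, lt_skipPair_iff' hjk, lt_self_iff_false, false_imp_iff, true_and]
      exact ⟨fun h => absurd h hlt.asymm, fun i hi => hp2 i hi⟩
    · simp only [Xj, Xk, Xs, skipPair_lt_iff' hjk, skipPair_lt_iff, skipPair_lt_skipPair]
      exact ⟨hp1 i, fun hi => (hp1 i hi).trans hp3', fun i' h => hx h⟩
  have hcross : Tendsto (fun p => ∏ i, crossFactor j k I (X p) i) (𝓝[{p | p.1 < p.2}] (ξ, ξ))
      (𝓝 (∏ i : Fin (2 * N), |x (skipPair (j : ℕ) i) - ξ| ^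
        (1 / 2 * colorSign I j (skipPair (j : ℕ) i) +
          1 / 2 * colorSign I k (skipPair (j : ℕ) i)))) := by
    refine tendsto_finsetProd _ fun i _ => ?_
    unfold crossFactor
    simp only [Xj, Xk, Xs]
    rw [Real.rpow_add (abs_pos.2 (hne i))]
    exact ((hfst.const_sub _).abs.rpow_const (Or.inl (abs_pos.2 (hne i)).ne')).mul
      ((hsnd.const_sub _).abs.rpow_const (Or.inl (abs_pos.2 (hne i)).ne'))
  have hself : ∀ᶠ p in 𝓝[{p : ℝ × ℝ | p.1 < p.2}] (ξ, ξ), colorBlock I (X p) /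
      (p.2 - p.1) ^ (-(1 / 2) : ℝ) = (p.2 - p.1) ^ (1 / 2 * colorSign I j k + 1 / 2) *
        (∏ i, crossFactor j k I (X p) i) *
        colorBlock (skipColors j I) (x ∘ skipPair (j : ℕ)) := by
    filter_upwards [hconf, self_mem_nhdsWithin] with p hp hp'
    have hpos : 0 < p.2 - p.1 := sub_pos.2 hp'
    rw [colorBlock_skipPair hjk I hp, Real.rpow_add hpos, Real.rpow_neg hpos.le, div_inv_eq_mul,
      Xj, Xk, show X p ∘ skipPair (j : ℕ) = x ∘ skipPair (N := N) (j : ℕ) from funext (Xs p)]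
    ring
  refine Tendsto.congr' (EventuallyEq.symm hself) ?_
  simp only [compatInd_insertPP]
  by_cases hc : k ∈ I ↔ j ∉ I
  · have hs : ∀ i, colorSign I j i + colorSign I k i = 0 := by
      intro i
      unfold colorSign
      by_cases a1 : j ∈ I <;> by_cases a2 : i ∈ I <;> simp [hc, a1, a2]
    have hs' : colorSign I j k = -1 := by
      unfold colorSign
      by_cases a1 : j ∈ I <;> simp [hc, a1]
    simp only [if_pos hc]
    rw [← colorBlock_eq_sum (card_skipColors hjk hI hc) hx]
    have h3 : ∏ i : Fin (2 * N), |x (skipPair (j : ℕ) i) - ξ| ^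
        (1 / 2 * colorSign I j (skipPair (j : ℕ) i) +
          1 / 2 * colorSign I k (skipPair (j : ℕ) i)) = 1 := by
      refine Finset.prod_eq_one fun i _ => ?_
      rw [← mul_add, hs, mul_zero, Real.rpow_zero]
    rw [h3] at hcross
    have h4 := hcross.mul_const (colorBlock (skipColors j I) (x ∘ skipPair (j : ℕ)))
    rw [one_mul] at h4
    refine h4.congr fun p => ?_
    rw [hs', show (1 / 2 * -1 + 1 / 2 : ℝ) = 0 by norm_num, Real.rpow_zero, one_mul]
  · have hs' : colorSign I j k = 1 := by
      unfold colorSign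
      rw [if_pos (by tauto)]
    simp only [if_neg hc, mul_zero, Finset.sum_const_zero]
    have h3 : Tendsto (fun p : ℝ × ℝ => (p.2 - p.1) ^ (1 / 2 * colorSign I j k + 1 / 2))
        (𝓝[{p | p.1 < p.2}] (ξ, ξ)) (𝓝 0) := by
      rw [hs', show (1 / 2 * 1 + 1 / 2 : ℝ) = 1 by norm_num]
      simp only [Real.rpow_one]
      simpa using hsnd.sub hfst
    have h4 := (h3.mul hcross).mul_const (colorBlock (skipColors j I) (x ∘ skipPair (j : ℕ)))
    rwa [zero_mul, zero_mul] at h4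

theorem tendsto_pureZ_collision (hjk : (k : ℕ) = j + 1) (α : PairPartition (N + 1))
    {x : Fin (2 * (N + 1)) → ℝ} {ξ : ℝ}
    (hx : x ∘ skipPair (N := N) (j : ℕ) ∈ config (2 * N)) (h1 : ∀ i < j, x i < ξ)
    (h2 : ∀ i > k, ξ < x i) :
    Tendsto (fun p : ℝ × ℝ => pureZ α (Function.update (Function.update x j p.1) k p.2)
        / (p.2 - p.1) ^ (-(1 / 2) : ℝ)) (𝓝[{p | p.1 < p.2}] (ξ, ξ))
      (𝓝 (∑ γ, if α = insertPP hjk γ then pureZ γ (x ∘ skipPair (j : ℕ)) else 0)) := by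
  have h := tendsto_finsetSum (Finset.univ : Finset (PairPartition (N + 1))) fun β _ =>
    (tendsto_colorBlock_collision hjk (β.compat_lefts.card β.mate_isNoncrossing) hx h1
      h2).const_mul ((incidence (N + 1))⁻¹ α β)
  refine (h.congr fun p => ?_).trans_eq ?_
  · rw [pureZ_eq, Finset.sum_div]
    exact Finset.sum_congr rfl fun β _ => by rw [mul_div_assoc]
  · congr 1
    simp only [Finset.mul_sum]
    rw [Finset.sum_comm]
    refine Finset.sum_congr rfl fun γ _ => ?_
    have h3 := congrFun (congrFun (Matrix.nonsing_inv_mul (incidence (N + 1))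
      ((Matrix.isUnit_iff_isUnit_det _).1 (isUnit_incidence _))) α) (insertPP hjk γ)
    rw [Matrix.mul_apply, Matrix.one_apply] at h3
    simp only [incidence_apply] at h3
    rw [← mul_boole (α = insertPP hjk γ), ← h3, Finset.mul_sum]
    exact Finset.sum_congr rfl fun β _ => by ring

theorem pureZ_asymptotics (hjk : (k : ℕ) = j + 1) (α : PairPartition (N + 1))
    {x : Fin (2 * (N + 1)) → ℝ} {ξ : ℝ}
    (hx : x ∘ skipPair (N := N) (j : ℕ) ∈ config (2 * N)) (h1 : ∀ i < j, x i < ξ)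
    (h2 : ∀ i > k, ξ < x i) :
    ((j, k) ∉ α.links →
      Tendsto (fun p : ℝ × ℝ => pureZ α (Function.update (Function.update x j p.1) k p.2)
        / (p.2 - p.1) ^ (-(1 / 2) : ℝ)) (𝓝[{p | p.1 < p.2}] (ξ, ξ)) (𝓝 0)) ∧
    ((j, k) ∈ α.links → ∃ α' : PairPartition N, IsRemoval α j k α' ∧
      Tendsto (fun p : ℝ × ℝ => pureZ α (Function.update (Function.update x j p.1) k p.2)
        / (p.2 - p.1) ^ (-(1 / 2) : ℝ)) (𝓝[{p | p.1 < p.2}] (ξ, ξ))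
        (𝓝 (pureZ α' (x ∘ skipPair (j : ℕ))))) := by
  have hlt : j < k := Fin.lt_def.2 (by omega)
  have h := tendsto_pureZ_collision hjk α hx h1 h2
  constructor
  · intro hα
    rwa [Finset.sum_eq_zero] at h
    intro γ _
    rw [if_neg]
    rintro rfl
    exact hα ((mem_links_iff _ _ _).2 ⟨hlt, by rw [mate_insertPP, insertFun_left]⟩)
  · intro hα
    obtain ⟨γ, rfl⟩ := exists_insertPP_eq hjk α ((mem_links_iff _ _ _).1 hα).2
    refine ⟨γ, isRemoval_insertPP hjk γ, ?_⟩
    rwa [Finset.sum_eq_single γ, if_pos rfl] at h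
    · intro δ _ hδ
      rw [if_neg fun h => hδ (insertPP_injective hjk h).symm]
    · exact fun h => absurd (Finset.mem_univ _) h

end Collision

/-! ### Pairs of points -/

/-- The first of the two points into which `j` is split. -/
def evenPt {n : ℕ} (j : Fin n) : Fin (2 * n) := ⟨2 * j, by omega⟩

/-- The second of the two points into which `j` is split. -/
def oddPt {n : ℕ} (j : Fin n) : Fin (2 * n) := ⟨2 * j + 1, by omega⟩

section Pairs

variable {n : ℕ}

@[simp] theorem halve_evenPt (j : Fin n) : halve (evenPt j) = j :=
  Fin.ext (by simp [halve, evenPt])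

@[simp] theorem halve_oddPt (j : Fin n) : halve (oddPt j) = j :=
  Fin.ext (by simp only [halve, oddPt]; omega)

theorem evenPt_ne_oddPt (j l : Fin n) : evenPt j ≠ oddPt l := fun h => by
  have := congrArg Fin.val h
  simp only [evenPt, oddPt] at this
  omega

theorem eq_evenPt_or_oddPt (k : Fin (2 * n)) : k = evenPt (halve k) ∨ k = oddPt (halve k) := by
  simp only [Fin.ext_iff, evenPt, oddPt, halve]
  omega

theorem evenPt_injective : Function.Injective (evenPt (n := n)) := fun i j h => by
  rw [← halve_evenPt i, h, halve_evenPt]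

theorem oddPt_injective : Function.Injective (oddPt (n := n)) := fun i j h => by
  rw [← halve_oddPt i, h, halve_oddPt]

theorem evenPt_lt_oddPt (j : Fin n) : evenPt j < oddPt j := Fin.lt_def.2 (by simp [evenPt, oddPt])

theorem halve_le_halve {i k : Fin (2 * n)} (h : i < k) : halve i ≤ halve k := by
  rw [Fin.le_def]
  simp only [halve]
  have := Fin.lt_def.1 h
  omega

theorem lt_of_halve_lt {i k : Fin (2 * n)} (h : halve i < halve k) : i < k := by
  rw [Fin.lt_def] at h ⊢
  simp only [halve] at h
  omega

@[to_additive]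
theorem prod_pairs {M : Type*} [CommMonoid M] (φ : Fin (2 * n) → M) :
    ∏ k, φ k = ∏ j, φ (evenPt j) * φ (oddPt j) := by
  classical
  have h : (Finset.univ : Finset (Fin (2 * n))) =
      Finset.univ.map ⟨evenPt, evenPt_injective⟩ ∪ Finset.univ.map ⟨oddPt, oddPt_injective⟩ := by
    symm
    rw [Finset.eq_univ_iff_forall]
    intro k
    rcases eq_evenPt_or_oddPt k with h | h <;> rw [h] <;> simp
  rw [h, Finset.prod_union, Finset.prod_map, Finset.prod_map, Finset.prod_mul_distrib]
  · rfl
  · rw [Finset.disjoint_left]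
    intro k h1 h2
    obtain ⟨i, -, rfl⟩ := Finset.mem_map.1 h1
    obtain ⟨j, -, h⟩ := Finset.mem_map.1 h2
    exact evenPt_ne_oddPt _ _ h.symm

/-- The configurations in which only the two points of a pair may collide or be exchanged. -/
def pairConfig (n : ℕ) : Set (Fin (2 * n) → ℝ) := {x | ∀ i k, halve i < halve k → x i < x k}

theorem isOpen_pairConfig (n : ℕ) : IsOpen (pairConfig n) := by
  have : pairConfig n = ⋂ i : Fin (2 * n), ⋂ j : Fin (2 * n), ⋂ _ : halve i < halve j,
      {x | x i < x j} := by
    ext x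
    simp only [pairConfig, Set.mem_ofPred_eq, Set.mem_iInter]
  rw [this]
  refine isOpen_iInter_of_finite fun i => isOpen_iInter_of_finite fun j =>
    isOpen_iInter_of_finite fun _ => isOpen_lt (continuous_apply i) (continuous_apply j)

theorem config_subset_pairConfig (n : ℕ) : config (2 * n) ⊆ pairConfig n :=
  fun _ hx _ _ h => hx (lt_of_halve_lt h)

theorem comp_halve_mem {y : Fin n → ℝ} (hy : y ∈ config n) : y ∘ halve ∈ pairConfig n :=
  fun _ _ h => hy h

/-- The square roots of the differences within the pairs. -/
noncomputable def pairSqrt (x : Fin (2 * n) → ℝ) : ℝ :=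
  ∏ j, (x (oddPt j) - x (evenPt j)) ^ (1 / 2 : ℝ)

/-- The square roots of the differences between different pairs. -/
noncomputable def crossSqrt (x : Fin (2 * n) → ℝ) : ℝ :=
  ∏ i, ∏ k ∈ Finset.Ioi i, if halve i = halve k then 1 else (x k - x i) ^ (1 / 2 : ℝ)

theorem pairSqrt_pos {x : Fin (2 * n) → ℝ} (hx : x ∈ config (2 * n)) : 0 < pairSqrt x :=
  Finset.prod_pos fun j _ => Real.rpow_pos_of_pos (sub_pos.2 (hx (evenPt_lt_oddPt j))) _

theorem sub_pos_of_pairConfig {x : Fin (2 * n) → ℝ} (hx : x ∈ pairConfig n) {i k : Fin (2 * n)}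
    (hk : k ∈ Finset.Ioi i) (h : halve i ≠ halve k) : 0 < x k - x i :=
  sub_pos.2 (hx _ _ (lt_of_le_of_ne (halve_le_halve (Finset.mem_Ioi.1 hk)) h))

theorem crossSqrt_pos {x : Fin (2 * n) → ℝ} (hx : x ∈ pairConfig n) : 0 < crossSqrt x := by
  refine Finset.prod_pos fun i _ => Finset.prod_pos fun k hk => ?_
  split_ifs with h
  · exact one_pos
  · exact Real.rpow_pos_of_pos (sub_pos_of_pairConfig hx hk h) _

theorem contDiffOn_crossSqrt : ContDiffOn ℝ ∞ (crossSqrt (n := n)) (pairConfig n) := by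
  unfold crossSqrt
  refine contDiffOn_prod fun i _ => contDiffOn_prod fun k hk => ?_
  split_ifs with h
  · exact contDiffOn_const
  · refine ContDiffOn.rpow_const_of_ne ?_ fun x hx => (sub_pos_of_pairConfig hx hk h).ne'
    exact ((contDiff_apply ℝ ℝ k).sub (contDiff_apply ℝ ℝ i)).contDiffOn

theorem sqrtVandermonde_eq (x : Fin (2 * n) → ℝ) :
    sqrtVandermonde x = crossSqrt x * pairSqrt x := by
  have h : pairSqrt x = ∏ i, ∏ k ∈ Finset.Ioi i,
      if halve i = halve k then (x k - x i) ^ (1 / 2 : ℝ) else 1 := by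
    unfold pairSqrt
    rw [prod_pairs]
    refine Finset.prod_congr rfl fun j _ => ?_
    rw [Finset.prod_eq_single_of_mem (oddPt j) (Finset.mem_Ioi.2 (evenPt_lt_oddPt j)),
      Finset.prod_eq_one, mul_one, if_pos (by simp)]
    · intro k hk
      rw [if_neg]
      intro h
      rw [halve_oddPt] at h
      rcases eq_evenPt_or_oddPt k with h1 | h1 <;> rw [← h] at h1 <;> rw [h1] at hk
      · exact absurd (Finset.mem_Ioi.1 hk) (evenPt_lt_oddPt j).asymm
      · exact absurd (Finset.mem_Ioi.1 hk) (lt_irrefl _)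
    · intro k hk hne
      rw [if_neg]
      intro h
      rw [halve_evenPt] at h
      rcases eq_evenPt_or_oddPt k with h1 | h1 <;> rw [← h] at h1
      · rw [h1] at hk; exact absurd (Finset.mem_Ioi.1 hk) (lt_irrefl _)
      · exact hne h1
  rw [h, crossSqrt, sqrtVandermonde, ← Finset.prod_mul_distrib]
  refine Finset.prod_congr rfl fun i _ => ?_
  rw [← Finset.prod_mul_distrib]
  refine Finset.prod_congr rfl fun k _ => ?_
  split_ifs <;> ring

end Pairs

/-! ### Divided differences of the moment curve -/

section Divided

variable {n : ℕ}

/-- The divided difference of the moment curve. -/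
noncomputable def dividedMoment {N : ℕ} (a b : ℝ) : Fin N → ℝ :=
  fun c => ∑ i ∈ Finset.range c, a ^ i * b ^ ((c : ℕ) - 1 - i)

theorem flag_zero_eq {N : ℕ} (a b : ℝ) :
    (flag 0 b : Fin N → ℝ) = flag 0 a + (b - a) • dividedMoment a b := by
  funext c
  have := geom_sum₂_mul a b (c : ℕ)
  simp only [flag, dividedMoment, Pi.add_apply, Pi.smul_apply, smul_eq_mul, Nat.descFactorial_zero,
    Nat.cast_one, one_mul, Nat.sub_zero]
  linarith

theorem dividedMoment_self {N : ℕ} (t : ℝ) : (dividedMoment t t : Fin N → ℝ) = flag 1 t := by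
  funext c
  have := geom_sum₂_self t (c : ℕ)
  simp only [flag, dividedMoment, this, Nat.descFactorial_one]

/-- The vectors of the moment curve, with the second one of each pair replaced by the divided
difference. -/
noncomputable def dividedVec (x : Fin (2 * n) → ℝ) (k : Fin (2 * n)) : Fin n → ℝ :=
  if (k : ℕ) % 2 = 0 then flag 0 (x k) else dividedMoment (x (evenPt (halve k))) (x k)

theorem dividedVec_evenPt (x : Fin (2 * n) → ℝ) (j : Fin n) :
    dividedVec x (evenPt j) = flag 0 (x (evenPt j)) := by
  simp [dividedVec, evenPt]

theorem dividedVec_oddPt (x : Fin (2 * n) → ℝ) (j : Fin n) :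
    dividedVec x (oddPt j) = dividedMoment (x (evenPt j)) (x (oddPt j)) := by
  rw [dividedVec, if_neg, halve_oddPt]
  simp only [oddPt]
  omega

theorem dividedVec_comp_halve (y : Fin n → ℝ) : dividedVec (y ∘ halve) = doubled y := by
  funext k
  rcases eq_evenPt_or_oddPt k with h | h <;> rw [h]
  · rw [dividedVec_evenPt]
    simp [doubled, evenPt, halve]
  · rw [dividedVec_oddPt]
    simp only [Function.comp_apply, halve_evenPt, halve_oddPt, dividedMoment_self, doubled]
    congr 1
    simp only [oddPt]
    omega

theorem contDiff_dividedVec : ContDiff ℝ ∞ (dividedVec (n := n)) := by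
  rw [contDiff_pi]
  intro k
  rw [contDiff_pi]
  intro c
  unfold dividedVec
  split_ifs
  · simp only [flag]
    exact contDiff_const.mul ((contDiff_apply ℝ ℝ k).pow _)
  · simp only [dividedMoment]
    exact ContDiff.sum fun i _ => ((contDiff_apply ℝ ℝ _).pow _).mul ((contDiff_apply ℝ ℝ _).pow _)

/-- No link joins the two points of a pair. -/
def Unlinked (α : PairPartition n) : Prop := ∀ j, α.mate (evenPt j) ≠ oddPt j

theorem unlinked_split (a : LinkPattern (fun _ : Fin n => 2)) : Unlinked a.split := by
  intro j h
  have h1 : (evenPt j, oddPt j) ∈ a.split.links :=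
    (mem_links_iff _ _ _).2 ⟨evenPt_lt_oddPt j, h⟩
  have h2 := Multiset.mem_map_of_mem (Prod.map halve halve) h1
  rw [a.split_spec] at h2
  have h3 := a.lt _ h2
  simp at h3

theorem pureM_moment_eq {α : PairPartition n} (hα : Unlinked α) (x : Fin (2 * n) → ℝ) :
    pureM α (fun k => flag 0 (x k)) =
      pureM α (dividedVec x) * ∏ j, (x (oddPt j) - x (evenPt j)) := by
  classical
  have key : ∀ S : Finset (Fin n), pureM α (fun k => flag 0 (x k)) =
      pureM α (fun k => if halve k ∈ S then dividedVec x k else flag 0 (x k)) *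
        ∏ j ∈ S, (x (oddPt j) - x (evenPt j)) := by
    intro S
    induction S using Finset.induction_on with
    | empty => simp
    | insert j S hj ih =>
      rw [ih, Finset.prod_insert hj]
      set q : Fin (2 * n) → Fin n → ℝ :=
        fun k => if halve k ∈ insert j S then dividedVec x k else flag 0 (x k) with hq
      have qe : q (evenPt j) = flag 0 (x (evenPt j)) := by
        simp [hq, dividedVec_evenPt]
      have qo : q (oddPt j) = dividedMoment (x (evenPt j)) (x (oddPt j)) := by
        simp [hq, dividedVec_oddPt]
      have e : (fun k => if halve k ∈ S then dividedVec x k else flag 0 (x k)) =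
          Function.update q (oddPt j) (flag 0 (x (evenPt j)) +
            (x (oddPt j) - x (evenPt j)) • dividedMoment (x (evenPt j)) (x (oddPt j))) := by
        funext k
        by_cases h1 : k = oddPt j
        · subst h1
          rw [Function.update_self, halve_oddPt, if_neg hj, flag_zero_eq (x (evenPt j))]
        · rw [Function.update_of_ne h1]
          by_cases h2 : halve k = j
          · have h3 : k = evenPt j := by
              rcases eq_evenPt_or_oddPt k with h | h
              · rw [h, h2]
              · rw [h2] at h; exact absurd h h1
            rw [h3, qe, halve_evenPt, if_neg hj]
          · simp only [hq, Finset.mem_insert, h2, false_or]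
      rw [e, MultilinearMap.map_update_add, MultilinearMap.map_update_smul, ← qo,
        Function.update_eq_self, smul_eq_mul,
        pureM_eq_zero _ (i := evenPt j) (j := oddPt j) rfl α (hα j)]
      · ring
      · rw [Function.update_self, Function.update_of_ne (evenPt_ne_oddPt j j), qe]
  have := key Finset.univ
  simpa using this

/-- The quotient of a pure partition function by the square roots of the differences within the
pairs, extended to `pairConfig`. -/
noncomputable def pairRatio (α : PairPartition n) (x : Fin (2 * n) → ℝ) : ℝ :=
  pureM α (dividedVec x) / crossSqrt x

theorem contDiffOn_pairRatio (α : PairPartition n) : ContDiffOn ℝ ∞ (pairRatio α) (pairConfig n) :=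
  ((contDiff_pureM α).comp contDiff_dividedVec).contDiffOn.div contDiffOn_crossSqrt
    fun _ hx => (crossSqrt_pos hx).ne'

theorem pureZ_eq_pairRatio {α : PairPartition n} (hα : Unlinked α) {x : Fin (2 * n) → ℝ}
    (hx : x ∈ config (2 * n)) : pureZ α x = pairRatio α x * pairSqrt x := by
  have h1 := crossSqrt_pos (config_subset_pairConfig n hx)
  have h2 := pairSqrt_pos hx
  have h3 : ∏ j, (x (oddPt j) - x (evenPt j)) = pairSqrt x * pairSqrt x := by
    unfold pairSqrt
    rw [← Finset.prod_mul_distrib]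
    refine Finset.prod_congr rfl fun j _ => ?_
    have hpos := sub_pos.2 (hx (evenPt_lt_oddPt j))
    rw [← Real.rpow_add hpos]
    norm_num
  rw [pureZ_eq_div α hx, pureM_moment_eq hα, sqrtVandermonde_eq, h3, pairRatio]
  field_simp

theorem pairRatio_pos {α : PairPartition n} (hα : Unlinked α) {y : Fin n → ℝ} (hy : y ∈ config n) :
    0 < pairRatio α (y ∘ halve) := by
  unfold pairRatio
  refine div_pos ?_ (crossSqrt_pos (comp_halve_mem hy))
  rw [dividedVec_comp_halve]
  refine pureM_doubled_pos α (fun k k' h1 h2 => ?_) hy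
  rcases eq_evenPt_or_oddPt k with h | h
  · have h3 : k' = oddPt (halve k) := Fin.ext (by simp only [oddPt, halve]; omega)
    rw [h3]
    intro h4
    rw [h] at h4
    simp only [halve_evenPt] at h4
    exact hα _ h4
  · have := congrArg Fin.val h
    simp only [oddPt, halve] at this
    omega

theorem fusionRatio_eq (a : LinkPattern (fun _ : Fin n => 2)) {x : Fin (2 * n) → ℝ}
    (hx : x ∈ config (2 * n)) : fusionRatio a x = pairRatio a.split x := by
  have h : fusionRatio a x = pureZ a.split x / pairSqrt x := rfl
  rw [h, pureZ_eq_pairRatio (unlinked_split a) hx, mul_div_assoc, div_self (pairSqrt_pos hx).ne',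
    mul_one]

/-- Weakly increasing configurations are limits of configurations. -/
theorem neBot_nhdsWithin_config {m : ℕ} {x : Fin m → ℝ} (hx : Monotone x) :
    (𝓝[config m] x).NeBot := by
  rw [← mem_closure_iff_nhdsWithin_neBot]
  have h : Tendsto (fun t : ℝ => fun i : Fin m => x i + t * (i : ℕ)) (𝓝[>] 0) (𝓝 x) := by
    rw [tendsto_pi_nhds]
    intro i
    have : Continuous fun t : ℝ => x i + t * ((i : ℕ) : ℝ) := by fun_prop
    simpa using (this.tendsto 0).mono_left nhdsWithin_le_nhds
  refine mem_closure_of_tendsto h ?_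
  filter_upwards [self_mem_nhdsWithin] with t ht i k hik
  have h1 := hx hik.le
  have h2 : ((i : ℕ) : ℝ) < ((k : ℕ) : ℝ) := by exact_mod_cast hik
  have h3 := mul_lt_mul_of_pos_left h2 (Set.mem_Ioi.1 ht)
  simp only
  linarith

theorem neBot_fusionFilter {y : Fin n → ℝ} (hy : y ∈ config n) : (fusionFilter y).NeBot :=
  neBot_nhdsWithin_config (hy.monotone.comp fun _ _ h =>
    h.eq_or_lt.elim (fun h => h ▸ le_rfl) halve_le_halve)

theorem tendsto_fusionRatio (a : LinkPattern (fun _ : Fin n => 2)) {y : Fin n → ℝ}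
    (hy : y ∈ config n) :
    Tendsto (fusionRatio a) (fusionFilter y) (𝓝 (pairRatio a.split (y ∘ halve))) := by
  have h1 : ContinuousAt (pairRatio a.split) (y ∘ halve) :=
    (contDiffOn_pairRatio a.split).continuousOn.continuousAt
      ((isOpen_pairConfig n).mem_nhds (comp_halve_mem hy))
  refine Tendsto.congr' ?_ (h1.tendsto.mono_left nhdsWithin_le_nhds)
  filter_upwards [self_mem_nhdsWithin] with x hx
  exact (fusionRatio_eq a hx).symm

theorem fusedZ_eq (a : LinkPattern (fun _ : Fin n => 2)) {y : Fin n → ℝ}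
    (hy : y ∈ config n) : fusedZ a y = pairRatio a.split (y ∘ halve) :=
  have := neBot_fusionFilter hy
  (tendsto_fusionRatio a hy).limUnder_eq

theorem fusedZ_pos (a : LinkPattern (fun _ : Fin n => 2)) {y : Fin n → ℝ}
    (hy : y ∈ config n) : 0 < fusedZ a y := by
  rw [fusedZ_eq a hy]
  exact pairRatio_pos (unlinked_split a) hy

theorem contDiffOn_fusedZ (a : LinkPattern (fun _ : Fin n => 2)) :
    ContDiffOn ℝ ∞ (fusedZ a) (config n) := by
  have h : ContDiff ℝ ∞ fun y : Fin n → ℝ => y ∘ halve (n := n) := by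
    rw [contDiff_pi]
    exact fun k => contDiff_apply ℝ ℝ _
  exact ((contDiffOn_pairRatio a.split).comp h.contDiffOn fun y hy => comp_halve_mem hy).congr
    fun y hy => fusedZ_eq a hy

end Divided

/-! ### Möbius covariance of the fused functions -/

theorem mul_pos_of_mobius {a b c d : ℝ} (hD : 0 < a * d - b * c) {s t : ℝ} (hst : s < t)
    (hs : c * s + d ≠ 0) (ht : c * t + d ≠ 0) (h : mobius a b c d s < mobius a b c d t) :
    0 < (c * s + d) * (c * t + d) := by
  have h1 := sub_pos.2 h
  rw [mobius_sub _ _ _ _ _ _ hs ht] at h1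
  by_contra hcon
  exact absurd h1 (not_lt.2 (div_nonpos_of_nonneg_of_nonpos (mul_pos hD (sub_pos.2 hst)).le
    (not_lt.1 hcon)))

theorem fusionRatio_mobius {n : ℕ} (α : LinkPattern (fun _ : Fin n => 2)) {a b c d : ℝ}
    (hD : 0 < a * d - b * c) {x : Fin (2 * n) → ℝ} (hx : x ∈ config (2 * n))
    (hne : ∀ i, c * x i + d ≠ 0) (hφ : mobius a b c d ∘ x ∈ config (2 * n)) :
    fusionRatio α x =
      (∏ i, deriv (mobius a b c d) (x i) ^ (1 / 2 : ℝ)) * fusionRatio α (mobius a b c d ∘ x) := by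
  obtain ⟨m, hm, hm1, hm2⟩ := exists_mobius_factor hD hx hne hφ
  have h1 : pairSqrt (mobius a b c d ∘ x) =
      pairSqrt x * ∏ i, deriv (mobius a b c d) (x i) ^ (1 / 4 : ℝ) := by
    unfold pairSqrt
    rw [prod_pairs, ← Finset.prod_mul_distrib]
    refine Finset.prod_congr rfl fun j _ => ?_
    rw [Function.comp_apply, Function.comp_apply, hm2 _ _ (evenPt_lt_oddPt j),
      Real.mul_rpow (sub_pos.2 (hx (evenPt_lt_oddPt j))).le (mul_pos (hm _) (hm _)).le,
      Real.mul_rpow (hm _).le (hm _).le, hm1, hm1, ← Real.rpow_natCast, ← Real.rpow_natCast,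
      ← Real.rpow_mul (hm _).le, ← Real.rpow_mul (hm _).le]
    norm_num
  have h2 : ∏ i, deriv (mobius a b c d) (x i) ^ (1 / 2 : ℝ) =
      (∏ i, deriv (mobius a b c d) (x i) ^ (1 / 4 : ℝ)) *
        ∏ i, deriv (mobius a b c d) (x i) ^ (1 / 4 : ℝ) := by
    rw [← Finset.prod_mul_distrib]
    refine Finset.prod_congr rfl fun i _ => ?_
    have : 0 < deriv (mobius a b c d) (x i) := by rw [hm1]; exact pow_pos (hm i) 2
    rw [← Real.rpow_add this]
    norm_num
  have h3 : ∏ i, deriv (mobius a b c d) (x i) ^ (1 / 4 : ℝ) ≠ 0 :=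
    (Finset.prod_pos fun i _ => Real.rpow_pos_of_pos (by rw [hm1]; exact pow_pos (hm i) 2) _).ne'
  have h4 := (pairSqrt_pos hx).ne'
  change pureZ α.split x / pairSqrt x = _ * (pureZ α.split _ / pairSqrt (mobius a b c d ∘ x))
  rw [pureZ_covariant α.split a b c d hD x hx hne hφ, h1, h2]
  field_simp

theorem fusedZ_covariant {n : ℕ} (α : LinkPattern (fun _ : Fin n => 2)) :
    IsMobiusCovariant 1 (fusedZ α) := by
  intro a b c d hD y hy hne hφ
  have hmul : ∀ i k : Fin (2 * n), i < k →
      0 < (c * y (halve i) + d) * (c * y (halve k) + d) := by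
    intro i k hik
    rcases (halve_le_halve hik).eq_or_lt with h | h
    · rw [h]
      exact mul_self_pos.2 (hne _)
    · exact mul_pos_of_mobius hD (hy h) (hne _) (hne _) (hφ h)
  have hev : ∀ᶠ x in fusionFilter y, x ∈ config (2 * n) ∧ (∀ i, c * x i + d ≠ 0) ∧
      mobius a b c d ∘ x ∈ config (2 * n) := by
    have e1 : ∀ᶠ x in fusionFilter y, ∀ i : Fin (2 * n), c * x i + d ≠ 0 := by
      rw [eventually_all]
      intro i
      have hc : Continuous fun x : Fin (2 * n) → ℝ => c * x i + d := by fun_prop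
      exact ((hc.tendsto (y ∘ halve)).mono_left nhdsWithin_le_nhds).eventually_ne (hne (halve i))
    have e2 : ∀ᶠ x in fusionFilter y, ∀ i k : Fin (2 * n), i < k →
        0 < (c * x i + d) * (c * x k + d) := by
      rw [eventually_all]
      intro i
      rw [eventually_all]
      intro k
      by_cases hik : i < k
      · have hc : Continuous fun x : Fin (2 * n) → ℝ => (c * x i + d) * (c * x k + d) := by fun_prop
        filter_upwards [((hc.tendsto (y ∘ halve)).mono_left nhdsWithin_le_nhds).eventually_const_lt
          (hmul i k hik)] with x hx _
        exact hx
      · exact Eventually.of_forall fun x h => absurd h hik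
    filter_upwards [e1, e2, self_mem_nhdsWithin] with x h1 h2 h3
    refine ⟨h3, h1, fun i k hik => ?_⟩
    have h4 : 0 < mobius a b c d (x k) - mobius a b c d (x i) := by
      rw [mobius_sub _ _ _ _ _ _ (h1 i) (h1 k)]
      exact div_pos (mul_pos hD (sub_pos.2 (h3 hik))) (h2 i k hik)
    exact sub_pos.1 h4
  have hlim : Tendsto (fun x : Fin (2 * n) → ℝ => mobius a b c d ∘ x) (fusionFilter y)
      (fusionFilter (mobius a b c d ∘ y)) := by
    refine tendsto_nhdsWithin_iff.2 ⟨?_, hev.mono fun x hx => hx.2.2⟩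
    rw [tendsto_pi_nhds]
    intro i
    have h1 := (hasDerivAt_mobius a b c d (y (halve i)) (hne _)).continuousAt.tendsto
    exact h1.comp (((continuous_apply i).tendsto (y ∘ halve)).mono_left nhdsWithin_le_nhds)
  have hder : Tendsto (fun x : Fin (2 * n) → ℝ => ∏ i, deriv (mobius a b c d) (x i) ^ (1 / 2 : ℝ))
      (fusionFilter y) (𝓝 (∏ i : Fin (2 * n), deriv (mobius a b c d) (y (halve i)) ^ (1 / 2 : ℝ))) := by
    refine tendsto_finsetProd _ fun i _ => ?_
    rw [(hasDerivAt_mobius a b c d _ (hne (halve i))).deriv]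
    have hpos : (a * d - b * c) / (c * y (halve i) + d) ^ 2 ≠ 0 :=
      div_ne_zero hD.ne' (pow_ne_zero 2 (hne _))
    refine Tendsto.congr' (f₁ := fun x : Fin (2 * n) → ℝ =>
      ((a * d - b * c) / (c * x i + d) ^ 2) ^ (1 / 2 : ℝ)) ?_ ?_
    · filter_upwards [hev] with x hx
      rw [(hasDerivAt_mobius a b c d _ (hx.2.1 i)).deriv]
    · refine Tendsto.rpow_const (Tendsto.div tendsto_const_nhds ?_ (pow_ne_zero 2 (hne _)))
        (Or.inl hpos)
      have hc : Continuous fun x : Fin (2 * n) → ℝ => (c * x i + d) ^ 2 := by fun_prop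
      exact (hc.tendsto (y ∘ halve)).mono_left nhdsWithin_le_nhds
  have := neBot_fusionFilter hy
  have h1 := tendsto_fusionRatio α hy
  have h2 := hder.mul ((tendsto_fusionRatio α hφ).comp hlim)
  have h3 := tendsto_nhds_unique h1 (h2.congr' (hev.mono fun x hx =>
    (fusionRatio_mobius α hD hx.1 hx.2.1 hx.2.2).symm))
  rw [fusedZ_eq α hy, fusedZ_eq α hφ, h3, prod_pairs]
  congr 1
  refine Finset.prod_congr rfl fun j _ => ?_
  have hpos : 0 < deriv (mobius a b c d) (y j) := by
    rw [(hasDerivAt_mobius a b c d _ (hne j)).deriv]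
    exact div_pos hD (by have := hne j; positivity)
  rw [halve_evenPt, halve_oddPt, ← Real.rpow_add hpos]
  norm_num

/-! ### Directional derivatives -/

section Directional

variable {E : Type*} [NormedAddCommGroup E] [NormedSpace ℝ E] {U : Set E} {f : E → ℝ} {x : E}

/-- The derivative in the direction `v`. -/
noncomputable def dirD (v : E) (f : E → ℝ) (x : E) : ℝ := fderiv ℝ f x v

theorem contDiffOn_dirD (hU : IsOpen U) (hf : ContDiffOn ℝ ∞ f U) (v : E) :
    ContDiffOn ℝ ∞ (dirD v f) U :=
  (hf.fderiv_of_isOpen hU (m := ∞) (by simp)).clm_apply contDiffOn_const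

theorem differentiableAt_of_contDiffOn (hU : IsOpen U) (hf : ContDiffOn ℝ ∞ f U) (hx : x ∈ U) :
    DifferentiableAt ℝ f x :=
  (hf.differentiableOn (by simp)).differentiableAt (hU.mem_nhds hx)

theorem continuousAt_of_contDiffOn (hU : IsOpen U) (hf : ContDiffOn ℝ ∞ f U) (hx : x ∈ U) :
    ContinuousAt f x :=
  (differentiableAt_of_contDiffOn hU hf hx).continuousAt

theorem hasDerivAt_comp_curve (hU : IsOpen U) (hf : ContDiffOn ℝ ∞ f U) {c : ℝ → E} {v : E} {t : ℝ}
    (hc : HasDerivAt c v t) (ht : c t ∈ U) :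
    HasDerivAt (fun s => f (c s)) (dirD v f (c t)) t :=
  (differentiableAt_of_contDiffOn hU hf ht).hasFDerivAt.comp_hasDerivAt t hc

theorem dirD_dirD (hU : IsOpen U) (hf : ContDiffOn ℝ ∞ f U) (hx : x ∈ U) (v w : E) :
    dirD v (dirD w f) x = fderiv ℝ (fderiv ℝ f) x v w := by
  have h : DifferentiableAt ℝ (fderiv ℝ f) x :=
    ((hf.fderiv_of_isOpen hU (m := ∞) (by simp)).differentiableOn
      (by simp)).differentiableAt (hU.mem_nhds hx)
  have h1 := (h.hasFDerivAt.clm_apply (hasFDerivAt_const w x)).fderiv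
  change fderiv ℝ (fun z => fderiv ℝ f z w) x v = _
  rw [h1]
  simp

theorem fderiv_fderiv_comm (hU : IsOpen U) (hf : ContDiffOn ℝ ∞ f U) (hx : x ∈ U) (v w : E) :
    fderiv ℝ (fderiv ℝ f) x v w = fderiv ℝ (fderiv ℝ f) x w v :=
  (((hf.contDiffAt (hU.mem_nhds hx)).isSymmSndFDerivAt
    (by simp only [minSmoothness_of_isRCLikeNormedField]; exact WithTop.coe_le_coe.2 (le_top : (2 : ℕ∞) ≤ ⊤))).eq v w)

theorem dirD_comm (hU : IsOpen U) (hf : ContDiffOn ℝ ∞ f U) (hx : x ∈ U) (v w : E) :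
    dirD v (dirD w f) x = dirD w (dirD v f) x := by
  rw [dirD_dirD hU hf hx, dirD_dirD hU hf hx, fderiv_fderiv_comm hU hf hx]

theorem partialDeriv_eq_dirD {m : ℕ} {U : Set (Fin m → ℝ)} {f : (Fin m → ℝ) → ℝ} {x : Fin m → ℝ}
    (hU : IsOpen U) (hf : ContDiffOn ℝ ∞ f U) (hx : x ∈ U) (j : Fin m) :
    HasDerivAt (fun t => f (Function.update x j t)) (dirD (Pi.single j 1) f x) (x j) := by
  have h := hasDerivAt_comp_curve hU hf (c := Function.update x j) (t := x j)
    (hasDerivAt_update x j (x j)) (by rwa [Function.update_eq_self])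
  rwa [Function.update_eq_self] at h

end Directional

/-! ### The second order equations in terms of the pairs -/

section PairEquation

variable {n : ℕ}

/-- The points `m` and `m'` are the two points of the pair `j`. -/
def IsPair (j : Fin n) (m m' : Fin (2 * n)) : Prop :=
  (m = evenPt j ∧ m' = oddPt j) ∨ (m = oddPt j ∧ m' = evenPt j)

theorem IsPair.ne {j : Fin n} {m m' : Fin (2 * n)} (h : IsPair j m m') : m ≠ m' := by
  rcases h with ⟨rfl, rfl⟩ | ⟨rfl, rfl⟩
  · exact evenPt_ne_oddPt j j
  · exact (evenPt_ne_oddPt j j).symm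

theorem hasDerivAt_pairSqrt {j : Fin n} {m m' : Fin (2 * n)} (h : IsPair j m m')
    {x : Fin (2 * n) → ℝ} (hx : x ∈ config (2 * n)) :
    HasDerivAt (fun t => pairSqrt (Function.update x m t))
      (pairSqrt x * (1 / 2 / (x m - x m'))) (x m) := by
  set C := ∏ l ∈ Finset.univ.erase j, (x (oddPt l) - x (evenPt l)) ^ (1 / 2 : ℝ) with hC
  have hsplit : ∀ z : Fin (2 * n) → ℝ, (∀ l ≠ j, z (oddPt l) = x (oddPt l) ∧
      z (evenPt l) = x (evenPt l)) →
      pairSqrt z = (z (oddPt j) - z (evenPt j)) ^ (1 / 2 : ℝ) * C := by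
    intro z hz
    unfold pairSqrt
    rw [← Finset.mul_prod_erase _ _ (Finset.mem_univ j), hC]
    congr 1
    refine Finset.prod_congr rfl fun l hl => ?_
    rw [(hz l (Finset.ne_of_mem_erase hl)).1, (hz l (Finset.ne_of_mem_erase hl)).2]
  have hpos : 0 < x (oddPt j) - x (evenPt j) := sub_pos.2 (hx (evenPt_lt_oddPt j))
  have hroot : (x (oddPt j) - x (evenPt j)) ^ (1 / 2 - 1 : ℝ) =
      (x (oddPt j) - x (evenPt j)) ^ (1 / 2 : ℝ) / (x (oddPt j) - x (evenPt j)) :=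
    Real.rpow_sub_one hpos.ne' _
  have hxs := hsplit x fun _ _ => ⟨rfl, rfl⟩
  rcases h with ⟨rfl, rfl⟩ | ⟨rfl, rfl⟩
  · have h1 : ∀ t, pairSqrt (Function.update x (evenPt j) t) =
        (x (oddPt j) - t) ^ (1 / 2 : ℝ) * C := by
      intro t
      rw [hsplit, Function.update_self, Function.update_of_ne (evenPt_ne_oddPt j j).symm]
      intro l hl
      exact ⟨Function.update_of_ne (evenPt_ne_oddPt j l).symm _ _,
        Function.update_of_ne (fun h => hl (evenPt_injective h)) _ _⟩
    simp only [h1]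
    refine ((((hasDerivAt_id (x (evenPt j))).const_sub (x (oddPt j))).rpow_const
      (p := 1 / 2) (Or.inl hpos.ne')).mul_const C).congr_deriv ?_
    rw [hxs, id, hroot, ← neg_sub (x (oddPt j)) (x (evenPt j)), div_neg]
    ring
  · have h1 : ∀ t, pairSqrt (Function.update x (oddPt j) t) =
        (t - x (evenPt j)) ^ (1 / 2 : ℝ) * C := by
      intro t
      rw [hsplit, Function.update_self, Function.update_of_ne (evenPt_ne_oddPt j j)]
      intro l hl
      exact ⟨Function.update_of_ne (fun h => hl (oddPt_injective h)) _ _,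
        Function.update_of_ne (evenPt_ne_oddPt l j) _ _⟩
    simp only [h1]
    refine ((((hasDerivAt_id (x (oddPt j))).sub_const (x (evenPt j))).rpow_const
      (p := 1 / 2) (Or.inl hpos.ne')).mul_const C).congr_deriv ?_
    rw [hxs, id, hroot]
    ring

variable {α : PairPartition n}

theorem partialDeriv_pureZ_pair (hα : Unlinked α) {j : Fin n} {m m' : Fin (2 * n)}
    (h : IsPair j m m') {x : Fin (2 * n) → ℝ} (hx : x ∈ config (2 * n)) :
    partialDeriv m (pureZ α) x = (dirD (Pi.single m 1) (pairRatio α) x +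
      pairRatio α x * (1 / 2 / (x m - x m'))) * pairSqrt x := by
  have hev : (fun t => pureZ α (Function.update x m t)) =ᶠ[𝓝 (x m)]
      fun t => pairRatio α (Function.update x m t) * pairSqrt (Function.update x m t) := by
    filter_upwards [eventually_update_mem (isOpen_config _) hx m] with t ht
    exact pureZ_eq_pairRatio hα ht
  unfold partialDeriv
  rw [hev.deriv_eq]
  refine ((partialDeriv_eq_dirD (isOpen_pairConfig n) (contDiffOn_pairRatio α)
    (config_subset_pairConfig n hx) m).mul (hasDerivAt_pairSqrt h hx)).deriv.trans ?_
  rw [Function.update_eq_self]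
  ring

theorem partialDeriv_partialDeriv_pureZ_pair (hα : Unlinked α) {j : Fin n} {m m' : Fin (2 * n)}
    (h : IsPair j m m') {x : Fin (2 * n) → ℝ} (hx : x ∈ config (2 * n)) :
    partialDeriv m (partialDeriv m (pureZ α)) x =
      (dirD (Pi.single m 1) (dirD (Pi.single m 1) (pairRatio α)) x +
        dirD (Pi.single m 1) (pairRatio α) x / (x m - x m') -
        pairRatio α x * (1 / 4 / (x m - x m') ^ 2)) * pairSqrt x := by
  have hev : (fun t => partialDeriv m (pureZ α) (Function.update x m t)) =ᶠ[𝓝 (x m)]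
      fun t => (dirD (Pi.single m 1) (pairRatio α) (Function.update x m t) +
        pairRatio α (Function.update x m t) * (1 / 2 / (t - x m'))) *
          pairSqrt (Function.update x m t) := by
    filter_upwards [eventually_update_mem (isOpen_config _) hx m] with t ht
    rw [partialDeriv_pureZ_pair hα h ht, Function.update_self, Function.update_of_ne h.ne.symm]
  have hU := isOpen_pairConfig n
  have hG := contDiffOn_pairRatio α
  have hxU := config_subset_pairConfig n hx
  have hne : x m - x m' ≠ 0 := sub_ne_zero.2 (hx.injective.ne h.ne)
  have h1 : HasDerivAt (fun t => t - x m') 1 (x m) := (hasDerivAt_id _).sub_const _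
  have h2 := (hasDerivAt_const (x m) (1 / 2 : ℝ)).div h1 hne
  have h3 := (((partialDeriv_eq_dirD hU (contDiffOn_dirD hU hG (Pi.single m 1)) hxU m).add
    ((partialDeriv_eq_dirD hU hG hxU m).mul h2)).mul (hasDerivAt_pairSqrt h hx)).deriv
  change deriv (fun t => partialDeriv m (pureZ α) (Function.update x m t)) (x m) = _
  rw [hev.deriv_eq]
  refine h3.trans ?_
  simp only [Pi.add_apply, Pi.mul_apply, Pi.div_apply, Function.update_eq_self]
  field_simp
  ring

/-- The second order operator acting on `pairRatio`. -/
noncomputable def pairBPZ (j : Fin n) (m m' : Fin (2 * n)) (G : (Fin (2 * n) → ℝ) → ℝ)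
    (x : Fin (2 * n) → ℝ) : ℝ :=
  2 * dirD (Pi.single m 1) (dirD (Pi.single m 1) G) x +
    2 / (x m - x m') * (dirD (Pi.single m 1) G x - dirD (Pi.single m' 1) G x) +
    ∑ q ∈ Finset.univ.erase j,
      (2 / (x (evenPt q) - x m) * dirD (Pi.single (evenPt q) 1) G x +
        2 / (x (oddPt q) - x m) * dirD (Pi.single (oddPt q) 1) G x -
        1 / 2 * (1 / (x (evenPt q) - x m) + 1 / (x (oddPt q) - x m)) ^ 2 * G x)

theorem pairBPZ_eq_zero_of_config (hα : Unlinked α) {j : Fin n} {m m' : Fin (2 * n)}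
    (h : IsPair j m m') {x : Fin (2 * n) → ℝ} (hx : x ∈ config (2 * n)) :
    pairBPZ j m m' (pairRatio α) x = 0 := by
  have hS := (pairSqrt_pos hx).ne'
  have hbpz := pureZ_bpz α m hx
  set ψ : Fin (2 * n) → ℝ := fun i => 2 / (x i - x m) * partialDeriv i (pureZ α) x -
    2 * (1 / 4) / (x i - x m) ^ 2 * pureZ α x with hψ
  have hψm : ψ m = 0 := by simp [hψ]
  have hsum : ∑ i ∈ Finset.univ.erase m, ψ i = ψ m' +
      ∑ q ∈ Finset.univ.erase j, (ψ (evenPt q) + ψ (oddPt q)) := by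
    rw [← zero_add (∑ i ∈ Finset.univ.erase m, ψ i), ← hψm,
      Finset.add_sum_erase _ _ (Finset.mem_univ m), sum_pairs,
      ← Finset.add_sum_erase _ _ (Finset.mem_univ j)]
    congr 1
    rcases h with ⟨rfl, rfl⟩ | ⟨rfl, rfl⟩
    · rw [hψm, zero_add]
    · rw [hψm, add_zero]
  have h' : IsPair j m' m := h.symm.imp And.symm And.symm
  have hd : x m - x m' ≠ 0 := sub_ne_zero.2 (hx.injective.ne h.ne)
  have hd' : x m' - x m ≠ 0 := sub_ne_zero.2 (hx.injective.ne h.ne.symm)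
  have hm' : ψ m' = (-(2 / (x m - x m')) * dirD (Pi.single m' 1) (pairRatio α) x +
      pairRatio α x * (1 / 2 / (x m - x m') ^ 2)) * pairSqrt x := by
    simp only [hψ]
    rw [partialDeriv_pureZ_pair hα h' hx, pureZ_eq_pairRatio hα hx, ← neg_sub (x m) (x m')]
    field_simp
    ring
  have hpair : ∀ q ∈ Finset.univ.erase j, ψ (evenPt q) + ψ (oddPt q) =
      (2 / (x (evenPt q) - x m) * dirD (Pi.single (evenPt q) 1) (pairRatio α) x +
        2 / (x (oddPt q) - x m) * dirD (Pi.single (oddPt q) 1) (pairRatio α) x -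
        1 / 2 * (1 / (x (evenPt q) - x m) + 1 / (x (oddPt q) - x m)) ^ 2 * pairRatio α x) *
        pairSqrt x := by
    intro q hq
    have hqj := Finset.ne_of_mem_erase hq
    have hem : evenPt q ≠ m := by
      rintro rfl
      rcases h with ⟨h, -⟩ | ⟨h, -⟩
      · exact hqj (evenPt_injective h)
      · exact evenPt_ne_oddPt _ _ h
    have hom : oddPt q ≠ m := by
      rintro rfl
      rcases h with ⟨h, -⟩ | ⟨h, -⟩
      · exact evenPt_ne_oddPt _ _ h.symm
      · exact hqj (oddPt_injective h)
    have e1 : x (evenPt q) - x m ≠ 0 := sub_ne_zero.2 (hx.injective.ne hem)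
    have e2 : x (oddPt q) - x m ≠ 0 := sub_ne_zero.2 (hx.injective.ne hom)
    have e3 : x (oddPt q) - x (evenPt q) ≠ 0 :=
      sub_ne_zero.2 (hx.injective.ne (evenPt_ne_oddPt q q).symm)
    simp only [hψ]
    rw [partialDeriv_pureZ_pair hα (Or.inl ⟨rfl, rfl⟩ : IsPair q (evenPt q) (oddPt q)) hx,
      partialDeriv_pureZ_pair hα (Or.inr ⟨rfl, rfl⟩ : IsPair q (oddPt q) (evenPt q)) hx,
      pureZ_eq_pairRatio hα hx, ← neg_sub (x (oddPt q)) (x (evenPt q)),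
      show x (oddPt q) - x (evenPt q) = (x (oddPt q) - x m) - (x (evenPt q) - x m) by ring]
    rw [show x (oddPt q) - x (evenPt q) = (x (oddPt q) - x m) - (x (evenPt q) - x m) by ring] at e3
    generalize x (oddPt q) - x m = B at *
    generalize x (evenPt q) - x m = A at *
    field_simp
    ring
  unfold secondOrderBPZ at hbpz
  change _ + ∑ i ∈ Finset.univ.erase m, ψ i = 0 at hbpz
  rw [hsum, hm', Finset.sum_congr rfl hpair, ← Finset.sum_mul,
    partialDeriv_partialDeriv_pureZ_pair hα h hx] at hbpz
  refine (mul_eq_zero.1 (?_ : pairBPZ j m m' (pairRatio α) x * pairSqrt x = 0)).resolve_right hS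
  rw [← hbpz]
  unfold pairBPZ
  ring

theorem pairBPZ_eq_zero (hα : Unlinked α) {j : Fin n} {m m' : Fin (2 * n)}
    (h : IsPair j m m') {x : Fin (2 * n) → ℝ} (hx : x ∈ pairConfig n) (hmono : Monotone x)
    (hne : x m ≠ x m') : pairBPZ j m m' (pairRatio α) x = 0 := by
  have hU := isOpen_pairConfig n
  have hG := contDiffOn_pairRatio α
  have c0 := continuousAt_of_contDiffOn hU hG hx
  have c1 := fun v => continuousAt_of_contDiffOn hU (contDiffOn_dirD hU hG v) hx
  have c2 := fun v w =>
    continuousAt_of_contDiffOn hU (contDiffOn_dirD hU (contDiffOn_dirD hU hG v) w) hx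
  have ca : ∀ i k, ContinuousAt (fun z : Fin (2 * n) → ℝ => z i - z k) x := fun i k =>
    ((continuous_apply i).sub (continuous_apply k)).continuousAt
  have hm : halve m = j := by rcases h with ⟨rfl, -⟩ | ⟨rfl, -⟩ <;> simp
  have hq : ∀ k, halve k ≠ j → x k - x m ≠ 0 := by
    intro k hk
    rcases lt_or_gt_of_ne (hm ▸ hk : halve k ≠ halve m) with h1 | h1
    · exact (sub_neg.2 (hx _ _ h1)).ne
    · exact (sub_pos.2 (hx _ _ h1)).ne'
  have hcont : ContinuousAt (pairBPZ j m m' (pairRatio α)) x := by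
    refine ((continuousAt_const.mul (c2 _ _)).add ((continuousAt_const.div (ca _ _)
      (sub_ne_zero.2 hne)).mul ((c1 _).sub (c1 _)))).add ?_
    refine tendsto_finsetSum _ fun q hq' => ?_
    have e1 := hq (evenPt q) (by rw [halve_evenPt]; exact Finset.ne_of_mem_erase hq')
    have e2 := hq (oddPt q) (by rw [halve_oddPt]; exact Finset.ne_of_mem_erase hq')
    exact (((continuousAt_const.div (ca _ _) e1).mul (c1 _)).add
      ((continuousAt_const.div (ca _ _) e2).mul (c1 _))).sub
      ((continuousAt_const.mul (((continuousAt_const.div (ca _ _) e1).add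
        (continuousAt_const.div (ca _ _) e2)).pow 2)).mul c0)
  have := neBot_nhdsWithin_config hmono
  have hzero : Tendsto (pairBPZ j m m' (pairRatio α)) (𝓝[config (2 * n)] x) (𝓝 0) := by
    refine Tendsto.congr' (f₁ := fun _ => 0) ?_ tendsto_const_nhds
    filter_upwards [self_mem_nhdsWithin] with z hz
    exact (pairBPZ_eq_zero_of_config hα h hz).symm
  exact tendsto_nhds_unique (hcont.tendsto.mono_left nhdsWithin_le_nhds) hzero

end PairEquation

/-! ### The limit of the second order equations as the pairs collapse -/

section Fusion

variable {n : ℕ}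

/-- The direction in which both points of a pair move together. -/
noncomputable def jointDir (q : Fin n) : Fin (2 * n) → ℝ :=
  Pi.single (evenPt q) 1 + Pi.single (oddPt q) 1

/-- The direction in which the points of a pair move apart. -/
noncomputable def splitDir (q : Fin n) : Fin (2 * n) → ℝ :=
  Pi.single (oddPt q) 1 - Pi.single (evenPt q) 1

theorem jointDir_apply (q : Fin n) (k : Fin (2 * n)) :
    jointDir q k = if halve k = q then 1 else 0 := by
  rcases eq_evenPt_or_oddPt k with h | h <;> rw [h]
  · simp [jointDir, Pi.single_apply, evenPt_ne_oddPt, evenPt_injective.eq_iff]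
  · simp [jointDir, Pi.single_apply, (evenPt_ne_oddPt _ _).symm, oddPt_injective.eq_iff]

theorem splitDir_evenPt (j q : Fin n) : splitDir j (evenPt q) = if q = j then -1 else 0 := by
  by_cases h : q = j <;>
    simp [splitDir, evenPt_ne_oddPt, evenPt_injective.eq_iff, h]

theorem splitDir_oddPt (j q : Fin n) : splitDir j (oddPt q) = if q = j then 1 else 0 := by
  by_cases h : q = j <;>
    simp [splitDir, (evenPt_ne_oddPt _ _).symm, oddPt_injective.eq_iff, h]

theorem add_mul_eq_zero_of_hasDerivAt {f R : ℝ → ℝ} {f' R₀ c : ℝ} (hf : HasDerivAt f f' 0)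
    (hR : Tendsto R (𝓝[>] 0) (𝓝 R₀)) (hc : c ≠ 0)
    (h : ∀ᶠ t in 𝓝[>] (0 : ℝ), t * R t + c * f t = 0) : R₀ + c * f' = 0 := by
  have ht : Tendsto (fun t : ℝ => t) (𝓝[>] 0) (𝓝 0) := tendsto_id.mono_left nhdsWithin_le_nhds
  have hf0 : f 0 = 0 := by
    have h1 := (ht.mul hR).add
      ((hf.continuousAt.tendsto.mono_left (nhdsWithin_le_nhds (s := Set.Ioi 0))).const_mul c)
    have h2 := tendsto_nhds_unique h1 (tendsto_const_nhds.congr' (h.mono fun t ht => ht.symm))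
    rw [zero_mul, zero_add] at h2
    exact (mul_eq_zero.1 h2).resolve_left hc
  have h1 := hR.add (hf.tendsto_slope_zero_right.const_mul c)
  refine tendsto_nhds_unique h1 (tendsto_const_nhds.congr' ?_)
  filter_upwards [h, self_mem_nhdsWithin] with t h2 h3
  have h4 : t ≠ 0 := (Set.mem_Ioi.1 h3).ne'
  rw [zero_add, hf0, sub_zero, smul_eq_mul]
  field_simp
  linarith

variable {α : PairPartition n} {y : Fin n → ℝ}

/-- All pairs collapsed, except for the pair `j`, whose points are at distance `t`. -/
noncomputable def openPair (y : Fin n → ℝ) (j : Fin n) (t : ℝ) : Fin (2 * n) → ℝ :=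
  y ∘ halve + (t / 2) • splitDir j

theorem openPair_zero (y : Fin n → ℝ) (j : Fin n) : openPair y j 0 = y ∘ halve := by
  simp [openPair]

theorem openPair_evenPt (y : Fin n → ℝ) (j q : Fin n) (t : ℝ) :
    openPair y j t (evenPt q) = y q - if q = j then t / 2 else 0 := by
  simp only [openPair, Pi.add_apply, Function.comp_apply, halve_evenPt, Pi.smul_apply,
    splitDir_evenPt, smul_eq_mul]
  split_ifs <;> ring

theorem openPair_oddPt (y : Fin n → ℝ) (j q : Fin n) (t : ℝ) :
    openPair y j t (oddPt q) = y q + if q = j then t / 2 else 0 := by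
  simp only [openPair, Pi.add_apply, Function.comp_apply, halve_oddPt, Pi.smul_apply,
    splitDir_oddPt, smul_eq_mul]
  split_ifs <;> ring

theorem hasDerivAt_openPair (y : Fin n → ℝ) (j : Fin n) (t : ℝ) :
    HasDerivAt (openPair y j) ((1 / 2 : ℝ) • splitDir j) t := by
  unfold openPair
  exact (((hasDerivAt_id t).div_const 2).smul_const (splitDir j)).const_add _

theorem eventually_openPair_mem (hy : y ∈ config n) (j : Fin n) :
    ∀ᶠ t in 𝓝[>] (0 : ℝ), openPair y j t ∈ pairConfig n := by
  have h := (hasDerivAt_openPair y j 0).continuousAt.preimage_mem_nhds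
    ((isOpen_pairConfig n).mem_nhds (by rw [openPair_zero]; exact comp_halve_mem hy))
  exact nhdsWithin_le_nhds h

theorem openPair_monotone {j : Fin n} {t : ℝ} (ht : 0 < t) (h : openPair y j t ∈ pairConfig n) :
    Monotone (openPair y j t) := by
  intro i k hik
  rcases hik.eq_or_lt with rfl | hik
  · exact le_rfl
  rcases (halve_le_halve hik).eq_or_lt with hh | hh
  · rcases eq_evenPt_or_oddPt i with h1 | h1 <;> rcases eq_evenPt_or_oddPt k with h2 | h2
    · rw [h1, h2, hh]
    · rw [h1, h2, hh, openPair_evenPt, openPair_oddPt]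
      split_ifs <;> linarith
    · rw [h1, h2, hh] at hik
      exact absurd hik (evenPt_lt_oddPt _).asymm
    · rw [h1, h2, hh]
  · exact (h _ _ hh).le

/-- The equations for the two points of the pair `j`, when all the other pairs are collapsed. -/
theorem openPair_equations (hα : Unlinked α) {j : Fin n} {t : ℝ} (ht : 0 < t)
    (h : openPair y j t ∈ pairConfig n) :
    (2 * fderiv ℝ (fderiv ℝ (pairRatio α)) (openPair y j t) (Pi.single (evenPt j) 1)
        (Pi.single (evenPt j) 1) + 2 / t * dirD (splitDir j) (pairRatio α) (openPair y j t) +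
      ∑ q ∈ Finset.univ.erase j, (2 / (y q - y j + t / 2) *
        dirD (jointDir q) (pairRatio α) (openPair y j t) -
        2 / (y q - y j + t / 2) ^ 2 * pairRatio α (openPair y j t)) = 0) ∧
    (2 * fderiv ℝ (fderiv ℝ (pairRatio α)) (openPair y j t) (Pi.single (oddPt j) 1)
        (Pi.single (oddPt j) 1) + 2 / t * dirD (splitDir j) (pairRatio α) (openPair y j t) +
      ∑ q ∈ Finset.univ.erase j, (2 / (y q - y j - t / 2) *
        dirD (jointDir q) (pairRatio α) (openPair y j t) -
        2 / (y q - y j - t / 2) ^ 2 * pairRatio α (openPair y j t)) = 0) := by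
  have hU := isOpen_pairConfig n
  have hG := contDiffOn_pairRatio α
  have hmono := openPair_monotone ht h
  have ve : openPair y j t (evenPt j) = y j - t / 2 := by rw [openPair_evenPt, if_pos rfl]
  have vo : openPair y j t (oddPt j) = y j + t / 2 := by rw [openPair_oddPt, if_pos rfl]
  have he := pairBPZ_eq_zero hα (Or.inl ⟨rfl, rfl⟩ : IsPair j (evenPt j) (oddPt j)) h hmono
    (by rw [ve, vo]; intro h; linarith)
  have ho := pairBPZ_eq_zero hα (Or.inr ⟨rfl, rfl⟩ : IsPair j (oddPt j) (evenPt j)) h hmono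
    (by rw [ve, vo]; intro h; linarith)
  unfold pairBPZ at he ho
  rw [dirD_dirD hU hG h, ve, vo] at he ho
  have ht' : t ≠ 0 := ht.ne'
  constructor
  · rw [← he]
    congr 1
    · congr 1
      simp only [dirD, splitDir, map_sub]
      rw [show y j - t / 2 - (y j + t / 2) = -t by ring, div_neg]
      ring
    · refine Finset.sum_congr rfl fun q hq => ?_
      rw [openPair_evenPt, openPair_oddPt, if_neg (Finset.ne_of_mem_erase hq)]
      simp only [dirD, jointDir, map_add, sub_zero, add_zero]
      rw [show y q - (y j - t / 2) = y q - y j + t / 2 by ring]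
      generalize y q - y j + t / 2 = A
      ring
  · rw [← ho]
    congr 1
    · congr 1
      simp only [dirD, splitDir, map_sub]
      rw [show y j + t / 2 - (y j - t / 2) = t by ring]
    · refine Finset.sum_congr rfl fun q hq => ?_
      rw [openPair_evenPt, openPair_oddPt, if_neg (Finset.ne_of_mem_erase hq)]
      simp only [dirD, jointDir, map_add, sub_zero, add_zero]
      rw [show y q - (y j + t / 2) = y q - y j - t / 2 by ring]
      generalize y q - y j - t / 2 = A
      ring

theorem tendsto_comp_openPair {f : (Fin (2 * n) → ℝ) → ℝ} (hf : ContDiffOn ℝ ∞ f (pairConfig n))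
    (hy : y ∈ config n) (j : Fin n) :
    Tendsto (fun t => f (openPair y j t)) (𝓝[>] 0) (𝓝 (f (y ∘ halve))) := by
  have h1 := continuousAt_of_contDiffOn (isOpen_pairConfig n) hf (comp_halve_mem hy)
  rw [← openPair_zero y j] at h1 ⊢
  exact (h1.tendsto.comp (hasDerivAt_openPair y j 0).continuousAt.tendsto).mono_left
    nhdsWithin_le_nhds

theorem hasDerivAt_comp_openPair {f : (Fin (2 * n) → ℝ) → ℝ} (hf : ContDiffOn ℝ ∞ f (pairConfig n))
    (hy : y ∈ config n) (j : Fin n) :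
    HasDerivAt (fun t => f (openPair y j t)) (1 / 2 * dirD (splitDir j) f (y ∘ halve)) 0 := by
  have h1 := hasDerivAt_comp_curve (isOpen_pairConfig n) hf (hasDerivAt_openPair y j 0)
    (by rw [openPair_zero]; exact comp_halve_mem hy)
  rw [openPair_zero] at h1
  refine h1.congr_deriv ?_
  simp [dirD]

theorem sub_ne_zero_of_config (hy : y ∈ config n) {j q : Fin n} (hq : q ∈ Finset.univ.erase j) :
    y q - y j ≠ 0 :=
  sub_ne_zero.2 (hy.injective.ne (Finset.ne_of_mem_erase hq))

/-- The limit of the sum of the equations for the two points of a pair. -/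
theorem fused_sum_equation (hα : Unlinked α) (hy : y ∈ config n) (j : Fin n) :
    dirD (jointDir j) (dirD (jointDir j) (pairRatio α)) (y ∘ halve) +
      3 * dirD (splitDir j) (dirD (splitDir j) (pairRatio α)) (y ∘ halve) +
      ∑ q ∈ Finset.univ.erase j, (4 / (y q - y j) * dirD (jointDir q) (pairRatio α) (y ∘ halve) -
        4 / (y q - y j) ^ 2 * pairRatio α (y ∘ halve)) = 0 := by
  have hU := isOpen_pairConfig n
  have hG := contDiffOn_pairRatio α
  have hD := fun v => contDiffOn_dirD hU hG v
  have hDD := fun v w => contDiffOn_dirD hU (hD v) w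
  have ht : Tendsto (fun t : ℝ => t / 2) (𝓝[>] 0) (𝓝 0) := by
    have : Continuous fun t : ℝ => t / 2 := by fun_prop
    simpa using (this.tendsto 0).mono_left (nhdsWithin_le_nhds (s := Set.Ioi 0))
  have hA : ∀ q, Tendsto (fun t : ℝ => y q - y j + t / 2) (𝓝[>] 0) (𝓝 (y q - y j)) := fun q => by
    simpa using ht.const_add (y q - y j)
  have hB : ∀ q, Tendsto (fun t : ℝ => y q - y j - t / 2) (𝓝[>] 0) (𝓝 (y q - y j)) := fun q => by
    simpa using ht.const_sub (y q - y j)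
  have hR := ((tendsto_comp_openPair (hDD (jointDir j) (jointDir j)) hy j).add
    (tendsto_comp_openPair (hDD (splitDir j) (splitDir j)) hy j)).add
    (tendsto_finsetSum (Finset.univ.erase j) fun q hq =>
      (((tendsto_const_nhds (x := (2 : ℝ))).div (hA q) (sub_ne_zero_of_config hy hq)).add
        ((tendsto_const_nhds (x := (2 : ℝ))).div (hB q) (sub_ne_zero_of_config hy hq))).mul
        (tendsto_comp_openPair (hD (jointDir q)) hy j) |>.sub
      ((((tendsto_const_nhds (x := (2 : ℝ))).div ((hA q).pow 2)
        (pow_ne_zero 2 (sub_ne_zero_of_config hy hq))).add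
        ((tendsto_const_nhds (x := (2 : ℝ))).div ((hB q).pow 2)
        (pow_ne_zero 2 (sub_ne_zero_of_config hy hq)))).mul (tendsto_comp_openPair hG hy j)))
  simp only [Pi.div_apply] at hR
  have key := add_mul_eq_zero_of_hasDerivAt (hasDerivAt_comp_openPair (hD (splitDir j)) hy j) hR
    (c := 4) (by norm_num) ?_
  · rw [← key]
    have e : ∀ q ∈ Finset.univ.erase j,
        (4 / (y q - y j) * dirD (jointDir q) (pairRatio α) (y ∘ halve) -
        4 / (y q - y j) ^ 2 * pairRatio α (y ∘ halve)) =
        (2 / (y q - y j) + 2 / (y q - y j)) * dirD (jointDir q) (pairRatio α) (y ∘ halve) -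
        (2 / (y q - y j) ^ 2 + 2 / (y q - y j) ^ 2) * pairRatio α (y ∘ halve) := fun q _ => by ring
    rw [Finset.sum_congr rfl e]
    ring
  · filter_upwards [eventually_openPair_mem hy j, self_mem_nhdsWithin] with t h1 h2
    have ht0 : t ≠ 0 := (Set.mem_Ioi.1 h2).ne'
    obtain ⟨he, ho⟩ := openPair_equations hα h2 h1
    have hsum := congrArg₂ (· + ·) he ho
    simp only [add_zero] at hsum
    rw [dirD_dirD hU hG h1, dirD_dirD hU hG h1]
    simp only [jointDir, splitDir, map_add, map_sub, add_apply,
      sub_apply] at hsum ⊢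
    have e := Finset.sum_add_distrib (s := Finset.univ.erase j)
      (f := fun q => 2 / (y q - y j + t / 2) *
        dirD (jointDir q) (pairRatio α) (openPair y j t) -
        2 / (y q - y j + t / 2) ^ 2 * pairRatio α (openPair y j t))
      (g := fun q => 2 / (y q - y j - t / 2) *
        dirD (jointDir q) (pairRatio α) (openPair y j t) -
        2 / (y q - y j - t / 2) ^ 2 * pairRatio α (openPair y j t))
    simp only [jointDir] at e
    have e2 : ∀ q, (2 / (y q - y j + t / 2) + 2 / (y q - y j - t / 2)) *
        dirD (Pi.single (evenPt q) 1 + Pi.single (oddPt q) 1) (pairRatio α) (openPair y j t) -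
        (2 / (y q - y j + t / 2) ^ 2 + 2 / (y q - y j - t / 2) ^ 2) *
          pairRatio α (openPair y j t) =
        (2 / (y q - y j + t / 2) *
        dirD (Pi.single (evenPt q) 1 + Pi.single (oddPt q) 1) (pairRatio α) (openPair y j t) -
        2 / (y q - y j + t / 2) ^ 2 * pairRatio α (openPair y j t)) +
        (2 / (y q - y j - t / 2) *
        dirD (Pi.single (evenPt q) 1 + Pi.single (oddPt q) 1) (pairRatio α) (openPair y j t) -
        2 / (y q - y j - t / 2) ^ 2 * pairRatio α (openPair y j t)) := fun q => by ring
    rw [Finset.sum_congr rfl fun q _ => e2 q, e]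
    have hsum2 := congrArg (t * ·) hsum
    simp only [mul_zero] at hsum2
    rw [← hsum2]
    field_simp
    ring

/-- The limit of the difference of the equations for the two points of a pair. -/
theorem fused_difference_equation (hα : Unlinked α) (hy : y ∈ config n) (j : Fin n) :
    dirD (jointDir j) (dirD (splitDir j) (dirD (splitDir j) (pairRatio α))) (y ∘ halve) +
      ∑ q ∈ Finset.univ.erase j, (2 / (y q - y j) ^ 2 *
        dirD (jointDir q) (pairRatio α) (y ∘ halve) -
        4 / (y q - y j) ^ 3 * pairRatio α (y ∘ halve)) = 0 := by
  have hU := isOpen_pairConfig n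
  have hG := contDiffOn_pairRatio α
  have hD := fun v => contDiffOn_dirD hU hG v
  have hDD := fun v w => contDiffOn_dirD hU (hD v) w
  have ht : Tendsto (fun t : ℝ => t / 2) (𝓝[>] 0) (𝓝 0) := by
    have : Continuous fun t : ℝ => t / 2 := by fun_prop
    simpa using (this.tendsto 0).mono_left (nhdsWithin_le_nhds (s := Set.Ioi 0))
  have hA : ∀ q, Tendsto (fun t : ℝ => y q - y j + t / 2) (𝓝[>] 0) (𝓝 (y q - y j)) := fun q => by
    simpa using ht.const_add (y q - y j)
  have hB : ∀ q, Tendsto (fun t : ℝ => y q - y j - t / 2) (𝓝[>] 0) (𝓝 (y q - y j)) := fun q => by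
    simpa using ht.const_sub (y q - y j)
  have hR := tendsto_finsetSum (Finset.univ.erase j) fun q hq =>
      ((tendsto_const_nhds (x := (2 : ℝ))).div ((hA q).mul (hB q))
        (mul_ne_zero (sub_ne_zero_of_config hy hq) (sub_ne_zero_of_config hy hq))).mul
        (tendsto_comp_openPair (hD (jointDir q)) hy j) |>.sub
      ((((hA q).add (hB q)).const_mul 2 |>.div (((hA q).mul (hB q)).pow 2)
        (pow_ne_zero 2 (mul_ne_zero (sub_ne_zero_of_config hy hq)
          (sub_ne_zero_of_config hy hq)))).mul (tendsto_comp_openPair hG hy j))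
  simp only [Pi.div_apply] at hR
  have key := add_mul_eq_zero_of_hasDerivAt
    (hasDerivAt_comp_openPair (hDD (splitDir j) (jointDir j)) hy j) hR
    (c := 2) (by norm_num) ?_
  · rw [← key, dirD_comm hU (hD (splitDir j)) (comp_halve_mem hy) (splitDir j) (jointDir j),
      add_comm]
    congr 1
    · refine Finset.sum_congr rfl fun q hq => ?_
      have := sub_ne_zero_of_config hy hq
      field_simp
      ring
    · ring
  · have hAB : ∀ᶠ t in 𝓝[>] (0 : ℝ), ∀ q ∈ Finset.univ.erase j,
        y q - y j + t / 2 ≠ 0 ∧ y q - y j - t / 2 ≠ 0 := by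
      rw [Filter.eventually_all_finset]
      intro q hq
      exact ((hA q).eventually_ne (sub_ne_zero_of_config hy hq)).and
        ((hB q).eventually_ne (sub_ne_zero_of_config hy hq))
    filter_upwards [eventually_openPair_mem hy j, self_mem_nhdsWithin, hAB] with t h1 h2 h3
    obtain ⟨he, ho⟩ := openPair_equations hα h2 h1
    rw [dirD_dirD hU hG h1]
    have hsym := fderiv_fderiv_comm hU hG h1 (Pi.single (oddPt j) 1) (Pi.single (evenPt j) 1)
    have e : ∀ q ∈ Finset.univ.erase j, t * (2 / ((y q - y j + t / 2) * (y q - y j - t / 2)) *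
        dirD (jointDir q) (pairRatio α) (openPair y j t) -
        2 * (y q - y j + t / 2 + (y q - y j - t / 2)) /
          ((y q - y j + t / 2) * (y q - y j - t / 2)) ^ 2 * pairRatio α (openPair y j t)) =
        (2 / (y q - y j - t / 2) * dirD (jointDir q) (pairRatio α) (openPair y j t) -
        2 / (y q - y j - t / 2) ^ 2 * pairRatio α (openPair y j t)) -
        (2 / (y q - y j + t / 2) * dirD (jointDir q) (pairRatio α) (openPair y j t) -
        2 / (y q - y j + t / 2) ^ 2 * pairRatio α (openPair y j t)) := by
      intro q hq
      obtain ⟨a1, a2⟩ := h3 q hq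
      have ht : t = (y q - y j + t / 2) - (y q - y j - t / 2) := by ring
      generalize y q - y j + t / 2 = A at *
      generalize y q - y j - t / 2 = B at *
      rw [ht]
      field_simp
      ring
    rw [Finset.mul_sum, Finset.sum_congr rfl e, Finset.sum_sub_distrib]
    have e2 : fderiv ℝ (fderiv ℝ (pairRatio α)) (openPair y j t) (jointDir j) (splitDir j) =
        fderiv ℝ (fderiv ℝ (pairRatio α)) (openPair y j t) (Pi.single (oddPt j) 1)
          (Pi.single (oddPt j) 1) -
        fderiv ℝ (fderiv ℝ (pairRatio α)) (openPair y j t) (Pi.single (evenPt j) 1)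
          (Pi.single (evenPt j) 1) := by
      simp only [jointDir, splitDir, map_add, map_sub, add_apply]
      rw [hsym]
      ring
    rw [e2]
    linear_combination ho - he

/-! ### The third order equations -/

theorem hasDerivAt_comp_halve {f : (Fin (2 * n) → ℝ) → ℝ} (hf : ContDiffOn ℝ ∞ f (pairConfig n))
    (hy : y ∈ config n) (j : Fin n) :
    HasDerivAt (fun t => f (Function.update y j t ∘ halve)) (dirD (jointDir j) f (y ∘ halve))
      (y j) := by
  have hc : HasDerivAt (fun t => Function.update y j t ∘ halve (n := n)) (jointDir j) (y j) := by
    rw [hasDerivAt_pi]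
    intro k
    rw [jointDir_apply]
    exact hasDerivAt_update_apply y j (halve k) (y j)
  have h := hasDerivAt_comp_curve (isOpen_pairConfig n) hf hc
    (by rw [Function.update_eq_self]; exact comp_halve_mem hy)
  rwa [Function.update_eq_self] at h

theorem partialDeriv_of_eq_comp_halve {g : (Fin n → ℝ) → ℝ} {f : (Fin (2 * n) → ℝ) → ℝ}
    (hf : ContDiffOn ℝ ∞ f (pairConfig n)) (h : ∀ y ∈ config n, g y = f (y ∘ halve)) (j : Fin n) :
    ∀ y ∈ config n, partialDeriv j g y = dirD (jointDir j) f (y ∘ halve) := by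
  intro y hy
  have hev : (fun t => g (Function.update y j t)) =ᶠ[𝓝 (y j)]
      fun t => f (Function.update y j t ∘ halve) := by
    filter_upwards [eventually_update_mem (isOpen_config _) hy j] with t ht
    exact h _ ht
  unfold partialDeriv
  rw [hev.deriv_eq, (hasDerivAt_comp_halve hf hy j).deriv]

/-- The derivative of `fused_sum_equation` with respect to the position of the pair. -/
theorem deriv_fused_sum_equation (hα : Unlinked α) (hy : y ∈ config n) (j : Fin n) :
    dirD (jointDir j) (dirD (jointDir j) (dirD (jointDir j) (pairRatio α))) (y ∘ halve) +
      3 * dirD (jointDir j) (dirD (splitDir j) (dirD (splitDir j) (pairRatio α))) (y ∘ halve) +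
      ∑ q ∈ Finset.univ.erase j,
        (4 / (y q - y j) ^ 2 * dirD (jointDir q) (pairRatio α) (y ∘ halve) +
        4 / (y q - y j) * dirD (jointDir j) (dirD (jointDir q) (pairRatio α)) (y ∘ halve) -
        (8 / (y q - y j) ^ 3 * pairRatio α (y ∘ halve) +
        4 / (y q - y j) ^ 2 * dirD (jointDir j) (pairRatio α) (y ∘ halve))) = 0 := by
  have hU := isOpen_pairConfig n
  have hG := contDiffOn_pairRatio α
  have hD := fun v => contDiffOn_dirD hU hG v
  have hDD := fun v w => contDiffOn_dirD hU (hD v) w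
  have hsub : ∀ q, HasDerivAt (fun t => y q - t) (-1) (y j) := fun q =>
    (hasDerivAt_id (y j)).const_sub (y q)
  have h1 : ∀ q ∈ Finset.univ.erase j, HasDerivAt (fun t => 4 / (y q - t)) (4 / (y q - y j) ^ 2)
      (y j) := fun q hq =>
    ((hasDerivAt_const (y j) (4 : ℝ)).div (hsub q) (sub_ne_zero_of_config hy hq)).congr_deriv
      (by ring)
  have h2 : ∀ q ∈ Finset.univ.erase j, HasDerivAt (fun t => 4 / (y q - t) ^ 2)
      (8 / (y q - y j) ^ 3) (y j) := fun q hq =>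
    ((hasDerivAt_const (y j) (4 : ℝ)).div ((hsub q).pow 2)
      (pow_ne_zero 2 (sub_ne_zero_of_config hy hq))).congr_deriv
      (by have := sub_ne_zero_of_config hy hq
          simp only [Pi.pow_apply]
          field_simp
          ring)
  have hder := ((hasDerivAt_comp_halve (hDD (jointDir j) (jointDir j)) hy j).add
    ((hasDerivAt_comp_halve (hDD (splitDir j) (splitDir j)) hy j).const_mul 3)).add
    (HasDerivAt.fun_sum (u := Finset.univ.erase j) fun q hq =>
      ((h1 q hq).mul (hasDerivAt_comp_halve (hD (jointDir q)) hy j)).sub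
        ((h2 q hq).mul (hasDerivAt_comp_halve hG hy j)))
  have hzero : HasDerivAt (fun _ : ℝ => (0 : ℝ)) 0 (y j) := hasDerivAt_const _ _
  simp only [Function.update_eq_self] at hder
  refine (hder.congr_of_eventuallyEq (f₁ := fun _ => 0) ?_).unique hzero
  filter_upwards [eventually_update_mem (isOpen_config _) hy j] with t ht
  have h3 := fused_sum_equation hα ht j
  rw [Function.update_self] at h3
  refine h3.symm.trans ?_
  refine congrArg₂ (· + ·) rfl (Finset.sum_congr rfl fun q hq => ?_)
  rw [Function.update_of_ne (Finset.ne_of_mem_erase hq)]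
  rfl

theorem fusedZ_thirdOrderBPZ (a : LinkPattern (fun _ : Fin n => 2)) (j : Fin n)
    (hy : y ∈ config n) : thirdOrderBPZ 4 1 j (fusedZ a) y = 0 := by
  have hU := isOpen_pairConfig n
  have hG := contDiffOn_pairRatio a.split
  have hD := fun v => contDiffOn_dirD hU hG v
  have hDD := fun v w => contDiffOn_dirD hU (hD v) w
  have p0 := fun y hy => fusedZ_eq a (y := y) hy
  have p1 := fun i => partialDeriv_of_eq_comp_halve hG p0 i
  have p2 := fun i => partialDeriv_of_eq_comp_halve (hD (jointDir j)) (p1 j) i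
  have p3 := partialDeriv_of_eq_comp_halve (hDD (jointDir j) (jointDir j)) (p2 j) j
  have hs := deriv_fused_sum_equation (unlinked_split a) hy j
  have hd := fused_difference_equation (unlinked_split a) hy j
  unfold thirdOrderBPZ opL2 opL3
  simp only [p0 y hy, p1 _ y hy, p2 _ y hy, p3 y hy]
  have e : ∀ q ∈ Finset.univ.erase j,
      (4 / (y q - y j) ^ 2 * dirD (jointDir q) (pairRatio a.split) (y ∘ halve) +
        4 / (y q - y j) * dirD (jointDir j) (dirD (jointDir q) (pairRatio a.split)) (y ∘ halve) -
        (8 / (y q - y j) ^ 3 * pairRatio a.split (y ∘ halve) +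
        4 / (y q - y j) ^ 2 * dirD (jointDir j) (pairRatio a.split) (y ∘ halve))) =
      -4 * (1 / (y q - y j) ^ 2 * dirD (jointDir j) (pairRatio a.split) (y ∘ halve) -
        1 / (y q - y j) * dirD (jointDir q) (dirD (jointDir j) (pairRatio a.split)) (y ∘ halve)) +
      2 * (2 * 1 / (y q - y j) ^ 3 * pairRatio a.split (y ∘ halve) -
        1 / (y q - y j) ^ 2 * dirD (jointDir q) (pairRatio a.split) (y ∘ halve)) +
      3 * (2 / (y q - y j) ^ 2 * dirD (jointDir q) (pairRatio a.split) (y ∘ halve) -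
        4 / (y q - y j) ^ 3 * pairRatio a.split (y ∘ halve)) := by
    intro q _
    rw [dirD_comm hU hG (comp_halve_mem hy) (jointDir q) (jointDir j)]
    ring
  rw [Finset.sum_congr rfl e, Finset.sum_add_distrib, Finset.sum_add_distrib, ← Finset.mul_sum,
    ← Finset.mul_sum, ← Finset.mul_sum] at hs
  linear_combination hs - 3 * hd

end Fusion

/-! ### The main theorem -/

theorem pureZ_isPurePartitionCollection : IsPurePartitionCollection 4 (fun _ α => pureZ α) := by
  have h4 : ((6 : ℝ) - 4) / (2 * 4) = 1 / 4 := by norm_num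
  have h2 : (-2 : ℝ) * (1 / 4) = -(1 / 2) := by norm_num
  constructor
  · exact pureZ_zero
  · exact fun N α x hx => pureZ_pos α hx
  · exact fun N α => contDiffOn_pureZ α
  · intro N α j x hx
    rw [h4]
    exact pureZ_bpz α j hx
  · intro N α
    rw [h4]
    exact pureZ_covariant α
  · intro N α j k hjk x ξ hx hlt hgt
    rw [h4, h2]
    exact pureZ_asymptotics hjk α hx hlt hgt
  · exact fun N α => pureZ_bound α

theorem proposition1p2 :
    IsPurePartitionCollection 4 (fun _ α => pureZ α) ∧
    ∀ N : ℕ, 1 ≤ N → ∀ a : LinkPattern (fun _ : Fin (2 * N) => 2),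
      (∀ y ∈ config (2 * N), Tendsto (fusionRatio a) (fusionFilter y) (𝓝 (fusedZ a y))) ∧
      (∀ y ∈ config (2 * N), 0 < fusedZ a y) ∧
      ContDiffOn ℝ ∞ (fusedZ a) (config (2 * N)) ∧
      (∀ j : Fin (2 * N), ∀ y ∈ config (2 * N), thirdOrderBPZ 4 1 j (fusedZ a) y = 0) ∧
      IsMobiusCovariant 1 (fusedZ a) := by
  refine ⟨pureZ_isPurePartitionCollection, fun N _ a => ⟨fun y hy => ?_, fun y hy => fusedZ_pos a hy,
    contDiffOn_fusedZ a, fun j y hy => fusedZ_thirdOrderBPZ a j hy, fusedZ_covariant a⟩⟩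
  rw [fusedZ_eq a hy]
  exact tendsto_fusionRatio a hy
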